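/- **Setting.** Let $\zeta:\mathcal X\times\mathcal X\to\mathbb R$ and $\eta:\mathcal Y\times\mathcal Y\to\mathbb R$ be symmetric measurable kernels. Let $k\ge 0$ be an even measurable function on $\mathbb R$ with $\int k=1$ and $\int k^{2+\delta}<\infty$ for some $\delta>0$, and put $\kappa_b(z_1,z_2)=k\big(\tfrac{z_1-z_2}{b}\big)$ for $b>0$. Let $Z$ be a real random variable with density $g$, $E[g^3(Z)]<\infty$, and let $D$ be the support of its law. Put $$F_i(z)=\int k^i(u)\,\mathbf 1\{z+bu\in D\}\,du,\quad A_1=\int F_1g^2,\quad A_2=\int F_1^2g^3,\quad A_3=\int F_2g^2$$ (these depend on $b$). Let $(X_i,Y_i,Z_i)$, $i\ge1$, be i.i.d., with $Z_i\sim Z$ independent of $(X_i,Y_i)\sim\omega$, and assume $E\zeta^2(X_1,X_2)<\infty$, $E\eta^2(Y_1,Y_2)<\infty$. With $P^n_r=n!/(n-r)!$ ($P^n_r=0$ for $r>n$) and sums over pairwise distinct indices in $\{1,\dots,n\}$, let $$T_{n,b}=\frac1{P^n_2}\sum_{i,j}\zeta(X_i,X_j)\eta(Y_i,Y_j)\kappa_b(Z_i,Z_j)-\frac2{P^n_3}\sum_{i,j,s}\zeta(X_i,X_j)\eta(Y_i,Y_s)\kappa_b(Z_i,Z_s)+\frac1{P^n_4}\sum_{i,j,s,t}\zeta(X_i,X_j)\eta(Y_s,Y_t)\kappa_b(Z_s,Z_t),$$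 $$S^2_{n,b}=\frac{2(n-4)(n-5)}{n^2(n-1)^2(n-2)(n-3)}\sum_{i\ne j}\big[(H\boldsymbol\zeta H)_{ij}(H\boldsymbol\varrho H)_{ij}\big]^2,$$ where $H=I-\frac1n\mathbf 1\mathbf 1^\top$, and $\boldsymbol\zeta$, $\boldsymbol\varrho$ are the $n\times n$ matrices with entries $\zeta(X_i,X_j)$ and $\eta(Y_i,Y_j)\kappa_b(Z_i,Z_j)$ (diagonal included). Put $$V_\zeta=E[\zeta^2(X_1,X_2)]-2E[\zeta(X_1,X_2)\zeta(X_1,X_3)]+\big(E\zeta(X_1,X_2)\big)^2,$$ $$v_{n,b}=\frac{2b\,P^{n-4}_2}{P^n_4}\,V_\zeta\,\Big\{A_3E[\eta^2(Y_1,Y_2)]-2A_2b\,E[\eta(Y_1,Y_2)\eta(Y_1,Y_3)]+A_1^2b\,\big(E\eta(Y_1,Y_2)\big)^2\Big\}.$$ **Proposition.** Assume the null hypothesis $\omega=\mu\otimes\nu$, i.e. $X$ and $Y$ are independent. 1. Suppose that $g$ is Lipschitz on $D$ and $\int|u|\,k^2(u)\,du<\infty$. Then for every $c>0$ there is a constant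 $C$ such that, for all $n\ge4$ and $b>0$ with $nb\ge c$, $T_{n,b}$ is square integrable and $$\big|\mathrm{var}(T_{n,b})-v_{n,b}\big|\le C\,\frac{b^2}{n^2}.$$ 2. If $V_\zeta\ne0$ and $E\eta^2(Y_1,Y_2)\ne0$, then the leading term has exact order $b/n^2$: $v_{n,b_n}=\Theta(b_n/n^2)$ whenever $b_n>0$, $b_n\to0$ and $nb_n\to\infty$. 3. Suppose that $E|\zeta(X_1,X_2)|^{2+\delta}<\infty$, $E|\eta(Y_1,Y_2)|^{2+\delta}<\infty$, $E|\zeta(X_1,X_1)|<\infty$ and $E|\eta(Y_1,Y_1)|<\infty$. If $b_n>0$, $b_n\to0$ and $nb_n\to\infty$, then $S^2_{n,b_n}$ is a consistent estimator of $\mathrm{var}(T_{n,b_n})$ on the scale $b_n/n^2$: $$\frac{n^2}{b_n}\big(S^2_{n,b_n}-\mathrm{var}(T_{n,b_n})\big)\to0\quad\text{in probability},$$ and if moreover $V_\zeta\ne0$ and $E\eta^2(Y_1,Y_2)\ne0$, then $S^2_{n,b_n}/\mathrm{var}(T_{n,b_n})\to1$ in probability. -/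

import Mathlib

open MeasureTheory ProbabilityTheory Filter Topology

noncomputable section

namespace RandomLifter

/-- The law of a real random variable with density `g`. -/
def lifterLaw (g : ℝ → ℝ) : Measure ℝ :=
  volume.withDensity (fun z => ENNReal.ofReal (g z))

/-- The support `D` of the random lifter: the topological support of its law. -/
def lifterSupport (g : ℝ → ℝ) : Set ℝ := (lifterLaw g).support

/-- The kernel `κ_b(z₁, z₂) = k((z₁ - z₂) / b)`. -/
def kappa (k : ℝ → ℝ) (b z₁ z₂ : ℝ) : ℝ := k ((z₁ - z₂) / b)

/-- `F_i(z) = ∫ k(u)^i 1{z + b u ∈ D} du`. -/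
def F (k g : ℝ → ℝ) (b : ℝ) (i : ℕ) (z : ℝ) : ℝ :=
  ∫ u in {u : ℝ | z + b * u ∈ lifterSupport g}, k u ^ i

def A₁ (k g : ℝ → ℝ) (b : ℝ) : ℝ := ∫ z, F k g b 1 z * g z ^ 2

def A₂ (k g : ℝ → ℝ) (b : ℝ) : ℝ := ∫ z, F k g b 1 z ^ 2 * g z ^ 3

def A₃ (k g : ℝ → ℝ) (b : ℝ) : ℝ := ∫ z, F k g b 2 z * g z ^ 2

section Moments

variable {S : Type*} [MeasurableSpace S]

/-- `E φ(X₁, X₂)` for `X₁, X₂` i.i.d. with law `μ`. -/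
def mean (φ : S → S → ℝ) (μ : Measure S) : ℝ := ∫ p, φ p.1 p.2 ∂(μ.prod μ)

/-- `E φ(X₁, X₂)²` for `X₁, X₂` i.i.d. with law `μ`. -/
def meanSq (φ : S → S → ℝ) (μ : Measure S) : ℝ := ∫ p, φ p.1 p.2 ^ 2 ∂(μ.prod μ)

/-- `E [φ(X₁, X₂) φ(X₁, X₃)]` for `X₁, X₂, X₃` i.i.d. with law `μ`. -/
def meanCross (φ : S → S → ℝ) (μ : Measure S) : ℝ :=
  ∫ p, φ p.1 p.2.1 * φ p.1 p.2.2 ∂(μ.prod (μ.prod μ))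

/-- `E φ²(X₁, X₂) - 2 E [φ(X₁, X₂) φ(X₁, X₃)] + (E φ(X₁, X₂))²`. -/
def centredSq (φ : S → S → ℝ) (μ : Measure S) : ℝ :=
  meanSq φ μ - 2 * meanCross φ μ + mean φ μ ^ 2

end Moments

section Statistics

variable {𝒳 𝒴 : Type*}

/-- The statistic `T_{n,b}` of a sample `(x i, y i, z i)`, `i < n`. A sum over `r` pairwise distinct
indices is a sum over the embeddings of `Fin r` in `Fin n`; `n.descFactorial r = n! / (n - r)!`. -/
def T (ζ : 𝒳 → 𝒳 → ℝ) (η : 𝒴 → 𝒴 → ℝ) (k : ℝ → ℝ) (n : ℕ) (b : ℝ)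
    (x : ℕ → 𝒳) (y : ℕ → 𝒴) (z : ℕ → ℝ) : ℝ :=
  1 / (n.descFactorial 2 : ℝ) * ∑ σ : Fin 2 ↪ Fin n,
      ζ (x (σ 0)) (x (σ 1)) * η (y (σ 0)) (y (σ 1)) * kappa k b (z (σ 0)) (z (σ 1))
  - 2 / (n.descFactorial 3 : ℝ) * ∑ σ : Fin 3 ↪ Fin n,
      ζ (x (σ 0)) (x (σ 1)) * η (y (σ 0)) (y (σ 2)) * kappa k b (z (σ 0)) (z (σ 2))
  + 1 / (n.descFactorial 4 : ℝ) * ∑ σ : Fin 4 ↪ Fin n,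
      ζ (x (σ 0)) (x (σ 1)) * η (y (σ 2)) (y (σ 3)) * kappa k b (z (σ 2)) (z (σ 3))

/-- The centring matrix `I - (1/n) 1 1ᵀ`. -/
def centring (n : ℕ) : Matrix (Fin n) (Fin n) ℝ :=
  1 - Matrix.of (fun _ _ => 1 / (n : ℝ))

/-- The Gram matrix of `ζ` (diagonal included). -/
def gramX (ζ : 𝒳 → 𝒳 → ℝ) (n : ℕ) (x : ℕ → 𝒳) : Matrix (Fin n) (Fin n) ℝ :=
  Matrix.of (fun i j => ζ (x i) (x j))

/-- The Gram matrix of `η κ_b` (diagonal included). -/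
def gramYZ (η : 𝒴 → 𝒴 → ℝ) (k : ℝ → ℝ) (n : ℕ) (b : ℝ) (y : ℕ → 𝒴) (z : ℕ → ℝ) :
    Matrix (Fin n) (Fin n) ℝ :=
  Matrix.of (fun i j => η (y i) (y j) * kappa k b (z i) (z j))

/-- The entrywise square of the entrywise product of the two doubly centred Gram matrices. -/
def matM (ζ : 𝒳 → 𝒳 → ℝ) (η : 𝒴 → 𝒴 → ℝ) (k : ℝ → ℝ) (n : ℕ) (b : ℝ)
    (x : ℕ → 𝒳) (y : ℕ → 𝒴) (z : ℕ → ℝ) : Matrix (Fin n) (Fin n) ℝ :=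
  (Matrix.hadamard (centring n * gramX ζ n x * centring n)
    (centring n * gramYZ η k n b y z * centring n)).map (fun t => t ^ 2)

/-- The variance estimator `S²_{n,b}`. -/
def Ssq (ζ : 𝒳 → 𝒳 → ℝ) (η : 𝒴 → 𝒴 → ℝ) (k : ℝ → ℝ) (n : ℕ) (b : ℝ)
    (x : ℕ → 𝒳) (y : ℕ → 𝒴) (z : ℕ → ℝ) : ℝ :=
  2 * ((n : ℝ) - 4) * ((n : ℝ) - 5) /
      ((n : ℝ) ^ 2 * ((n : ℝ) - 1) ^ 2 * ((n : ℝ) - 2) * ((n : ℝ) - 3)) *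
    ∑ i : Fin n, ∑ j : Fin n, if i ≠ j then matM ζ η k n b x y z i j else 0

/-- The leading expression of `var(T_{n,b})`. -/
def mainVar [MeasurableSpace 𝒳] [MeasurableSpace 𝒴] (ζ : 𝒳 → 𝒳 → ℝ) (η : 𝒴 → 𝒴 → ℝ)
    (k g : ℝ → ℝ) (μ : Measure 𝒳) (ν : Measure 𝒴) (n : ℕ) (b : ℝ) : ℝ :=
  2 * b * ((n - 4).descFactorial 2 : ℝ) / (n.descFactorial 4 : ℝ) * centredSq ζ μ *
    (A₃ k g b * meanSq η ν - 2 * A₂ k g b * b * meanCross η ν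
      + A₁ k g b ^ 2 * b * mean η ν ^ 2)

end Statistics

end RandomLifter

end

/-! Under the null hypothesis the `X`'s are independent of the pairs `(Y, Z)`, and `T` pairs the two
kernel matrices. The three sums combine into `(n(n-3))⁻¹ ∑ A_ij B̃_ij`, where `A` is the matrix of
`ζ` with zero diagonal and `B̃` is the unbiased double centring of the matrix of `η κ_b` (`T_eq`).
The rows of `B̃` sum to zero and the pairing is symmetric in the two matrices, so both kernels may
be replaced by their doubly centred versions. Those are degenerate, hence their values at different
unordered pairs of indices are orthogonal. Conditioning on the `(Y, Z)`'s gives an exact formula: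
`var T = 2 V_ζ W_b / (n(n-3))`, with `W_b` the `centredSq` of `η κ_b` (`memLp_and_variance_T`).

The rest of the variance expansion is analysis in `b`. The moments in `W_b` factor into moments of
`η` and of `κ_b`. The substitution `w = z + bu` gives `E κ_b² = b ∫ k²(u) corr(bu) du` with `corr`
the autocorrelation of `g`; `A₃` is the same integral with `g(z + bu)` replaced by `g(z)` wherever
`z + bu` lies in the support, and the Lipschitz condition makes the replacement cost `O(b)`. The
cross moment and the squared mean of `κ_b`, and the terms with `A₂` and `A₁`, are all `O(b²)`, so
size bounds suffice for them. The two rational functions of `n` differ by `6 / (n(n-1)(n-2))`, which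
`nb ≥ c` absorbs. The exact order comes from the limit of `A₃`, squeezed between the autocorrelation
integral and `∫ k² ∫ g²`; this needs only the continuity of translations in `L²`.

For the estimator, the entries of the doubly centred matrices are compared in mean square with the
centred kernel of `ζ` and with `η κ_b` itself, whose projections are negligible at scale `b`.
Independence makes second moments of products factor, so no fourth moments appear. The diagonals are
only integrable; they are truncated at level `n`, which changes nothing outside an event of
vanishing probability. The remaining sum of squared kernels obeys a law of large numbers at scale
`n² b`, by truncating the three factors at a level independent of `b` and applying Chebyshev, with
relative error of order `(nb)^(-1/2)`. -/

noncomputable section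

namespace RandomLifter

set_option linter.unusedSectionVars false

/-! ### Projections and double centring of a square integrable kernel. -/

section Kernel

variable {S : Type*} [MeasurableSpace S]

/-- The projection `x ↦ E φ(x, X)` of a kernel. -/
def proj (φ : S → S → ℝ) (m : Measure S) (x : S) : ℝ := ∫ y, φ x y ∂m

/-- The doubly centred kernel. -/
def centred (φ : S → S → ℝ) (m : Measure S) (x y : S) : ℝ :=
  φ x y - proj φ m x - proj φ m y + mean φ m

/-- `f` is integrable, with integral `v`. -/
structure HasMean {α : Type*} [MeasurableSpace α] (f : α → ℝ) (m : Measure α) (v : ℝ) : Prop where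
  integrable : Integrable f m
  integral_eq : ∫ x, f x ∂m = v

namespace HasMean

variable {α : Type*} [MeasurableSpace α] {m : Measure α} {f f' : α → ℝ} {v v' : ℝ}

theorem add (h : HasMean f m v) (h' : HasMean f' m v') :
    HasMean (fun x => f x + f' x) m (v + v') :=
  ⟨h.1.add h'.1, by rw [integral_add h.1 h'.1, h.2, h'.2]⟩

theorem sub (h : HasMean f m v) (h' : HasMean f' m v') :
    HasMean (fun x => f x - f' x) m (v - v') :=
  ⟨h.1.sub h'.1, by rw [integral_sub h.1 h'.1, h.2, h'.2]⟩

theorem const_mul (h : HasMean f m v) (c : ℝ) : HasMean (fun x => c * f x) m (c * v) :=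
  ⟨h.1.const_mul c, by rw [integral_const_mul, h.2]⟩

theorem const [IsProbabilityMeasure m] (c : ℝ) : HasMean (fun _ => c) m c :=
  ⟨integrable_const c, by simp⟩

theorem congr (h : HasMean f m v) (hf : ∀ x, f' x = f x) (hv : v' = v) : HasMean f' m v' := by
  rw [funext hf, hv]; exact h

theorem sum {ι : Type*} (s : Finset ι) {f : ι → α → ℝ} {v : ι → ℝ}
    (h : ∀ i ∈ s, HasMean (f i) m (v i)) :
    HasMean (fun x => ∑ i ∈ s, f i x) m (∑ i ∈ s, v i) :=
  ⟨integrable_finsetSum s fun i hi => (h i hi).1, by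
    rw [integral_finsetSum s fun i hi => (h i hi).1]
    exact Finset.sum_congr rfl fun i hi => (h i hi).2⟩

end HasMean

/-- A measurable symmetric square integrable kernel. -/
structure IsL2Kernel (φ : S → S → ℝ) (m : Measure S) : Prop where
  meas : Measurable (Function.uncurry φ)
  symm : ∀ x y, φ x y = φ y x
  memLp : MemLp (fun p : S × S => φ p.1 p.2) 2 (m.prod m)

theorem sq_integral_le {α : Type*} [MeasurableSpace α] {m : Measure α} [IsProbabilityMeasure m]
    {f : α → ℝ} (hf : MemLp f 2 m) : (∫ x, f x ∂m) ^ 2 ≤ ∫ x, f x ^ 2 ∂m := by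
  have h := variance_nonneg f m
  rw [variance_eq_sub hf] at h
  simpa using h

variable {m : Measure S} [IsProbabilityMeasure m] {φ : S → S → ℝ}

namespace IsL2Kernel

theorem integrable_sq (h : IsL2Kernel φ m) :
    Integrable (fun p : S × S => φ p.1 p.2 ^ 2) (m.prod m) := h.memLp.integrable_sq

theorem integrable (h : IsL2Kernel φ m) :
    Integrable (fun p : S × S => φ p.1 p.2) (m.prod m) := h.memLp.integrable one_le_two

theorem measurable_proj (h : IsL2Kernel φ m) : Measurable (proj φ m) :=
  (h.meas.stronglyMeasurable.integral_prod_right (ν := m)).measurable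

theorem ae_memLp (h : IsL2Kernel φ m) : ∀ᵐ x ∂m, MemLp (φ x) 2 m := by
  filter_upwards [h.integrable_sq.prod_right_ae] with x hx
  refine (memLp_two_iff_integrable_sq ?_).2 hx
  exact (h.meas.comp measurable_prodMk_left).aestronglyMeasurable

theorem memLp_proj (h : IsL2Kernel φ m) : MemLp (proj φ m) 2 m := by
  refine (memLp_two_iff_integrable_sq h.measurable_proj.aestronglyMeasurable).2 ?_
  refine h.integrable_sq.integral_prod_left.mono'
    (h.measurable_proj.pow_const 2).aestronglyMeasurable ?_
  filter_upwards [h.ae_memLp] with x hx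
  rw [Real.norm_eq_abs, abs_of_nonneg (sq_nonneg _)]
  exact sq_integral_le hx

theorem integral_proj (h : IsL2Kernel φ m) : ∫ x, proj φ m x ∂m = mean φ m :=
  (integral_prod _ h.integrable).symm

theorem integral_proj_sq (h : IsL2Kernel φ m) :
    ∫ x, proj φ m x ^ 2 ∂m = meanCross φ m := by
  have e1 : MeasurePreserving (fun p : S × S × S => (p.1, p.2.1)) (m.prod (m.prod m)) (m.prod m) :=
    (MeasurePreserving.id m).prod measurePreserving_fst
  have e2 : MeasurePreserving (fun p : S × S × S => (p.1, p.2.2)) (m.prod (m.prod m)) (m.prod m) :=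
    (MeasurePreserving.id m).prod measurePreserving_snd
  have hi : Integrable (fun p : S × S × S => φ p.1 p.2.1 * φ p.1 p.2.2) (m.prod (m.prod m)) :=
    (h.memLp.comp_measurePreserving e1).integrable_mul (h.memLp.comp_measurePreserving e2)
  rw [meanCross, integral_prod _ hi]
  refine integral_congr_ae (ae_of_all _ fun x => ?_)
  simp only [sq]
  exact (integral_prod_mul (φ x) (φ x)).symm

theorem memLp_fst (h : IsL2Kernel φ m) : MemLp (fun p : S × S => proj φ m p.1) 2 (m.prod m) :=
  h.memLp_proj.comp_measurePreserving measurePreserving_fst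

theorem memLp_snd (h : IsL2Kernel φ m) : MemLp (fun p : S × S => proj φ m p.2) 2 (m.prod m) :=
  h.memLp_proj.comp_measurePreserving measurePreserving_snd

theorem centred_kernel (h : IsL2Kernel φ m) : IsL2Kernel (centred φ m) m where
  meas := by
    have := h.measurable_proj
    exact ((h.meas.sub (this.comp measurable_fst)).sub (this.comp measurable_snd)).add_const _
  symm x y := by simp only [centred]; rw [h.symm x y]; ring
  memLp := ((h.memLp.sub h.memLp_fst).sub h.memLp_snd).add (memLp_const _)

theorem integral_centred (h : IsL2Kernel φ m) : ∀ᵐ x ∂m, ∫ y, centred φ m x y ∂m = 0 := by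
  filter_upwards [h.ae_memLp] with x hx
  have h1 : HasMean (φ x) m (proj φ m x) := ⟨hx.integrable one_le_two, rfl⟩
  have h2 : HasMean (proj φ m) m (mean φ m) :=
    ⟨h.memLp_proj.integrable one_le_two, h.integral_proj⟩
  refine (((h1.sub (.const (proj φ m x))).sub h2).add (.const (mean φ m))).congr
    (fun y => rfl) ?_ |>.integral_eq
  ring

theorem hasMean_fst {f : S → ℝ} {v : ℝ} (hf : HasMean f m v) :
    HasMean (fun p : S × S => f p.1) (m.prod m) v :=
  ⟨hf.1.comp_fst m, by
    simpa [hf.2] using integral_prod_mul (μ := m) (ν := m) f (fun _ => (1 : ℝ))⟩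

theorem hasMean_snd {f : S → ℝ} {v : ℝ} (hf : HasMean f m v) :
    HasMean (fun p : S × S => f p.2) (m.prod m) v :=
  ⟨hf.1.comp_snd m, by
    simpa [hf.2] using integral_prod_mul (μ := m) (ν := m) (fun _ => (1 : ℝ)) f⟩

theorem integral_mul_fst (h : IsL2Kernel φ m) :
    ∫ p, φ p.1 p.2 * proj φ m p.1 ∂(m.prod m) = meanCross φ m := by
  have hi : Integrable (fun p : S × S => φ p.1 p.2 * proj φ m p.1) (m.prod m) :=
    h.memLp.integrable_mul h.memLp_fst
  rw [integral_prod _ hi, ← h.integral_proj_sq]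
  refine integral_congr_ae (ae_of_all _ fun x => ?_)
  simp only [integral_mul_const, sq, proj]

theorem integral_mul_snd (h : IsL2Kernel φ m) :
    ∫ p, φ p.1 p.2 * proj φ m p.2 ∂(m.prod m) = meanCross φ m := by
  rw [← h.integral_mul_fst, ← integral_prod_swap]
  refine integral_congr_ae (ae_of_all _ fun p => ?_)
  simp only [Prod.fst_swap, Prod.snd_swap]
  rw [h.symm]

/-- The second moments of the linear combinations of a kernel and of its projections. -/
theorem integral_comb_sq (h : IsL2Kernel φ m) (t : ℝ) :
    ∫ p, (t * φ p.1 p.2 - proj φ m p.1 - proj φ m p.2 + mean φ m) ^ 2 ∂(m.prod m)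
      = t ^ 2 * meanSq φ m + (2 - 4 * t) * meanCross φ m + (2 * t - 1) * mean φ m ^ 2 := by
  set c := mean φ m with hc
  have p1 : HasMean (proj φ m) m c := ⟨h.memLp_proj.integrable one_le_two, h.integral_proj⟩
  have p2 : HasMean (fun x => proj φ m x ^ 2) m (meanCross φ m) :=
    ⟨h.memLp_proj.integrable_sq, h.integral_proj_sq⟩
  have i1 : HasMean (fun p : S × S => φ p.1 p.2 ^ 2) (m.prod m) (meanSq φ m) :=
    ⟨h.memLp.integrable_sq, rfl⟩
  have i4 : HasMean (fun p : S × S => φ p.1 p.2 * proj φ m p.1) (m.prod m) (meanCross φ m) :=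
    ⟨h.memLp.integrable_mul h.memLp_fst, h.integral_mul_fst⟩
  have i5 : HasMean (fun p : S × S => φ p.1 p.2 * proj φ m p.2) (m.prod m) (meanCross φ m) :=
    ⟨h.memLp.integrable_mul h.memLp_snd, h.integral_mul_snd⟩
  have i6 : HasMean (fun p : S × S => proj φ m p.1 * proj φ m p.2) (m.prod m) (c * c) :=
    ⟨h.memLp_fst.integrable_mul h.memLp_snd, by
      rw [integral_prod_mul (proj φ m) (proj φ m), h.integral_proj]⟩
  have i7 : HasMean (fun p : S × S => φ p.1 p.2) (m.prod m) c := ⟨h.integrable, rfl⟩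
  -- The square expands into ten terms, integrated one by one. The parameter `t` lets one expansion
  -- serve twice: `t = 1` is the centred kernel and `t = 0` its difference from the kernel.
  refine (((((((((i1.const_mul (t ^ 2)).add (hasMean_fst p2)).add (hasMean_snd p2)).add
    (i4.const_mul (-2 * t))).add (i5.const_mul (-2 * t))).add (i6.const_mul 2)).add
    (i7.const_mul (2 * t * c))).add ((hasMean_fst p1).const_mul (-2 * c))).add
    (((hasMean_snd p1).const_mul (-2 * c)).add (.const (c ^ 2)))).congr
    (fun p => ?_) ?_ |>.integral_eq <;> ring

theorem meanSq_centred (h : IsL2Kernel φ m) : meanSq (centred φ m) m = centredSq φ m := by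
  have := h.integral_comb_sq 1
  simp only [one_mul] at this
  rw [meanSq]; simp only [centred]
  rw [this, centredSq]; ring

theorem integral_sub_centred_sq (h : IsL2Kernel φ m) :
    ∫ p, (centred φ m p.1 p.2 - φ p.1 p.2) ^ 2 ∂(m.prod m)
      = 2 * meanCross φ m - mean φ m ^ 2 := by
  have := h.integral_comb_sq 0
  rw [show 2 * meanCross φ m - mean φ m ^ 2 = 0 ^ 2 * meanSq φ m + (2 - 4 * 0) * meanCross φ m
    + (2 * 0 - 1) * mean φ m ^ 2 by ring, ← this]
  refine integral_congr_ae (ae_of_all _ fun p => ?_)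
  simp only [centred]; ring

theorem centredSq_nonneg (h : IsL2Kernel φ m) : 0 ≤ centredSq φ m := by
  rw [← h.meanSq_centred]; exact integral_nonneg fun _ => sq_nonneg _

/-- Jensen's inequality for the projection, whose first moment is `mean` and whose second moment is
`meanCross`. -/
theorem mean_sq_le (h : IsL2Kernel φ m) : mean φ m ^ 2 ≤ meanCross φ m := by
  rw [← h.integral_proj, ← h.integral_proj_sq]; exact sq_integral_le h.memLp_proj

theorem centredSq_le (h : IsL2Kernel φ m) : centredSq φ m ≤ meanSq φ m := by
  have h1 := h.mean_sq_le
  have h2 := sq_nonneg (mean φ m)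
  rw [centredSq]; linarith

theorem meanCross_nonneg (h : IsL2Kernel φ m) : 0 ≤ meanCross φ m :=
  (sq_nonneg _).trans h.mean_sq_le

end IsL2Kernel

end Kernel

/-! ### Orthogonality of degenerate kernels along an i.i.d. sample. -/

section Sample

/-- The matrix of a kernel along a sample, with zero diagonal. -/
def hollow {S ι : Type*} [DecidableEq ι] (φ : S → S → ℝ) (x : ι → S) (i j : ι) : ℝ :=
  if i = j then 0 else φ (x i) (x j)

theorem hollow_symm {S ι : Type*} [DecidableEq ι] {φ : S → S → ℝ}
    (hs : ∀ x y, φ x y = φ y x) (x : ι → S) (i j : ι) :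
    hollow φ x i j = hollow φ x j i := by
  simp only [hollow, eq_comm (a := i), hs (x i)]

variable {S : Type*} [MeasurableSpace S] {m : Measure S} [IsProbabilityMeasure m]
  {φ : S → S → ℝ} {ι : Type*} [Fintype ι] [DecidableEq ι]

theorem measurePreserving_pair {i j : ι} (hij : i ≠ j) :
    MeasurePreserving (fun x : ι → S => (x i, x j)) (Measure.pi fun _ => m) (m.prod m) := by
  refine ⟨by fun_prop, ?_⟩
  have h := (iIndepFun_pi (μ := fun _ : ι => m) (X := fun _ => (id : S → S))
    (fun _ => aemeasurable_id)).indepFun hij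
  simp only [id] at h
  have h2 := (indepFun_iff_map_prod_eq_prod_map_map (measurable_pi_apply i).aemeasurable
    (measurable_pi_apply j).aemeasurable).1 h
  rw [h2]
  congr 1
  · exact (measurePreserving_eval (fun _ : ι => m) i).map_eq
  · exact (measurePreserving_eval (fun _ : ι => m) j).map_eq

/-- The coordinates other than `j` are independent of the coordinate `j`. -/
theorem measurePreserving_split (j : ι) :
    MeasurePreserving (fun x : ι → S => ((fun i : ({j}ᶜ : Finset ι) => x i), x j))
      (Measure.pi fun _ => m) ((Measure.map (fun (x : ι → S) (i : ({j}ᶜ : Finset ι)) => x i)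
        (Measure.pi fun _ => m)).prod m) := by
  refine ⟨by fun_prop, ?_⟩
  have h := (iIndepFun_pi (μ := fun _ : ι => m) (X := fun _ => (id : S → S))
    (fun _ => aemeasurable_id)).indepFun_finset ({j}ᶜ) {j} (by simp)
    (fun i => by fun_prop)
  have hm : Measurable (fun f : (({j} : Finset ι) → S) => f ⟨j, Finset.mem_singleton_self j⟩) :=
    measurable_pi_apply _
  have h1 := h.comp measurable_id hm
  simp only [Function.comp_def, id] at h1
  have hr : Measurable (fun (x : ι → S) (i : ({j}ᶜ : Finset ι)) => x i) := by fun_prop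
  have h2 := (indepFun_iff_map_prod_eq_prod_map_map hr.aemeasurable
    (measurable_pi_apply j).aemeasurable).1 h1
  have e := (measurePreserving_eval (fun _ : ι => m) j).map_eq
  exact h2.trans (congrArg _ e)

/-- A square integrable kernel with vanishing projection. -/
structure IsDegenerate (φ : S → S → ℝ) (m : Measure S) : Prop extends IsL2Kernel φ m where
  integral_eq_zero : ∀ᵐ x ∂m, ∫ y, φ x y ∂m = 0

theorem IsL2Kernel.isDegenerate (h : IsL2Kernel φ m) : IsDegenerate (centred φ m) m :=
  ⟨h.centred_kernel, h.integral_centred⟩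

theorem IsL2Kernel.memLp_pair (h : IsL2Kernel φ m) {i j : ι} (hij : i ≠ j) :
    MemLp (fun x : ι → S => φ (x i) (x j)) 2 (Measure.pi fun _ => m) :=
  h.memLp.comp_measurePreserving (measurePreserving_pair hij)

theorem integral_pair {f : S × S → ℝ} (hf : Measurable f) {i j : ι} (hij : i ≠ j) :
    ∫ x, f (x i, x j) ∂(Measure.pi fun _ : ι => m) = ∫ p, f p ∂(m.prod m) := by
  have h := measurePreserving_pair (m := m) hij
  rw [← h.map_eq, integral_map h.measurable.aemeasurable hf.aestronglyMeasurable]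

/-- The index `j` occurs in the first factor only. Integrating out that coordinate, with the others
frozen, leaves the projection of the kernel at `x i`, which vanishes almost everywhere. -/
theorem IsDegenerate.integral_mul_eq_zero (h : IsDegenerate φ m) {i j k l : ι} (hi : i ≠ j)
    (hk : k ≠ j) (hl : l ≠ j) (hkl : k ≠ l) :
    ∫ x, φ (x i) (x j) * φ (x k) (x l) ∂(Measure.pi fun _ : ι => m) = 0 := by
  let ψ : (({j}ᶜ : Finset ι) → S) × S → ℝ := fun p =>
    φ (p.1 ⟨i, by simpa using hi⟩) p.2 * φ (p.1 ⟨k, by simpa using hk⟩) (p.1 ⟨l, by simpa using hl⟩)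
  have hψ : Measurable ψ :=
    (h.meas.comp (f := fun p : (({j}ᶜ : Finset ι) → S) × S => (p.1 ⟨i, by simpa using hi⟩, p.2))
      (by fun_prop)).mul
    (h.meas.comp (f := fun p : (({j}ᶜ : Finset ι) → S) × S =>
      (p.1 ⟨k, by simpa using hk⟩, p.1 ⟨l, by simpa using hl⟩)) (by fun_prop))
  have hs := measurePreserving_split (m := m) j
  have hint : Integrable ψ (((Measure.pi fun _ : ι => m).map
      (fun x (i : ({j}ᶜ : Finset ι)) => x i)).prod m) := by
    rw [← hs.map_eq, integrable_map_measure hψ.aestronglyMeasurable hs.measurable.aemeasurable]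
    exact (h.memLp_pair hi).integrable_mul (h.memLp_pair hkl)
  have e : ∫ x, φ (x i) (x j) * φ (x k) (x l) ∂(Measure.pi fun _ : ι => m)
      = ∫ p, ψ p ∂(((Measure.pi fun _ : ι => m).map
          (fun x (i : ({j}ᶜ : Finset ι)) => x i)).prod m) := by
    rw [← hs.map_eq, integral_map hs.measurable.aemeasurable hψ.aestronglyMeasurable]
  have hmeas : Measurable (fun (x : ι → S) (i : ({j}ᶜ : Finset ι)) => x i) := by fun_prop
  have : IsProbabilityMeasure ((Measure.pi fun _ : ι => m).map
      (fun x (i : ({j}ᶜ : Finset ι)) => x i)) :=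
    Measure.isProbabilityMeasure_map hmeas.aemeasurable
  rw [e, integral_prod _ hint]
  refine integral_eq_zero_of_ae ?_
  have hev : MeasurePreserving (fun u : (({j}ᶜ : Finset ι) → S) => u ⟨i, by simpa using hi⟩)
      ((Measure.pi fun _ : ι => m).map (fun x (i : ({j}ᶜ : Finset ι)) => x i)) m := by
    refine ⟨by fun_prop, ?_⟩
    rw [Measure.map_map (by fun_prop) hmeas]
    exact (measurePreserving_eval (fun _ : ι => m) i).map_eq
  filter_upwards [hev.quasiMeasurePreserving.ae h.integral_eq_zero] with u hu
  simp only [ψ, integral_mul_const, hu, zero_mul, Pi.zero_apply]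

/-- Unless the two pairs coincide as sets, one index of the first pair is missing from the second
and can be integrated out. The two conditionals are the two orderings of a common pair; they exclude
each other because `i ≠ j`. -/
theorem IsDegenerate.hasMean_mul (h : IsDegenerate φ m) {i j k l : ι} (hij : i ≠ j)
    (hkl : k ≠ l) :
    HasMean (fun x : ι → S => φ (x i) (x j) * φ (x k) (x l)) (Measure.pi fun _ => m)
      ((if i = k ∧ j = l then meanSq φ m else 0) + if i = l ∧ j = k then meanSq φ m else 0) := by
  refine ⟨(h.memLp_pair hij).integrable_mul (h.memLp_pair hkl), ?_⟩
  have hsq : ∀ i j : ι, i ≠ j →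
      ∫ x, φ (x i) (x j) * φ (x i) (x j) ∂(Measure.pi fun _ : ι => m) = meanSq φ m := by
    intro i j hij
    rw [integral_pair (f := fun p => φ p.1 p.2 * φ p.1 p.2) (h.meas.mul h.meas) hij]
    simp only [meanSq, sq]
  by_cases hj : j = k ∨ j = l
  · by_cases hi : i = k ∨ i = l
    · rcases hj with rfl | rfl <;> rcases hi with rfl | rfl
      · exact absurd rfl hij
      · rw [if_neg (by tauto), if_pos ⟨rfl, rfl⟩, zero_add, ← hsq i j hij]
        refine integral_congr_ae (ae_of_all _ fun x => ?_)
        simp only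
        rw [h.symm (x j) (x i)]
      · rw [if_pos ⟨rfl, rfl⟩, if_neg (by tauto), add_zero, ← hsq i j hij]
      · exact absurd rfl hij
    · push Not at hi
      rw [if_neg (by tauto), if_neg (by tauto), add_zero,
        ← h.integral_mul_eq_zero hij.symm hi.1.symm hi.2.symm hkl]
      refine integral_congr_ae (ae_of_all _ fun x => ?_)
      simp only
      rw [h.symm (x i) (x j)]
  · push Not at hj
    rw [if_neg (by tauto), if_neg (by tauto), add_zero]
    exact h.integral_mul_eq_zero hij hj.1.symm hj.2.symm hkl

theorem IsL2Kernel.memLp_hollow (h : IsL2Kernel φ m) (i j : ι) :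
    MemLp (fun x : ι → S => hollow φ x i j) 2 (Measure.pi fun _ => m) := by
  unfold hollow
  split_ifs with hij
  · exact MemLp.zero
  · exact h.memLp_pair hij

/-- The value is written with nested conditionals in `k` and `l` so that, in the fourfold sum of the
next result, each term collapses to a single pair. -/
theorem IsDegenerate.hasMean_hollow_mul (h : IsDegenerate φ m) (i j k l : ι) :
    HasMean (fun x : ι → S => hollow φ x i j * hollow φ x k l) (Measure.pi fun _ => m)
      (if i = j then 0 else
        ((if k = i then if l = j then meanSq φ m else 0 else 0)
          + if k = j then if l = i then meanSq φ m else 0 else 0)) := by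
  unfold hollow
  by_cases hij : i = j
  · simp only [hij, if_true, zero_mul]; exact .const 0
  by_cases hkl : k = l
  · simp only [hij, hkl, if_true, if_false, mul_zero]
    convert HasMean.const (m := Measure.pi fun _ : ι => m) 0 using 1
    split_ifs <;> simp_all
  simp only [hij, hkl, if_false]
  convert h.hasMean_mul hij hkl using 1
  simp only [← ite_and, eq_comm (a := k), eq_comm (a := l)]
  congr 1
  simp only [and_comm]

/-- The second moment of a quadratic form with a degenerate kernel. -/
theorem IsDegenerate.hasMean_sum_sq (h : IsDegenerate φ m) (C : ι → ι → ℝ) :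
    HasMean (fun x : ι → S => (∑ i, ∑ j, hollow φ x i j * C i j) ^ 2) (Measure.pi fun _ => m)
      (meanSq φ m * ∑ i, ∑ j, if i = j then 0 else C i j * (C i j + C j i)) := by
  have key : HasMean (fun x : ι → S => ∑ i, ∑ j, ∑ k, ∑ l,
      (C i j * C k l) * (hollow φ x i j * hollow φ x k l)) (Measure.pi fun _ => m) _ :=
    .sum _ fun i _ => .sum _ fun j _ => .sum _ fun k _ => .sum _ fun l _ =>
      (h.hasMean_hollow_mul i j k l).const_mul (C i j * C k l)
  refine key.congr (fun x => ?_) ?_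
  · simp only [sq, Finset.sum_mul, Finset.mul_sum]
    refine Finset.sum_congr rfl fun i _ => Finset.sum_congr rfl fun j _ =>
      Finset.sum_congr rfl fun k _ => Finset.sum_congr rfl fun l _ => by ring
  · simp only [Finset.mul_sum]
    refine Finset.sum_congr rfl fun i _ => Finset.sum_congr rfl fun j _ => ?_
    by_cases hij : i = j
    · simp [hij]
    · simp only [hij, if_false, mul_add, Finset.sum_add_distrib, mul_ite, mul_zero]
      have : ∀ a b : ι, (∑ k : ι, ∑ l : ι, if k = a then if l = b then C i j * C k l * meanSq φ m
          else 0 else 0) = C i j * C a b * meanSq φ m := by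
        intro a b
        rw [Finset.sum_eq_single a, Finset.sum_eq_single b] <;> simp +contextual
      rw [this, this]; ring

theorem IsDegenerate.hasMean_hollow (h : IsDegenerate φ m) (i j : ι) :
    HasMean (fun x : ι → S => hollow φ x i j) (Measure.pi fun _ => m) 0 := by
  unfold hollow
  by_cases hij : i = j
  · simp only [hij, if_true]; exact .const 0
  · simp only [hij, if_false]
    refine ⟨(h.memLp_pair hij).integrable one_le_two, ?_⟩
    rw [integral_pair (f := fun p => φ p.1 p.2) h.meas hij, integral_prod _ h.integrable]
    exact integral_eq_zero_of_ae h.integral_eq_zero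

end Sample

/-! ### Sums over distinct indices and the unbiased double centring of a hollow matrix. -/

section Combinatorics

variable {ι : Type*} [Fintype ι] [DecidableEq ι]

theorem sum_embedding (r : ℕ) (f : (Fin r → ι) → ℝ)
    [DecidablePred (Function.Injective (α := Fin r) (β := ι))] :
    ∑ σ : Fin r ↪ ι, f σ = ∑ τ : Fin r → ι, if Function.Injective τ then f τ else 0 := by
  rw [← Finset.sum_filter]
  refine Finset.sum_bij' (fun σ _ => (σ : Fin r → ι))
    (fun τ h => ⟨τ, (Finset.mem_filter.1 h).2⟩) ?_ ?_ ?_ ?_ ?_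
  · intro σ _; simpa using σ.injective
  · intro τ _; exact Finset.mem_univ _
  · intro σ _; rfl
  · intro τ _; rfl
  · intro σ _; rfl

theorem sum_fin_succ_fun (r : ℕ) (f : (Fin (r + 1) → ι) → ℝ) :
    ∑ τ, f τ = ∑ i, ∑ τ : Fin r → ι, f (Fin.cons i τ) := by
  rw [← Fintype.sum_prod_type (f := fun p : ι × (Fin r → ι) => f (Fin.cons p.1 p.2))]
  exact (Fintype.sum_equiv (Fin.consEquiv fun _ => ι) _ _ fun p => rfl).symm

theorem sum_embedding_two (f : ι → ι → ℝ) :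
    ∑ σ : Fin 2 ↪ ι, f (σ 0) (σ 1) = ∑ i, ∑ j, if i = j then 0 else f i j := by
  classical
  rw [sum_embedding 2 fun τ => f (τ 0) (τ 1)]
  simp only [sum_fin_succ_fun, Fintype.sum_unique]
  refine Finset.sum_congr rfl fun i _ => Finset.sum_congr rfl fun j _ => ?_
  simp [Fin.cons_injective_iff, Function.injective_of_subsingleton]

theorem sum_embedding_three (f : ι → ι → ι → ℝ) :
    ∑ σ : Fin 3 ↪ ι, f (σ 0) (σ 1) (σ 2) =
      ∑ i, ∑ j, ∑ s, if i = j ∨ i = s ∨ j = s then 0 else f i j s := by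
  classical
  rw [sum_embedding 3 fun τ => f (τ 0) (τ 1) (τ 2)]
  simp only [sum_fin_succ_fun, Fintype.sum_unique]
  refine Finset.sum_congr rfl fun i _ => Finset.sum_congr rfl fun j _ =>
    Finset.sum_congr rfl fun s _ => ?_
  simp only [Fin.cons_injective_iff, Function.injective_of_subsingleton, Fin.range_cons,
    Set.mem_insert_iff, Set.range_eq_empty, Set.mem_empty_iff_false, or_false, not_or, and_true]
  split_ifs <;> first | rfl | grind

theorem sum_embedding_four (f : ι → ι → ι → ι → ℝ) :
    ∑ σ : Fin 4 ↪ ι, f (σ 0) (σ 1) (σ 2) (σ 3) =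
      ∑ i, ∑ j, ∑ s, ∑ t, if i = j ∨ i = s ∨ i = t ∨ j = s ∨ j = t ∨ s = t then 0
        else f i j s t := by
  classical
  rw [sum_embedding 4 fun τ => f (τ 0) (τ 1) (τ 2) (τ 3)]
  simp only [sum_fin_succ_fun, Fintype.sum_unique]
  refine Finset.sum_congr rfl fun i _ => Finset.sum_congr rfl fun j _ =>
    Finset.sum_congr rfl fun s _ => Finset.sum_congr rfl fun t _ => ?_
  simp only [Fin.cons_injective_iff, Function.injective_of_subsingleton, Fin.range_cons,
    Set.mem_insert_iff, Set.range_eq_empty, Set.mem_empty_iff_false, or_false, not_or, and_true]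
  split_ifs <;> first | rfl | grind


/-- The zero diagonals already remove `i = j` and `i = s`, so only the coincidence `j = s` has to be
subtracted. -/
theorem sum_mul_sum_of_ne (A B : ι → ι → ℝ) (hA : ∀ i, A i i = 0) (hB : ∀ i, B i i = 0) :
    (∑ i, ∑ j, ∑ s, if i = j ∨ i = s ∨ j = s then 0 else A i j * B i s)
      = ∑ i, (∑ j, A i j) * (∑ j, B i j) - ∑ i, ∑ j, A i j * B i j := by
  rw [← Finset.sum_sub_distrib]
  refine Finset.sum_congr rfl fun i _ => ?_
  rw [Finset.sum_mul, ← Finset.sum_sub_distrib]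
  refine Finset.sum_congr rfl fun j _ => ?_
  have e : ∀ s, (if i = j ∨ i = s ∨ j = s then 0 else A i j * B i s)
      = A i j * B i s - if j = s then A i j * B i s else 0 := by
    intro s
    by_cases h1 : i = j
    · subst h1; simp [hA]
    by_cases h2 : i = s
    · subst h2; simp [hB]
    by_cases h3 : j = s
    · simp [h3]
    · simp [h1, h2, h3]
  simp_rw [e]
  rw [Finset.sum_sub_distrib, Finset.sum_ite_eq, if_pos (Finset.mem_univ _), Finset.mul_sum]

theorem sum_mul_sum_of_ne_four (A B : ι → ι → ℝ) (hA : ∀ i, A i i = 0) (hB : ∀ i, B i i = 0)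
    (hA' : ∀ i j, A i j = A j i) (hB' : ∀ i j, B i j = B j i) :
    (∑ i, ∑ j, ∑ s, ∑ t, if i = j ∨ i = s ∨ i = t ∨ j = s ∨ j = t ∨ s = t then 0
        else A i j * B s t)
      = (∑ i, ∑ j, A i j) * (∑ i, ∑ j, B i j) - 4 * ∑ i, (∑ j, A i j) * (∑ j, B i j)
        + 2 * ∑ i, ∑ j, A i j * B i j := by
  -- Inclusion–exclusion: the zero diagonals account for `i = j` and `s = t`. Four single
  -- coincidences between the pairs are subtracted, and the two double ones, removed twice, are
  -- added back.
  have e : ∀ i j s t, (if i = j ∨ i = s ∨ i = t ∨ j = s ∨ j = t ∨ s = t then 0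
        else A i j * B s t)
      = A i j * (B s t - (if i = s then B i t else 0) - (if j = s then B j t else 0)
        - (if i = t then B s i else 0) - (if j = t then B s j else 0)
        + (if i = s then if j = t then B i j else 0 else 0)
        + (if j = s then if i = t then B j i else 0 else 0)) := by
    intro i j s t
    by_cases h1 : i = j
    · subst h1; simp [hA]
    by_cases h2 : s = t
    · subst h2; rw [hB]; split_ifs <;> simp_all
    by_cases h3 : i = s
    · subst h3
      by_cases h4 : j = t
      · subst h4; simp [h1, Ne.symm h1]
      · simp [h4, h2, Ne.symm h1]
    by_cases h5 : j = s
    · subst h5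
      by_cases h4 : i = t
      · subst h4; simp [h1, Ne.symm h1]
      · simp [h4, h2, h3]
    by_cases h6 : i = t
    · subst h6; simp [h3, h5, Ne.symm h1]
    by_cases h7 : j = t
    · subst h7; simp [h3, h5, h1]
    simp [h1, h2, h3, h5, h6, h7]
  have e2 : ∀ i j, (∑ s, ∑ t, (B s t - (if i = s then B i t else 0) - (if j = s then B j t else 0)
        - (if i = t then B s i else 0) - (if j = t then B s j else 0)
        + (if i = s then if j = t then B i j else 0 else 0)
        + (if j = s then if i = t then B j i else 0 else 0)))
      = (∑ s, ∑ t, B s t) - 2 * ∑ t, B i t - 2 * ∑ t, B j t + 2 * B i j := by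
    intro i j
    have h1 : ∀ a, (∑ s, ∑ t, if a = s then B a t else 0) = ∑ t, B a t := by
      intro a; rw [Finset.sum_comm]; simp
    have h2 : ∀ a, (∑ s, ∑ t, if a = t then B s a else 0) = ∑ t, B a t := by
      intro a; simp [hB' a]
    have h3 : ∀ a b, (∑ s, ∑ t, if a = s then if b = t then B a b else 0 else 0) = B a b := by
      intro a b; rw [Finset.sum_eq_single a] <;> simp +contextual [eq_comm]
    simp only [Finset.sum_sub_distrib, Finset.sum_add_distrib, h1, h2, h3]
    rw [hB' j i]; ring
  simp_rw [e, ← Finset.mul_sum, e2]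
  have e3 : ∀ i j, A i j * ((∑ s, ∑ t, B s t) - 2 * ∑ t, B i t - 2 * ∑ t, B j t + 2 * B i j)
      = A i j * (∑ s, ∑ t, B s t) - 2 * (A i j * ∑ t, B i t) - 2 * (A i j * ∑ t, B j t)
        + 2 * (A i j * B i j) := fun i j => by ring
  have e4 : (∑ i, ∑ j, A i j * ∑ t, B j t) = ∑ i, (∑ j, A i j) * (∑ j, B i j) := by
    rw [Finset.sum_comm]
    simp_rw [← Finset.sum_mul]
    exact Finset.sum_congr rfl fun i _ => by simp_rw [hA' i]
  simp_rw [e3, Finset.sum_add_distrib, Finset.sum_sub_distrib, ← Finset.mul_sum, e4,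
    ← Finset.sum_mul]
  ring

/-- The unbiased double centring of a matrix with zero diagonal. -/
def uCentring (B : ι → ι → ℝ) (i j : ι) : ℝ :=
  if i = j then 0 else B i j - (∑ t, B i t + ∑ t, B j t) / (Fintype.card ι - 2)
    + (∑ s, ∑ t, B s t) / ((Fintype.card ι - 1) * (Fintype.card ι - 2))

theorem uCentring_symm {B : ι → ι → ℝ} (hB' : ∀ i j, B i j = B j i) (i j : ι) :
    uCentring B i j = uCentring B j i := by
  simp only [uCentring, eq_comm (a := i), hB' i j, add_comm (∑ t, B i t)]

theorem sum_ne_const (i : ι) (c : ℝ) :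
    (∑ j, if i = j then 0 else c) = (Fintype.card ι - 1) * c := by
  have : ∀ j, (if i = j then 0 else c) = c - if i = j then c else 0 := by
    intro j; split_ifs <;> simp
  simp_rw [this, Finset.sum_sub_distrib, Finset.sum_ite_eq]
  simp; ring

theorem sum_mul_uCentring {A B : ι → ι → ℝ} (hA : ∀ i, A i i = 0)
    (hA' : ∀ i j, A i j = A j i) :
    ∑ i, ∑ j, A i j * uCentring B i j = ∑ i, ∑ j, A i j * B i j
      - 2 * (∑ i, (∑ j, A i j) * (∑ j, B i j)) / (Fintype.card ι - 2)
      + (∑ i, ∑ j, A i j) * (∑ i, ∑ j, B i j)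
        / ((Fintype.card ι - 1) * (Fintype.card ι - 2)) := by
  have e : ∀ i j, A i j * uCentring B i j = A i j * B i j
      - (A i j * (∑ t, B i t) + A i j * (∑ t, B j t)) / (Fintype.card ι - 2)
      + A i j * (∑ s, ∑ t, B s t) / ((Fintype.card ι - 1) * (Fintype.card ι - 2)) := by
    intro i j
    unfold uCentring
    split_ifs with h
    · subst h; simp [hA]
    · ring
  have e4 : (∑ i, ∑ j, A i j * ∑ t, B j t) = ∑ i, (∑ j, A i j) * (∑ j, B i j) := by
    rw [Finset.sum_comm]
    simp_rw [← Finset.sum_mul]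
    exact Finset.sum_congr rfl fun i _ => by simp_rw [hA' i]
  simp_rw [e, Finset.sum_add_distrib, Finset.sum_sub_distrib, ← Finset.sum_div,
    Finset.sum_add_distrib, e4, ← Finset.sum_mul]
  ring

/-- The expanded pairing is symmetric in the two matrices. Hence the invariance under additive
perturbations, visible on one side, holds on the other side too. -/
theorem sum_mul_uCentring_comm {A B : ι → ι → ℝ} (hA : ∀ i, A i i = 0)
    (hA' : ∀ i j, A i j = A j i) (hB : ∀ i, B i i = 0) (hB' : ∀ i j, B i j = B j i) :
    ∑ i, ∑ j, A i j * uCentring B i j = ∑ i, ∑ j, B i j * uCentring A i j := by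
  rw [sum_mul_uCentring hA hA', sum_mul_uCentring hB hB']
  simp only [mul_comm (A _ _), mul_comm (∑ j, A _ j), mul_comm (∑ i, ∑ j, A i j)]

/-- The denominators `n - 2` and `(n - 1)(n - 2)` in the definition are those that make the rows sum
to zero in spite of the zero diagonal. -/
theorem sum_uCentring {B : ι → ι → ℝ} (hB : ∀ i, B i i = 0)
    (hn : 3 ≤ Fintype.card ι) (i : ι) : ∑ j, uCentring B i j = 0 := by
  have hn' : (3 : ℝ) ≤ Fintype.card ι := by exact_mod_cast hn
  have e : ∀ j, uCentring B i j = B i j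
      - (if i = j then 0 else (∑ t, B i t) / (Fintype.card ι - 2))
      - ((∑ t, B j t) - if i = j then ∑ t, B i t else 0) / (Fintype.card ι - 2)
      + if i = j then 0
        else (∑ s, ∑ t, B s t) / ((Fintype.card ι - 1) * (Fintype.card ι - 2)) := by
    intro j
    unfold uCentring
    split_ifs with h
    · subst h; simp [hB]
    · ring
  simp_rw [e, Finset.sum_add_distrib, Finset.sum_sub_distrib, ← Finset.sum_div,
    Finset.sum_sub_distrib, sum_ne_const, Finset.sum_ite_eq, if_pos (Finset.mem_univ i)]
  have h1 : (Fintype.card ι : ℝ) - 2 ≠ 0 := by linarith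
  have h2 : (Fintype.card ι : ℝ) - 1 ≠ 0 := by linarith
  field_simp
  ring

/-- Additive perturbations of a kernel do not change its pairing with a centred matrix. -/
theorem sum_add_mul_uCentring (A : ι → ι → ℝ) {B : ι → ι → ℝ} (hB : ∀ i, B i i = 0)
    (hB' : ∀ i j, B i j = B j i) (hn : 3 ≤ Fintype.card ι) (f : ι → ℝ) (c : ℝ) :
    ∑ i, ∑ j, (A i j + if i = j then 0 else f i + f j + c) * uCentring B i j
      = ∑ i, ∑ j, A i j * uCentring B i j := by
  have e : ∀ i j, (A i j + if i = j then 0 else f i + f j + c) * uCentring B i j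
      = A i j * uCentring B i j + f i * uCentring B i j + f j * uCentring B i j
        + c * uCentring B i j := by
    intro i j
    split_ifs with h
    · simp [uCentring, h]
    · ring
  have e2 : ∑ i, ∑ j, f j * uCentring B i j = 0 := by
    rw [Finset.sum_comm]
    simp_rw [uCentring_symm hB', ← Finset.mul_sum, sum_uCentring hB hn]
    simp
  simp_rw [e, Finset.sum_add_distrib, e2, ← Finset.mul_sum, sum_uCentring hB hn]
  simp

/-- The centred matrix differs from `B` off the diagonal by an additive perturbation, and such a
perturbation pairs to zero with it; the centring acts as an orthogonal projection. -/
theorem sum_uCentring_sq {B : ι → ι → ℝ} (hB : ∀ i, B i i = 0)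
    (hB' : ∀ i j, B i j = B j i) (hn : 3 ≤ Fintype.card ι) :
    ∑ i, ∑ j, uCentring B i j ^ 2 = ∑ i, ∑ j, B i j * uCentring B i j := by
  have e : ∀ i j, uCentring B i j ^ 2 = (B i j + if i = j then 0 else
      (-(∑ t, B i t) / (Fintype.card ι - 2)) + (-(∑ t, B j t) / (Fintype.card ι - 2))
        + (∑ s, ∑ t, B s t) / ((Fintype.card ι - 1) * (Fintype.card ι - 2)))
          * uCentring B i j := by
    intro i j
    rw [sq]
    congr 1
    unfold uCentring
    split_ifs with h
    · subst h; simp [hB]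
    · ring
  simp_rw [e]
  exact sum_add_mul_uCentring B hB hB' hn (fun i => -(∑ t, B i t) / (Fintype.card ι - 2)) _

end Combinatorics

/-! ### The statistic as a bilinear pairing. -/

section Bilinear

variable {𝒳 𝒴 : Type*}

/-- The product kernel `η κ_b` on `𝒴 × ℝ`. -/
def lifted (η : 𝒴 → 𝒴 → ℝ) (k : ℝ → ℝ) (b : ℝ) (v w : 𝒴 × ℝ) : ℝ :=
  η v.1 w.1 * kappa k b v.2 w.2

theorem cast_descFactorial_four {n : ℕ} (hn : 4 ≤ n) :
    (n.descFactorial 4 : ℝ) = n * (n - 1) * (n - 2) * (n - 3) := by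
  obtain ⟨m, rfl⟩ := Nat.exists_eq_add_of_le hn
  simp only [Nat.descFactorial_succ, Nat.descFactorial_zero]
  rw [show 4 + m - 3 = m + 1 by omega, show 4 + m - 2 = m + 2 by omega,
    show 4 + m - 1 = m + 3 by omega, Nat.sub_zero]
  push_cast; ring

/-- Both sides are combinations of the same three quantities: the entrywise pairing, the pairing of
row sums and the product of totals. For the first, the coefficients add up as `(n-2)(n-3) + 2(n-3) +
2 = (n-1)(n-2)` over the common denominator `n(n-1)(n-2)(n-3)`, which gives `1 / (n(n-3))`. -/
theorem T_eq {n : ℕ} (hn : 4 ≤ n) {ζ : 𝒳 → 𝒳 → ℝ} {η : 𝒴 → 𝒴 → ℝ} {k : ℝ → ℝ}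
    (hζs : ∀ x x', ζ x x' = ζ x' x) (hηs : ∀ y y', η y y' = η y' y) (hks : ∀ u, k (-u) = k u)
    (b : ℝ) (x : ℕ → 𝒳) (y : ℕ → 𝒴) (z : ℕ → ℝ) :
    T ζ η k n b x y z = (∑ i, ∑ j, hollow ζ (fun i : Fin n => x i) i j *
        uCentring (hollow (lifted η k b) fun i : Fin n => (y i, z i)) i j) / (n * (n - 3)) := by
  have hls : ∀ v w, lifted η k b v w = lifted η k b w v := by
    intro v w
    rw [lifted, lifted, hηs, kappa, kappa, ← hks, ← neg_div, neg_sub]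
  set A := hollow ζ (fun i : Fin n => x i) with hA
  set B := hollow (lifted η k b) (fun i : Fin n => (y i, z i)) with hB
  have hA0 : ∀ i, A i i = 0 := fun i => by simp [hA, hollow]
  have hB0 : ∀ i, B i i = 0 := fun i => by simp [hB, hollow]
  have hA1 : ∀ i j, A i j = A j i := hollow_symm hζs _
  have hB1 : ∀ i j, B i j = B j i := hollow_symm hls _
  have t2 : ∑ σ : Fin 2 ↪ Fin n,
      ζ (x (σ 0)) (x (σ 1)) * η (y (σ 0)) (y (σ 1)) * kappa k b (z (σ 0)) (z (σ 1))
      = ∑ i, ∑ j, A i j * B i j := by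
    rw [sum_embedding_two fun i j : Fin n => ζ (x i) (x j) * η (y i) (y j) * kappa k b (z i) (z j)]
    refine Finset.sum_congr rfl fun i _ => Finset.sum_congr rfl fun j _ => ?_
    simp only [hA, hB, hollow, lifted]
    split_ifs <;> ring
  have t3 : ∑ σ : Fin 3 ↪ Fin n,
      ζ (x (σ 0)) (x (σ 1)) * η (y (σ 0)) (y (σ 2)) * kappa k b (z (σ 0)) (z (σ 2))
      = ∑ i, (∑ j, A i j) * (∑ j, B i j) - ∑ i, ∑ j, A i j * B i j := by
    rw [← sum_mul_sum_of_ne A B hA0 hB0, sum_embedding_three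
      fun i j s : Fin n => ζ (x i) (x j) * η (y i) (y s) * kappa k b (z i) (z s)]
    refine Finset.sum_congr rfl fun i _ => Finset.sum_congr rfl fun j _ =>
      Finset.sum_congr rfl fun s _ => ?_
    split_ifs with h
    · rfl
    · simp only [not_or] at h
      simp only [hA, hB, hollow, lifted, h, if_false]; ring
  have t4 : ∑ σ : Fin 4 ↪ Fin n,
      ζ (x (σ 0)) (x (σ 1)) * η (y (σ 2)) (y (σ 3)) * kappa k b (z (σ 2)) (z (σ 3))
      = (∑ i, ∑ j, A i j) * (∑ i, ∑ j, B i j) - 4 * ∑ i, (∑ j, A i j) * (∑ j, B i j)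
        + 2 * ∑ i, ∑ j, A i j * B i j := by
    rw [← sum_mul_sum_of_ne_four A B hA0 hB0 hA1 hB1, sum_embedding_four
      fun i j s t : Fin n => ζ (x i) (x j) * η (y s) (y t) * kappa k b (z s) (z t)]
    refine Finset.sum_congr rfl fun i _ => Finset.sum_congr rfl fun j _ =>
      Finset.sum_congr rfl fun s _ => Finset.sum_congr rfl fun t _ => ?_
    split_ifs with h
    · rfl
    · simp only [not_or] at h
      simp only [hA, hB, hollow, lifted, h, if_false]; ring
  rw [T, t2, t3, t4, sum_mul_uCentring hA0 hA1, cast_descFactorial_four hn, Fintype.card_fin]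
  obtain ⟨m, rfl⟩ := Nat.exists_eq_add_of_le hn
  simp only [Nat.descFactorial_succ, Nat.descFactorial_zero]
  rw [show 4 + m - 2 = m + 2 by omega, show 4 + m - 1 = m + 3 by omega, Nat.sub_zero]
  push_cast
  have h1 : (4 + m - 3 : ℝ) ≠ 0 := by have : (0 : ℝ) ≤ m := m.cast_nonneg; linarith
  have h2 : (4 + m - 2 : ℝ) ≠ 0 := by have : (0 : ℝ) ≤ m := m.cast_nonneg; linarith
  have h3 : (4 + m - 1 : ℝ) ≠ 0 := by have : (0 : ℝ) ≤ m := m.cast_nonneg; linarith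
  have h4 : (4 + m : ℝ) ≠ 0 := by positivity
  rw [show (m + 2 : ℝ) = 4 + m - 2 by ring, show (m + 3 : ℝ) = 4 + m - 1 by ring]
  field_simp
  ring

end Bilinear

/-! ### Mean and exact second moment of the pairing for independent samples. -/

section Variance

variable {S S' : Type*} [MeasurableSpace S] [MeasurableSpace S'] {m : Measure S} {m' : Measure S'}
  [IsProbabilityMeasure m] [IsProbabilityMeasure m'] {φ : S → S → ℝ} {ψ : S' → S' → ℝ}
  {ι : Type*} [Fintype ι] [DecidableEq ι]

/-- The pairing of two kernels along a sample that is invariant under centring of the kernels. -/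
def pairing (φ : S → S → ℝ) (ψ : S' → S' → ℝ) (x : ι → S) (v : ι → S') : ℝ :=
  ∑ i, ∑ j, hollow φ x i j * uCentring (hollow ψ v) i j

theorem hollow_self (φ : S → S → ℝ) (x : ι → S) (i : ι) : hollow φ x i i = 0 := by simp [hollow]

theorem pairing_comm (hφ : ∀ x y, φ x y = φ y x) (hψ : ∀ x y, ψ x y = ψ y x) (x : ι → S)
    (v : ι → S') : pairing φ ψ x v = pairing ψ φ v x :=
  sum_mul_uCentring_comm (hollow_self φ x) (hollow_symm hφ x) (hollow_self ψ v) (hollow_symm hψ v)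

theorem pairing_centred_left (hψ : ∀ x y, ψ x y = ψ y x) (hn : 3 ≤ Fintype.card ι) (x : ι → S)
    (v : ι → S') : pairing φ ψ x v = pairing (centred φ m) ψ x v := by
  unfold pairing
  rw [← sum_add_mul_uCentring (hollow (centred φ m) x) (hollow_self ψ v) (hollow_symm hψ v) hn
    (fun i => proj φ m (x i)) (-mean φ m)]
  refine Finset.sum_congr rfl fun i _ => Finset.sum_congr rfl fun j _ => ?_
  congr 1
  simp only [hollow, centred]
  split_ifs <;> ring

theorem pairing_centred (hφ : IsL2Kernel φ m) (hψ : IsL2Kernel ψ m') (hn : 3 ≤ Fintype.card ι)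
    (x : ι → S) (v : ι → S') :
    pairing φ ψ x v = pairing (centred φ m) (centred ψ m') x v := by
  rw [pairing_centred_left (m := m) hψ.symm hn, pairing_comm hφ.centred_kernel.symm hψ.symm,
    pairing_centred_left (m := m') hφ.centred_kernel.symm hn,
    pairing_comm hψ.centred_kernel.symm hφ.centred_kernel.symm]

theorem memLp_uCentring (hψ : IsL2Kernel ψ m') (i j : ι) :
    MemLp (fun v : ι → S' => uCentring (hollow ψ v) i j) 2 (Measure.pi fun _ => m') := by
  unfold uCentring
  split_ifs
  · exact MemLp.zero
  · have h1 := hψ.memLp_hollow (ι := ι)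
    have h2 : ∀ i : ι, MemLp (fun v : ι → S' => ∑ t, hollow ψ v i t) 2 (Measure.pi fun _ => m') :=
      fun i => memLp_finsetSum _ fun j _ => h1 i j
    have h3 : MemLp (fun v : ι → S' => ∑ s, ∑ t, hollow ψ v s t) 2 (Measure.pi fun _ => m') :=
      memLp_finsetSum _ fun j _ => h2 j
    simp only [div_eq_mul_inv]
    exact ((h1 i j).sub (((h2 i).add (h2 j)).mul_const _)).add (h3.mul_const _)

theorem memLp_mul_prod {α β : Type*} [MeasurableSpace α] [MeasurableSpace β] {μ : Measure α}
    {ν : Measure β} [SigmaFinite μ] [SigmaFinite ν] {f : α → ℝ} {g : β → ℝ} (hf : MemLp f 2 μ)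
    (hg : MemLp g 2 ν) : MemLp (fun p : α × β => f p.1 * g p.2) 2 (μ.prod ν) := by
  refine (memLp_two_iff_integrable_sq (hf.1.comp_fst.mul hg.1.comp_snd)).2 ?_
  exact (hf.integrable_sq.mul_prod hg.integrable_sq).congr
    (ae_of_all _ fun p => (mul_pow _ _ _).symm)

theorem memLp_pairing (hφ : IsL2Kernel φ m) (hψ : IsL2Kernel ψ m') :
    MemLp (fun p : (ι → S) × (ι → S') => pairing φ ψ p.1 p.2) 2
      ((Measure.pi fun _ => m).prod (Measure.pi fun _ => m')) :=
  memLp_finsetSum _ fun i _ => memLp_finsetSum _ fun j _ =>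
    memLp_mul_prod (hφ.memLp_hollow i j) (memLp_uCentring hψ i j)

theorem integral_pairing (hφ : IsL2Kernel φ m) (hψ : IsL2Kernel ψ m')
    (hn : 3 ≤ Fintype.card ι) :
    ∫ p, pairing φ ψ p.1 p.2 ∂((Measure.pi fun _ : ι => m).prod (Measure.pi fun _ : ι => m'))
      = 0 := by
  -- With `v` fixed, the pairing is a linear combination of values of a degenerate kernel, so
  -- already its conditional mean vanishes.
  rw [integral_prod_symm _ ((memLp_pairing hφ hψ).integrable one_le_two)]
  refine integral_eq_zero_of_ae (ae_of_all _ fun v => ?_)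
  refine (integral_congr_ae (ae_of_all _ fun x =>
    pairing_centred_left (m := m) hψ.symm hn x v)).trans ?_
  show _ = (0 : ℝ)
  exact (HasMean.sum Finset.univ fun i _ => HasMean.sum Finset.univ fun j _ =>
    (hφ.isDegenerate.hasMean_hollow i j).const_mul (uCentring (hollow ψ v) i j)).congr
    (fun x => by simp only [pairing, mul_comm]) (by simp) |>.integral_eq

theorem IsDegenerate.hasMean_row_sq (h : IsDegenerate φ m) (i : ι) :
    HasMean (fun x : ι → S => (∑ j, hollow φ x i j) ^ 2) (Measure.pi fun _ => m)
      (meanSq φ m * (Fintype.card ι - 1)) := by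
  -- A row sum is the quadratic form whose coefficients are the indicator of row `i`.
  refine (h.hasMean_sum_sq fun k l => if k = i then 1 else 0).congr (fun x => ?_) ?_
  · congr 1; simp
  · congr 1
    have : ∀ k l : ι, (if k = l then (0 : ℝ) else (if k = i then 1 else 0) *
        ((if k = i then 1 else 0) + if l = i then 1 else 0))
        = if k = i then (if i = l then 0 else 1) else 0 := by
      intro k l
      by_cases hk : k = i
      · subst hk; by_cases hl : k = l
        · simp [hl]
        · simp [hl, Ne.symm hl]
      · simp [hk]
    simp_rw [this]
    rw [Finset.sum_eq_single i]
    · simp [sum_ne_const]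
    · simp +contextual
    · simp

theorem IsDegenerate.hasMean_total_sq (h : IsDegenerate φ m) :
    HasMean (fun x : ι → S => (∑ i, ∑ j, hollow φ x i j) ^ 2) (Measure.pi fun _ => m)
      (meanSq φ m * (2 * Fintype.card ι * (Fintype.card ι - 1))) := by
  refine (h.hasMean_sum_sq fun k l => 1).congr (fun x => ?_) ?_
  · simp
  · simp_rw [sum_ne_const]
    simp only [Finset.sum_const, Finset.card_univ, nsmul_eq_mul]; ring

/-- In units of `meanSq φ m`, the squared entries, squared row sums and squared total have means
`n(n-1)`, `n(n-1)` and `2n(n-1)`. Weighted by `1`, `-2/(n-2)` and `1/((n-1)(n-2))` they give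
`n(n-3)`. -/
theorem IsDegenerate.hasMean_sum_uCentring_sq (h : IsDegenerate φ m) (hn : 3 ≤ Fintype.card ι) :
    HasMean (fun x : ι → S => ∑ i, ∑ j, uCentring (hollow φ x) i j ^ 2) (Measure.pi fun _ => m)
      (meanSq φ m * (Fintype.card ι * (Fintype.card ι - 3))) := by
  set N : ℝ := (Fintype.card ι : ℝ) with hN
  have hn' : (3 : ℝ) ≤ N := by rw [hN]; exact_mod_cast hn
  have a1 : HasMean (fun x : ι → S => ∑ i, ∑ j, hollow φ x i j * hollow φ x i j)
      (Measure.pi fun _ => m) (meanSq φ m * (N * (N - 1))) := by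
    refine (HasMean.sum Finset.univ fun i _ => .sum Finset.univ fun j _ =>
      h.hasMean_hollow_mul i j i j).congr (fun x => rfl) ?_
    trans ∑ i : ι, ∑ j : ι, if i = j then 0 else meanSq φ m
    · simp_rw [sum_ne_const]
      simp only [Finset.sum_const, Finset.card_univ, nsmul_eq_mul, ← hN]; ring
    · refine Finset.sum_congr rfl fun i _ => Finset.sum_congr rfl fun j _ => ?_
      by_cases hij : i = j <;> simp [hij]
  have a2 : ∀ i : ι, HasMean (fun x : ι → S => (∑ j, hollow φ x i j) * ∑ j, hollow φ x i j)
      (Measure.pi fun _ => m) (meanSq φ m * (N - 1)) := fun i => by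
    simpa only [sq] using h.hasMean_row_sq i
  have a3 : HasMean (fun x : ι → S => (∑ i, ∑ j, hollow φ x i j) * ∑ i, ∑ j, hollow φ x i j)
      (Measure.pi fun _ => m) (meanSq φ m * (2 * N * (N - 1))) := by
    simpa only [sq] using h.hasMean_total_sq (ι := ι)
  refine ((a1.sub ((HasMean.sum Finset.univ fun i _ => a2 i).const_mul (2 / (N - 2)))).add
    (a3.const_mul (1 / ((N - 1) * (N - 2))))).congr (fun x => ?_) ?_
  · rw [sum_uCentring_sq (hollow_self φ x) (hollow_symm h.symm x) hn,
      sum_mul_uCentring (hollow_self φ x) (hollow_symm h.symm x), ← hN]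
    ring
  · simp only [Finset.sum_const, Finset.card_univ, nsmul_eq_mul, ← hN]
    have h1 : N - 2 ≠ 0 := by linarith
    have h2 : N - 1 ≠ 0 := by linarith
    field_simp
    ring

/-- Given `v`, this is the second moment of a quadratic form in a degenerate kernel with fixed
symmetric coefficients; the symmetry produces the factor `2`. Averaging the sum of squared
coefficients over `v` produces `n(n-3)`. -/
theorem integral_pairing_sq (hφ : IsL2Kernel φ m) (hψ : IsL2Kernel ψ m')
    (hn : 3 ≤ Fintype.card ι) :
    ∫ p, pairing φ ψ p.1 p.2 ^ 2
        ∂((Measure.pi fun _ : ι => m).prod (Measure.pi fun _ : ι => m'))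
      = 2 * centredSq φ m * centredSq ψ m' * (Fintype.card ι * (Fintype.card ι - 3)) := by
  rw [integral_prod_symm _ (memLp_pairing hφ hψ).integrable_sq]
  have hψd := hψ.isDegenerate.hasMean_sum_uCentring_sq hn
  have e : ∀ v : ι → S', ∫ x, pairing φ ψ x v ^ 2 ∂(Measure.pi fun _ : ι => m)
      = 2 * centredSq φ m * ∑ i, ∑ j, uCentring (hollow (centred ψ m') v) i j ^ 2 := by
    intro v
    refine (integral_congr_ae (ae_of_all _ fun x =>
      congrArg (· ^ 2) (pairing_centred hφ hψ hn x v))).trans ?_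
    refine ((hφ.isDegenerate.hasMean_sum_sq
      (uCentring (hollow (centred ψ m') v))).integral_eq.trans ?_)
    rw [hφ.meanSq_centred, Finset.mul_sum, Finset.mul_sum]
    refine Finset.sum_congr rfl fun i _ => ?_
    rw [Finset.mul_sum, Finset.mul_sum]
    refine Finset.sum_congr rfl fun j _ => ?_
    rw [uCentring_symm (hollow_symm hψ.centred_kernel.symm v) j i]
    split_ifs with hij
    · simp [uCentring, hij]
    · ring
  simp only [e]
  rw [integral_const_mul, hψd.integral_eq, hψ.meanSq_centred]
  ring

end Variance

/-! ### Moments of the product kernel `η κ_b` factor. -/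

section Lifted

variable {𝒴 : Type*} [MeasurableSpace 𝒴] {ν : Measure 𝒴} [IsProbabilityMeasure ν]
  {l : Measure ℝ} [IsProbabilityMeasure l] {η : 𝒴 → 𝒴 → ℝ} {k : ℝ → ℝ} {b : ℝ}

theorem measurePreserving_prodProdComm {α β : Type*} [MeasurableSpace α] [MeasurableSpace β]
    (μ : Measure α) (ν : Measure β) [IsProbabilityMeasure μ] [IsProbabilityMeasure ν] :
    MeasurePreserving (fun p : (α × β) × (α × β) => ((p.1.1, p.2.1), (p.1.2, p.2.2)))
      ((μ.prod ν).prod (μ.prod ν)) ((μ.prod μ).prod (ν.prod ν)) := by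
  refine ⟨by fun_prop, ?_⟩
  -- A pair of independent draws is a sample indexed by `Fin 2`, for which exchanging products and
  -- function spaces is known to preserve the measure.
  have h01 : (0 : Fin 2) ≠ 1 := by decide
  have h1 := measurePreserving_pair (m := μ.prod ν) h01
  have h2 := (measurePreserving_pair (m := μ) h01).prod (measurePreserving_pair (m := ν) h01)
  have h3 := measurePreserving_arrowProdEquivProdArrow α β (Fin 2) (fun _ => μ) (fun _ => ν)
  rw [← h1.map_eq, Measure.map_map (by fun_prop) h1.measurable, ← (h2.comp h3).map_eq]
  rfl

theorem isL2Kernel_lifted (hη : IsL2Kernel η ν) (hκ : IsL2Kernel (kappa k b) l) :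
    IsL2Kernel (lifted η k b) (ν.prod l) where
  meas := (hη.meas.comp (f := fun p : (𝒴 × ℝ) × (𝒴 × ℝ) => (p.1.1, p.2.1)) (by fun_prop)).mul
    (hκ.meas.comp (f := fun p : (𝒴 × ℝ) × (𝒴 × ℝ) => (p.1.2, p.2.2)) (by fun_prop))
  symm v w := by rw [lifted, lifted, hη.symm, hκ.symm]
  memLp := (memLp_mul_prod hη.memLp hκ.memLp).comp_measurePreserving
    (measurePreserving_prodProdComm ν l)

theorem integral_lifted_mul {f : 𝒴 × 𝒴 → ℝ} {h : ℝ × ℝ → ℝ} (hf : Measurable f)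
    (hh : Measurable h) :
    ∫ p, f (p.1.1, p.2.1) * h (p.1.2, p.2.2) ∂((ν.prod l).prod (ν.prod l))
      = (∫ p, f p ∂(ν.prod ν)) * ∫ p, h p ∂(l.prod l) := by
  rw [← integral_prod_mul f h, ← (measurePreserving_prodProdComm ν l).map_eq,
    integral_map (measurePreserving_prodProdComm ν l).measurable.aemeasurable]
  exact ((hf.comp measurable_fst).mul (hh.comp measurable_snd)).aestronglyMeasurable

theorem meanSq_lifted (hη : IsL2Kernel η ν) (hκ : IsL2Kernel (kappa k b) l) :
    meanSq (lifted η k b) (ν.prod l) = meanSq η ν * meanSq (kappa k b) l := by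
  refine (integral_congr_ae (ae_of_all _ fun p => ?_)).trans
    (integral_lifted_mul (hη.meas.pow_const 2) (hκ.meas.pow_const 2))
  simp only [lifted, mul_pow]

theorem mean_lifted (hη : IsL2Kernel η ν) (hκ : IsL2Kernel (kappa k b) l) :
    mean (lifted η k b) (ν.prod l) = mean η ν * mean (kappa k b) l := by
  exact integral_lifted_mul hη.meas hκ.meas

/-- The projection of a product kernel under a product law is the product of the projections, and
the cross moment is the second moment of the projection. -/
theorem meanCross_lifted (hη : IsL2Kernel η ν) (hκ : IsL2Kernel (kappa k b) l) :
    meanCross (lifted η k b) (ν.prod l) = meanCross η ν * meanCross (kappa k b) l := by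
  rw [← (isL2Kernel_lifted hη hκ).integral_proj_sq, ← hη.integral_proj_sq, ← hκ.integral_proj_sq,
    ← integral_prod_mul]
  refine integral_congr_ae (ae_of_all _ fun p => ?_)
  simp only [← mul_pow]
  congr 1
  exact integral_prod_mul (η p.1) (kappa k b p.2)

end Lifted

/-! ### The law of the sample and the variance of the statistic under the null hypothesis. -/

section Law

variable {𝒳 𝒴 Ω : Type*} [MeasurableSpace 𝒳] [MeasurableSpace 𝒴] [MeasurableSpace Ω]
  {μ : Measure 𝒳} {ν : Measure 𝒴} {l : Measure ℝ} {P : Measure Ω}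
  [IsProbabilityMeasure μ] [IsProbabilityMeasure ν] [IsProbabilityMeasure l]
  [IsProbabilityMeasure P]
  {X : ℕ → Ω → 𝒳} {Y : ℕ → Ω → 𝒴} {Z : ℕ → Ω → ℝ}

/-- This is how the null hypothesis is used: regrouping `((X, Y), Z)` as `(X, (Y, Z))` turns the
product law into independence of the whole array of `X`'s from the whole array of `(Y, Z)`'s. -/
theorem measurePreserving_sample (hX : ∀ i, Measurable (X i)) (hY : ∀ i, Measurable (Y i))
    (hZ : ∀ i, Measurable (Z i))
    (hlaw : ∀ i, P.map (fun s => ((X i s, Y i s), Z i s)) = (μ.prod ν).prod l)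
    (hind : iIndepFun (fun i s => ((X i s, Y i s), Z i s)) P) (n : ℕ) :
    MeasurePreserving (fun s => ((fun i : Fin n => X i s), fun i : Fin n => (Y i s, Z i s))) P
      ((Measure.pi fun _ : Fin n => μ).prod (Measure.pi fun _ : Fin n => ν.prod l)) := by
  have hm : ∀ i, Measurable (fun s => (X i s, (Y i s, Z i s))) := fun i =>
    (hX i).prodMk ((hY i).prodMk (hZ i))
  have h1 : iIndepFun (fun (i : Fin n) s => (X i s, (Y i s, Z i s))) P :=
    (hind.precomp Fin.val_injective).comp (fun _ p => (p.1.1, (p.1.2, p.2)))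
      (fun _ => by fun_prop)
  have h2 : ∀ i, P.map (fun s => (X i s, (Y i s, Z i s))) = μ.prod (ν.prod l) := by
    intro i
    rw [← (measurePreserving_prodAssoc μ ν l).map_eq, ← hlaw i, Measure.map_map
      MeasurableEquiv.prodAssoc.measurable (((hX i).prodMk (hY i)).prodMk (hZ i))]
    rfl
  have h3 : MeasurePreserving (fun s (i : Fin n) => (X i s, (Y i s, Z i s))) P
      (Measure.pi fun _ : Fin n => μ.prod (ν.prod l)) := by
    refine ⟨measurable_pi_lambda _ fun i => hm i, ?_⟩
    rw [(iIndepFun_iff_map_fun_eq_pi_map fun i : Fin n => (hm i).aemeasurable).1 h1]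
    simp only [h2]
  exact (measurePreserving_arrowProdEquivProdArrow 𝒳 (𝒴 × ℝ) (Fin n) (fun _ => μ)
    (fun _ => ν.prod l)).comp h3

variable {ζ : 𝒳 → 𝒳 → ℝ} {η : 𝒴 → 𝒴 → ℝ} {k : ℝ → ℝ} {b : ℝ}

/-- Exact variance of the statistic under the null hypothesis. -/
theorem memLp_and_variance_T (hX : ∀ i, Measurable (X i)) (hY : ∀ i, Measurable (Y i))
    (hZ : ∀ i, Measurable (Z i))
    (hlaw : ∀ i, P.map (fun s => ((X i s, Y i s), Z i s)) = (μ.prod ν).prod l)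
    (hind : iIndepFun (fun i s => ((X i s, Y i s), Z i s)) P)
    (hζ : IsL2Kernel ζ μ) (hη : IsL2Kernel η ν) (hκ : IsL2Kernel (kappa k b) l)
    (hks : ∀ u, k (-u) = k u) {n : ℕ} (hn : 4 ≤ n) :
    MemLp (fun s => T ζ η k n b (X · s) (Y · s) (Z · s)) 2 P ∧
    variance (fun s => T ζ η k n b (X · s) (Y · s) (Z · s)) P
      = 2 * centredSq ζ μ * centredSq (lifted η k b) (ν.prod l) / (n * (n - 3)) := by
  have hS := measurePreserving_sample hX hY hZ hlaw hind n
  have hl := isL2Kernel_lifted hη hκ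
  have hn3 : 3 ≤ Fintype.card (Fin n) := by rw [Fintype.card_fin]; omega
  have hn' : (4 : ℝ) ≤ n := by exact_mod_cast hn
  have e : (fun s => T ζ η k n b (X · s) (Y · s) (Z · s)) = fun s =>
      (n * (n - 3) : ℝ)⁻¹ * pairing ζ (lifted η k b) (fun i : Fin n => X i s)
        (fun i : Fin n => (Y i s, Z i s)) := by
    funext s
    rw [T_eq hn hζ.symm hη.symm hks, div_eq_inv_mul, pairing]
  have hM := memLp_pairing (ι := Fin n) hζ hl
  have hP := hM.comp_measurePreserving hS
  rw [e]
  refine ⟨hP.const_mul _, ?_⟩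
  rw [variance_const_mul]
  have hv := variance_eq_sub hM
  rw [integral_pairing hζ hl hn3] at hv
  have hi := integral_pairing_sq hζ hl hn3
  simp only [Pi.pow_apply] at hv
  rw [hi, Fintype.card_fin] at hv
  have hv2 := hS.variance_fun_comp hM.1.aemeasurable
  rw [hv2, hv]
  have h1 : (n : ℝ) ≠ 0 := by linarith
  have h2 : (n : ℝ) - 3 ≠ 0 := by linarith
  field_simp
  ring

end Law

/-! ### Densities and their autocorrelation. -/

/-- A probability density on the line that has a third moment under its own law. -/
structure IsDensity (g : ℝ → ℝ) : Prop where
  meas : Measurable g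
  nonneg : ∀ z, 0 ≤ g z
  integral_eq : ∫ z, g z = 1
  cube : Integrable (fun z => g z ^ 3) (lifterLaw g)

/-- The autocorrelation of `g`. -/
def corr (g : ℝ → ℝ) (h : ℝ) : ℝ := ∫ z, g z * g (z + h)

namespace IsDensity

variable {g : ℝ → ℝ}

theorem integrable (hg : IsDensity g) : Integrable g := by
  by_contra h
  have := hg.integral_eq
  rw [integral_undef h] at this
  exact zero_ne_one this

/-- A third moment of `g` under its own law is a fourth moment under Lebesgue measure. With `∫ g =
1`, it controls the powers in between. -/
theorem integrable_pow_four (hg : IsDensity g) : Integrable (fun z => g z ^ 4) := by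
  have h := (integrable_withDensity_iff hg.meas.ennreal_ofReal
    (ae_of_all _ fun _ => ENNReal.ofReal_lt_top)).1 hg.cube
  refine h.congr (ae_of_all _ fun z => ?_)
  simp only [ENNReal.toReal_ofReal (hg.nonneg z)]
  ring

theorem integrable_sq (hg : IsDensity g) : Integrable (fun z => g z ^ 2) := by
  refine (hg.integrable.add hg.integrable_pow_four).mono'
    (hg.meas.pow_const 2).aestronglyMeasurable (ae_of_all _ fun z => ?_)
  have := hg.nonneg z
  rw [Real.norm_eq_abs, abs_of_nonneg (by positivity), Pi.add_apply]
  rcases le_total (g z) 1 with h | h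
  · nlinarith [pow_nonneg this 4]
  · nlinarith [pow_le_pow_right₀ h (show 2 ≤ 4 by norm_num)]

theorem integrable_pow_three (hg : IsDensity g) : Integrable (fun z => g z ^ 3) := by
  refine (hg.integrable_sq.add hg.integrable_pow_four).mono'
    (hg.meas.pow_const 3).aestronglyMeasurable (ae_of_all _ fun z => ?_)
  have := hg.nonneg z
  rw [Real.norm_eq_abs, abs_of_nonneg (by positivity), Pi.add_apply]
  nlinarith [sq_nonneg (g z * (g z - 1)), pow_nonneg this 2, pow_nonneg this 4]

theorem memLp (hg : IsDensity g) : MemLp g 2 :=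
  (memLp_two_iff_integrable_sq hg.meas.aestronglyMeasurable).2 hg.integrable_sq

theorem isProbabilityMeasure (hg : IsDensity g) : IsProbabilityMeasure (lifterLaw g) := by
  refine ⟨?_⟩
  rw [lifterLaw, withDensity_apply _ MeasurableSet.univ, Measure.restrict_univ,
    ← ofReal_integral_eq_lintegral_ofReal hg.integrable (ae_of_all _ hg.nonneg), hg.integral_eq,
    ENNReal.ofReal_one]

theorem memLp_shift (hg : IsDensity g) (h : ℝ) : MemLp (fun z => g (z + h)) 2 :=
  hg.memLp.comp_measurePreserving (measurePreserving_add_right volume h)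

theorem integral_shift_sq (h : ℝ) : ∫ w, g (w + h) ^ 2 = ∫ w, g w ^ 2 :=
  integral_add_right_eq_self (fun w => g w ^ 2) h

theorem integrable_mul_shift (hg : IsDensity g) (h : ℝ) :
    Integrable (fun z => g z * g (z + h)) := hg.memLp.integrable_mul (hg.memLp_shift h)

theorem corr_nonneg (hg : IsDensity g) (h : ℝ) : 0 ≤ corr g h :=
  integral_nonneg fun _ => mul_nonneg (hg.nonneg _) (hg.nonneg _)

theorem corr_le (hg : IsDensity g) (h : ℝ) : corr g h ≤ ∫ z, g z ^ 2 := by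
  have h1 : ∫ z, (g z ^ 2 + g (z + h) ^ 2) / 2 = ∫ z, g z ^ 2 := by
    rw [integral_div, integral_add hg.integrable_sq (hg.memLp_shift h).integrable_sq,
      integral_shift_sq]
    ring
  rw [← h1]
  refine integral_mono (hg.integrable_mul_shift h)
    ((hg.integrable_sq.add (hg.memLp_shift h).integrable_sq).div_const 2) fun z => ?_
  simp only
  nlinarith [sq_nonneg (g z - g (z + h))]

theorem corr_zero : corr g 0 = ∫ z, g z ^ 2 := by simp [corr, sq]

theorem integral_sq_pos (hg : IsDensity g) : 0 < ∫ z, g z ^ 2 := by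
  refine lt_of_le_of_ne (integral_nonneg fun z => sq_nonneg _) fun h => ?_
  have h1 := (integral_eq_zero_iff_of_nonneg (fun z => sq_nonneg (g z)) hg.integrable_sq).1 h.symm
  have h2 : ∫ z, g z = 0 := by
    refine integral_eq_zero_of_ae (h1.mono fun z hz => ?_)
    simpa using hz
  rw [hg.integral_eq] at h2
  exact one_ne_zero h2

/-- The autocorrelation is the inner product in `L²` of `g` with its translate, and translation acts
continuously on `L²`; no regularity of `g` is needed. -/
theorem continuous_corr (hg : IsDensity g) : Continuous (corr g) := by
  let τ : ℝ → C(ℝ, ℝ) := fun h => ⟨fun z => z + h, by fun_prop⟩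
  have hτ : Continuous τ :=
    (ContinuousMap.curry ⟨fun p : ℝ × ℝ => p.2 + p.1, by fun_prop⟩).continuous
  have hmp : ∀ h, MeasurePreserving (τ h) volume volume := fun h =>
    measurePreserving_add_right volume h
  have hc : Continuous fun h => Lp.compMeasurePreserving (τ h) (hmp h) (hg.memLp.toLp g) :=
    continuous_const.compMeasurePreservingLp hτ hmp (by simp)
  have hi : corr g = fun h => inner ℝ (hg.memLp.toLp g)
      (Lp.compMeasurePreserving (τ h) (hmp h) (hg.memLp.toLp g)) := by
    funext h
    rw [L2.inner_def, corr, Lp.toLp_compMeasurePreserving]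
    refine integral_congr_ae ?_
    filter_upwards [hg.memLp.coeFn_toLp, (hg.memLp.comp_measurePreserving (hmp h)).coeFn_toLp]
      with z h1 h2
    rw [h1, h2]
    simp [τ, mul_comm]
  rw [hi]
  exact continuous_const.inner hc

end IsDensity

theorem lintegral_affine {f : ℝ → ENNReal} (hf : Measurable f) {b : ℝ} (hb : 0 < b) (z : ℝ) :
    ∫⁻ w, f w = ENNReal.ofReal b * ∫⁻ u, f (z + b * u) := by
  have h1 : ∫⁻ u, f (z + b * u) = ∫⁻ w, f (z + w) ∂(Measure.map (b * ·) volume) := by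
    rw [lintegral_map (by fun_prop) (by fun_prop)]
  rw [h1, Real.map_volume_mul_left hb.ne', lintegral_smul_measure,
    lintegral_add_left_eq_self (fun w => f w) z, smul_eq_mul, ← mul_assoc,
    ← ENNReal.ofReal_mul hb.le, abs_of_pos (inv_pos.2 hb), mul_inv_cancel₀ hb.ne']
  simp

/-! ### Integrals of even functions of `(Z₁ - Z₂) / b`. -/

section Lifter

variable {g : ℝ → ℝ}

theorem lintegral_lifterLaw (hg : IsDensity g) {f : ℝ → ENNReal} (hf : Measurable f) :
    ∫⁻ z, f z ∂(lifterLaw g) = ∫⁻ z, ENNReal.ofReal (g z) * f z :=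
  lintegral_withDensity_eq_lintegral_mul _ hg.meas.ennreal_ofReal hf

/-- The substitution `w = z + bu` brings out the factor `b`; Tonelli's theorem then integrates `g(z)
g(z + bu)` over `z`. -/
theorem lintegral_lifterLaw_prod (hg : IsDensity g) {q : ℝ → ENNReal} (hq : Measurable q)
    (hqs : ∀ u, q (-u) = q u) {b : ℝ} (hb : 0 < b) :
    ∫⁻ p, q ((p.1 - p.2) / b) ∂((lifterLaw g).prod (lifterLaw g))
      = ENNReal.ofReal b * ∫⁻ u, q u * ENNReal.ofReal (corr g (b * u)) := by
  have := hg.isProbabilityMeasure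
  have hgm := hg.meas
  have hG : Measurable fun z => ENNReal.ofReal (g z) := hgm.ennreal_ofReal
  have e1 : ∀ z, ∫⁻ w, q ((z - w) / b) ∂(lifterLaw g)
      = ENNReal.ofReal b * ∫⁻ u, ENNReal.ofReal (g (z + b * u)) * q u := by
    intro z
    rw [lintegral_lifterLaw hg (by fun_prop), lintegral_affine (by fun_prop) hb z]
    congr 1
    refine lintegral_congr fun u => ?_
    rw [show (z - (z + b * u)) / b = -u by field_simp; ring, hqs]
  have e2 : ∀ u, ∫⁻ z, ENNReal.ofReal (g z) * ENNReal.ofReal (g (z + b * u))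
      = ENNReal.ofReal (corr g (b * u)) := by
    intro u
    rw [corr, ofReal_integral_eq_lintegral_ofReal (hg.integrable_mul_shift _)
      (ae_of_all _ fun z => mul_nonneg (hg.nonneg _) (hg.nonneg _))]
    exact lintegral_congr fun z => (ENNReal.ofReal_mul (hg.nonneg z)).symm
  rw [lintegral_prod _ (by fun_prop)]
  simp_rw [e1]
  rw [lintegral_const_mul _ (by fun_prop), lintegral_lifterLaw hg (by fun_prop)]
  congr 1
  simp_rw [← e2]
  calc ∫⁻ z, ENNReal.ofReal (g z) * ∫⁻ u, ENNReal.ofReal (g (z + b * u)) * q u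
      = ∫⁻ z, ∫⁻ u, ENNReal.ofReal (g z) * (ENNReal.ofReal (g (z + b * u)) * q u) :=
        lintegral_congr fun z => (lintegral_const_mul _ (by fun_prop)).symm
    _ = ∫⁻ u, ∫⁻ z, ENNReal.ofReal (g z) * (ENNReal.ofReal (g (z + b * u)) * q u) :=
        lintegral_lintegral_swap (by fun_prop)
    _ = _ := lintegral_congr fun u => by
        rw [← lintegral_const_mul _ (by fun_prop)]
        exact lintegral_congr fun z => by ring

theorem integrable_mul_corr (hg : IsDensity g) {q : ℝ → ℝ} (hq : Integrable q) (b : ℝ) :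
    Integrable (fun u => q u * corr g (b * u)) := by
  refine hq.mul_bdd (c := ∫ z, g z ^ 2)
    (hg.continuous_corr.comp (continuous_const.mul continuous_id)).aestronglyMeasurable
    (ae_of_all _ fun u => ?_)
  simp only [Real.norm_eq_abs, abs_of_nonneg (hg.corr_nonneg _)]
  exact hg.corr_le _

theorem hasMean_lifterLaw_prod (hg : IsDensity g) {q : ℝ → ℝ} (hqm : Measurable q)
    (hq0 : ∀ u, 0 ≤ q u) (hq : Integrable q) (hqs : ∀ u, q (-u) = q u) {b : ℝ} (hb : 0 < b) :
    HasMean (fun p : ℝ × ℝ => q ((p.1 - p.2) / b)) ((lifterLaw g).prod (lifterLaw g))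
      (b * ∫ u, q u * corr g (b * u)) := by
  have hi := integrable_mul_corr hg hq b
  have hnn : ∀ u, 0 ≤ q u * corr g (b * u) := fun u => mul_nonneg (hq0 u) (hg.corr_nonneg _)
  have e := lintegral_lifterLaw_prod hg hqm.ennreal_ofReal (fun u => by rw [hqs]) hb
  simp_rw [← ENNReal.ofReal_mul (hq0 _)] at e
  rw [← ofReal_integral_eq_lintegral_ofReal hi (ae_of_all _ hnn), ← ENNReal.ofReal_mul hb.le] at e
  have hm : Measurable (fun p : ℝ × ℝ => q ((p.1 - p.2) / b)) := by fun_prop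
  refine ⟨⟨hm.aestronglyMeasurable, ?_⟩, ?_⟩
  · rw [hasFiniteIntegral_iff_ofReal (ae_of_all _ fun p => hq0 _), e]
    exact ENNReal.ofReal_lt_top
  · rw [integral_eq_lintegral_of_nonneg_ae (ae_of_all _ fun p => hq0 _) hm.aestronglyMeasurable, e,
      ENNReal.toReal_ofReal (mul_nonneg hb.le (integral_nonneg hnn))]

theorem integral_mul_corr_le (hg : IsDensity g) {q : ℝ → ℝ}
    (hq0 : ∀ u, 0 ≤ q u) (hq : Integrable q) (b : ℝ) :
    ∫ u, q u * corr g (b * u) ≤ (∫ u, q u) * ∫ z, g z ^ 2 := by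
  rw [← integral_mul_const]
  exact integral_mono (integrable_mul_corr hg hq b) (hq.mul_const _) fun u =>
    mul_le_mul_of_nonneg_left (hg.corr_le _) (hq0 u)

/-- Dominated convergence: the autocorrelation is continuous, equals `∫ g²` at `0` and is bounded by
that value. -/
theorem tendsto_integral_mul_corr (hg : IsDensity g) {q : ℝ → ℝ} (hq : Integrable q)
    {b : ℕ → ℝ} (hb : Tendsto b atTop (𝓝 0)) :
    Tendsto (fun n => ∫ u, q u * corr g (b n * u)) atTop (𝓝 ((∫ u, q u) * ∫ z, g z ^ 2)) := by
  rw [← integral_mul_const]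
  refine tendsto_integral_of_dominated_convergence (fun u => ‖q u‖ * ∫ z, g z ^ 2)
    (fun n => (integrable_mul_corr hg hq _).aestronglyMeasurable) (hq.norm.mul_const _)
    (fun n => ae_of_all _ fun u => ?_) (ae_of_all _ fun u => ?_)
  · rw [norm_mul, Real.norm_eq_abs (corr g _), abs_of_nonneg (hg.corr_nonneg _)]
    exact mul_le_mul_of_nonneg_left (hg.corr_le _) (norm_nonneg _)
  · rw [← IsDensity.corr_zero (g := g)]
    refine ((hg.continuous_corr.tendsto 0).comp ?_).const_mul _
    simpa using hb.mul_const u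

end Lifter

/-! ### The smoothing kernel and the moments of `κ_b`. -/

/-- An even square integrable smoothing kernel. -/
structure IsSmoother (k : ℝ → ℝ) : Prop where
  meas : Measurable k
  nonneg : ∀ u, 0 ≤ k u
  even : ∀ u, k (-u) = k u
  integral_eq : ∫ u, k u = 1
  integrable_sq : Integrable fun u => k u ^ 2

theorem IsSmoother.integrable {k : ℝ → ℝ} (hk : IsSmoother k) : Integrable k := by
  by_contra h
  have := hk.integral_eq
  rw [integral_undef h] at this
  exact zero_ne_one this

theorem IsSmoother.integral_sq_pos {k : ℝ → ℝ} (hk : IsSmoother k) : 0 < ∫ u, k u ^ 2 := by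
  refine lt_of_le_of_ne (integral_nonneg fun z => sq_nonneg _) fun h => ?_
  have h1 := (integral_eq_zero_iff_of_nonneg (fun z => sq_nonneg (k z)) hk.integrable_sq).1 h.symm
  have h2 : ∫ z, k z = 0 := by
    refine integral_eq_zero_of_ae (h1.mono fun z hz => ?_)
    simpa using hz
  rw [hk.integral_eq] at h2
  exact one_ne_zero h2

/-- The square lies below `k` where `k ≤ 1` and below `k ^ (2 + δ)` elsewhere. -/
theorem isSmoother_of_rpow {k : ℝ → ℝ} {δ : ℝ} (hδ : 0 < δ) (hkm : Measurable k)
    (hk0 : ∀ u, 0 ≤ k u) (hk1 : ∫ u, k u = 1) (hkδ : Integrable (fun u => k u ^ (2 + δ)))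
    (hks : ∀ u, k (-u) = k u) : IsSmoother k := by
  refine ⟨hkm, hk0, hks, hk1, ?_⟩
  have hki : Integrable k := by
    by_contra h
    rw [integral_undef h] at hk1
    exact zero_ne_one hk1
  refine (hki.add hkδ).mono' (hkm.pow_const 2).aestronglyMeasurable (ae_of_all _ fun u => ?_)
  rw [Real.norm_eq_abs, abs_of_nonneg (sq_nonneg _), Pi.add_apply]
  rcases le_total (k u) 1 with h | h
  · nlinarith [hk0 u, Real.rpow_nonneg (hk0 u) (2 + δ)]
  · have := Real.rpow_le_rpow_of_exponent_le h (show (2 : ℝ) ≤ 2 + δ by linarith)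
    rw [Real.rpow_two] at this
    linarith [hk0 u]

section

variable {k g : ℝ → ℝ} {b : ℝ}

theorem kappa_symm (hk : IsSmoother k) (b z w : ℝ) : kappa k b z w = kappa k b w z := by
  rw [kappa, kappa, ← hk.even, ← neg_div, neg_sub]

theorem measurable_kappa (hk : IsSmoother k) (b : ℝ) :
    Measurable (Function.uncurry (kappa k b)) := by
  have := hk.meas
  unfold kappa Function.uncurry
  fun_prop

theorem hasMean_kappa_sq (hk : IsSmoother k) (hg : IsDensity g) (hb : 0 < b) :
    HasMean (fun p : ℝ × ℝ => kappa k b p.1 p.2 ^ 2) ((lifterLaw g).prod (lifterLaw g))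
      (b * ∫ u, k u ^ 2 * corr g (b * u)) :=
  hasMean_lifterLaw_prod hg (hk.meas.pow_const 2) (fun u => sq_nonneg _) hk.integrable_sq
    (fun u => by rw [hk.even]) hb

theorem isL2Kernel_kappa (hk : IsSmoother k) (hg : IsDensity g) (hb : 0 < b) :
    IsL2Kernel (kappa k b) (lifterLaw g) where
  meas := measurable_kappa hk b
  symm := kappa_symm hk b
  memLp := (memLp_two_iff_integrable_sq (measurable_kappa hk b).aestronglyMeasurable).2
    (hasMean_kappa_sq hk hg hb).integrable

theorem meanSq_kappa (hk : IsSmoother k) (hg : IsDensity g) (hb : 0 < b) :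
    meanSq (kappa k b) (lifterLaw g) = b * ∫ u, k u ^ 2 * corr g (b * u) :=
  (hasMean_kappa_sq hk hg hb).integral_eq

theorem meanSq_kappa_le (hk : IsSmoother k) (hg : IsDensity g) (hb : 0 < b) :
    meanSq (kappa k b) (lifterLaw g) ≤ b * ((∫ u, k u ^ 2) * ∫ z, g z ^ 2) := by
  rw [meanSq_kappa hk hg hb]
  exact mul_le_mul_of_nonneg_left
    (integral_mul_corr_le hg (fun u => sq_nonneg _) hk.integrable_sq b) hb.le

/-- The product is at most the cube of the largest factor. Applied to `g(z) g(w) g(t)`, this puts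
all the density on one variable, and the two others can be integrated freely against `κ_b`. -/
theorem mul_mul_le_add_pow_three (x y z : ENNReal) : x * y * z ≤ x ^ 3 + y ^ 3 + z ^ 3 := by
  have key : ∀ a, x ≤ a → y ≤ a → z ≤ a → x * y * z ≤ a ^ 3 := fun a hx hy hz => by
    rw [show a ^ 3 = a * a * a by ring]; gcongr
  rcases le_total x y with h1 | h1 <;> rcases le_total y z with h2 | h2
  · exact (key z (h1.trans h2) h2 le_rfl).trans le_add_self
  · exact (key y h1 le_rfl h2).trans (le_add_self.trans le_self_add)
  · rcases le_total x z with h3 | h3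
    · exact (key z h3 h2 le_rfl).trans le_add_self
    · exact (key x le_rfl h1 h3).trans (le_self_add.trans le_self_add)
  · exact (key x le_rfl h1 (h2.trans h1)).trans (le_self_add.trans le_self_add)

theorem lintegral_kappa (hk : IsSmoother k) (hb : 0 < b) (z : ℝ) :
    ∫⁻ w, ENNReal.ofReal (kappa k b z w) = ENNReal.ofReal b := by
  have := hk.meas
  unfold kappa
  rw [lintegral_affine (by fun_prop) hb z]
  have : ∀ u, k ((z - (z + b * u)) / b) = k u := fun u => by
    rw [show (z - (z + b * u)) / b = -u by field_simp; ring, hk.even]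
  simp_rw [this]
  rw [← ofReal_integral_eq_lintegral_ofReal hk.integrable (ae_of_all _ hk.nonneg), hk.integral_eq]
  simp

/-- After the product of densities is replaced by the sum of their cubes, each of three terms
carries a cube in one variable. The two factors `κ_b` integrate to `b` each, in either argument by
symmetry, so every term equals `b² ∫ g³`. -/
theorem lintegral_kappa_cross_le (hk : IsSmoother k) (hg : IsDensity g) (hb : 0 < b) :
    ∫⁻ z, ∫⁻ w, ∫⁻ t, ENNReal.ofReal (kappa k b z w) * ENNReal.ofReal (kappa k b z t)
        ∂(lifterLaw g) ∂(lifterLaw g) ∂(lifterLaw g)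
      ≤ 3 * (ENNReal.ofReal b ^ 2 * ∫⁻ z, ENNReal.ofReal (g z) ^ 3) := by
  have hgm := hg.meas
  have hG : Measurable fun z => ENNReal.ofReal (g z) := hgm.ennreal_ofReal
  have hK : Measurable fun p : ℝ × ℝ => ENNReal.ofReal (kappa k b p.1 p.2) :=
    (measurable_kappa hk b).ennreal_ofReal
  set G : ℝ → ENNReal := fun z => ENNReal.ofReal (g z) with hGd
  set K : ℝ × ℝ → ENNReal := fun p => ENNReal.ofReal (kappa k b p.1 p.2) with hKd
  set B := ENNReal.ofReal b
  have := hg.isProbabilityMeasure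
  have k1 : ∀ z, ∫⁻ w, K (z, w) = B := fun z => lintegral_kappa hk hb z
  have k2 : ∀ w, ∫⁻ z, K (z, w) = B := fun w => by
    rw [← k1 w]
    exact lintegral_congr fun z => by simp only [hKd, kappa_symm hk b z w]
  have e1 : ∫⁻ z, ∫⁻ w, ∫⁻ t, K (z, w) * K (z, t)
        ∂(lifterLaw g) ∂(lifterLaw g) ∂(lifterLaw g)
      = ∫⁻ z, ∫⁻ w, ∫⁻ t, (G z * G w * G t) * (K (z, w) * K (z, t)) := by
    rw [lintegral_lifterLaw hg (by fun_prop)]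
    refine lintegral_congr fun z => ?_
    rw [lintegral_lifterLaw hg (by fun_prop), ← lintegral_const_mul _ (by fun_prop)]
    refine lintegral_congr fun w => ?_
    rw [lintegral_lifterLaw hg (by fun_prop), ← lintegral_const_mul _ (by fun_prop),
      ← lintegral_const_mul _ (by fun_prop)]
    exact lintegral_congr fun t => by ring
  have e2 : ∫⁻ z, ∫⁻ w, ∫⁻ t, G z ^ 3 * K (z, w) * K (z, t) = B ^ 2 * ∫⁻ z, G z ^ 3 := by
    rw [← lintegral_const_mul _ (by fun_prop)]
    refine lintegral_congr fun z => ?_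
    simp_rw [lintegral_const_mul (G z ^ 3 * K (z, _)) (show Measurable fun t => K (z, t) by fun_prop),
      k1, mul_comm _ B, ]
    rw [lintegral_const_mul _ (by fun_prop), lintegral_const_mul _ (by fun_prop), k1]
    ring
  have e3 : ∫⁻ z, ∫⁻ w, K (z, w) * G w ^ 3 = B * ∫⁻ z, G z ^ 3 := by
    rw [lintegral_lintegral_swap (by fun_prop), ← lintegral_const_mul _ (by fun_prop)]
    refine lintegral_congr fun w => ?_
    rw [lintegral_mul_const _ (by fun_prop), k2]
  have e4 : ∫⁻ z, ∫⁻ w, ∫⁻ t, K (z, w) * G w ^ 3 * K (z, t) = B ^ 2 * ∫⁻ z, G z ^ 3 := by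
    have : ∀ z w, ∫⁻ t, K (z, w) * G w ^ 3 * K (z, t) = B * (K (z, w) * G w ^ 3) := by
      intro z w
      rw [lintegral_const_mul _ (by fun_prop), k1, mul_comm]
    simp_rw [this]
    have : ∀ z, ∫⁻ w, B * (K (z, w) * G w ^ 3) = B * ∫⁻ w, K (z, w) * G w ^ 3 := fun z =>
      lintegral_const_mul _ (by fun_prop)
    simp_rw [this]
    rw [lintegral_const_mul _ (by fun_prop), e3]
    ring
  have e5 : ∫⁻ z, ∫⁻ w, ∫⁻ t, K (z, w) * (K (z, t) * G t ^ 3) = B ^ 2 * ∫⁻ z, G z ^ 3 := by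
    have : ∀ z w, ∫⁻ t, K (z, w) * (K (z, t) * G t ^ 3)
        = K (z, w) * ∫⁻ t, K (z, t) * G t ^ 3 := fun z w => lintegral_const_mul _ (by fun_prop)
    simp_rw [this]
    have : ∀ z, ∫⁻ w, K (z, w) * ∫⁻ t, K (z, t) * G t ^ 3 = B * ∫⁻ t, K (z, t) * G t ^ 3 :=
      fun z => by rw [lintegral_mul_const _ (by fun_prop), k1]
    simp_rw [this]
    rw [lintegral_const_mul _ (by fun_prop), e3]
    ring
  refine e1.trans_le ?_
  calc _ ≤ ∫⁻ z, ∫⁻ w, ∫⁻ t, (G z ^ 3 * K (z, w) * K (z, t) + K (z, w) * G w ^ 3 * K (z, t)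
          + K (z, w) * (K (z, t) * G t ^ 3)) := by
        refine lintegral_mono fun z => lintegral_mono fun w => lintegral_mono fun t => ?_
        refine (mul_le_mul_left (mul_mul_le_add_pow_three (G z) (G w) (G t)) _).trans_eq ?_
        ring
    _ = (∫⁻ z, ∫⁻ w, ∫⁻ t, G z ^ 3 * K (z, w) * K (z, t))
        + (∫⁻ z, ∫⁻ w, ∫⁻ t, K (z, w) * G w ^ 3 * K (z, t))
        + ∫⁻ z, ∫⁻ w, ∫⁻ t, K (z, w) * (K (z, t) * G t ^ 3) := by
        rw [← lintegral_add_left (by fun_prop), ← lintegral_add_left (by fun_prop)]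
        refine lintegral_congr fun z => ?_
        rw [← lintegral_add_left (by fun_prop), ← lintegral_add_left (by fun_prop)]
        refine lintegral_congr fun w => ?_
        rw [← lintegral_add_left (by fun_prop), ← lintegral_add_left (by fun_prop)]
    _ = _ := by rw [e2, e4, e5]; ring

theorem meanCross_kappa_le (hk : IsSmoother k) (hg : IsDensity g) (hb : 0 < b) :
    meanCross (kappa k b) (lifterLaw g) ≤ 3 * (b ^ 2 * ∫ z, g z ^ 3) := by
  have := hg.isProbabilityMeasure
  have h3 : 0 ≤ ∫ z, g z ^ 3 := integral_nonneg fun z => pow_nonneg (hg.nonneg z) 3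
  have hK := measurable_kappa hk b
  have hm : Measurable fun p : ℝ × ℝ × ℝ => kappa k b p.1 p.2.1 * kappa k b p.1 p.2.2 :=
    (hK.comp (f := fun p : ℝ × ℝ × ℝ => (p.1, p.2.1)) (by fun_prop)).mul
      (hK.comp (f := fun p : ℝ × ℝ × ℝ => (p.1, p.2.2)) (by fun_prop))
  have hnn : ∀ z w, 0 ≤ kappa k b z w := fun z w => hk.nonneg _
  rw [meanCross, integral_eq_lintegral_of_nonneg_ae
    (ae_of_all _ fun p => mul_nonneg (hnn _ _) (hnn _ _)) hm.aestronglyMeasurable]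
  refine ENNReal.toReal_le_of_le_ofReal (by positivity) ?_
  rw [lintegral_prod _ hm.ennreal_ofReal.aemeasurable]
  have e : ∀ z, ∫⁻ p : ℝ × ℝ, ENNReal.ofReal (kappa k b z p.1 * kappa k b z p.2)
        ∂((lifterLaw g).prod (lifterLaw g)) = ∫⁻ w, ∫⁻ t, ENNReal.ofReal (kappa k b z w) *
          ENNReal.ofReal (kappa k b z t) ∂(lifterLaw g) ∂(lifterLaw g) := by
    intro z
    have hz : Measurable fun p : ℝ × ℝ => ENNReal.ofReal (kappa k b z p.1 * kappa k b z p.2) :=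
      (hm.comp (f := fun p : ℝ × ℝ => (z, p)) measurable_prodMk_left).ennreal_ofReal
    rw [lintegral_prod _ hz.aemeasurable]
    exact lintegral_congr fun w => lintegral_congr fun t => ENNReal.ofReal_mul (hnn _ _)
  simp_rw [e]
  refine (lintegral_kappa_cross_le hk hg hb).trans_eq ?_
  rw [ENNReal.ofReal_mul (by norm_num), ENNReal.ofReal_mul (by positivity), ENNReal.ofReal_pow hb.le,
    ofReal_integral_eq_lintegral_ofReal hg.integrable_pow_three
      (ae_of_all _ fun z => pow_nonneg (hg.nonneg z) 3)]
  simp_rw [ENNReal.ofReal_pow (hg.nonneg _)]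
  simp

end

/-! ### The support of the density and the constants `A₁`, `A₂`, `A₃`. -/

variable {k g : ℝ → ℝ} {b : ℝ}

theorem measurableSet_lifterSupport (g : ℝ → ℝ) : MeasurableSet (lifterSupport g) :=
  Measure.isClosed_support.measurableSet

theorem IsDensity.ae_mem_or_eq_zero (hg : IsDensity g) :
    ∀ᵐ z, z ∈ lifterSupport g ∨ g z = 0 := by
  have h : lifterLaw g (lifterSupport g)ᶜ = 0 := Measure.measure_compl_support
  rw [lifterLaw, withDensity_apply _ (measurableSet_lifterSupport g).compl,
    lintegral_eq_zero_iff hg.meas.ennreal_ofReal] at h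
  filter_upwards [(ae_restrict_iff' (measurableSet_lifterSupport g).compl).1 h] with z hz
  by_cases hD : z ∈ lifterSupport g
  · exact .inl hD
  · exact .inr (le_antisymm (by simpa using hz hD) (hg.nonneg z))

/-- The indicator function of the support. -/
def suppInd (g : ℝ → ℝ) (z : ℝ) : ℝ := (lifterSupport g).indicator 1 z

theorem measurable_suppInd : Measurable (suppInd g) :=
  measurable_one.indicator (measurableSet_lifterSupport g)

theorem suppInd_nonneg (z : ℝ) : 0 ≤ suppInd g z := Set.indicator_nonneg (fun _ _ => zero_le_one) z

theorem suppInd_le_one (z : ℝ) : suppInd g z ≤ 1 :=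
  Set.indicator_le_self' (fun _ _ => zero_le_one) z

theorem F_eq (k g : ℝ → ℝ) (b : ℝ) (i : ℕ) (z : ℝ) :
    F k g b i z = ∫ u, suppInd g (z + b * u) * k u ^ i := by
  have hm : MeasurableSet {u : ℝ | z + b * u ∈ lifterSupport g} :=
    (by fun_prop : Measurable fun u : ℝ => z + b * u) (measurableSet_lifterSupport g)
  rw [F, ← integral_indicator hm]
  refine integral_congr_ae (ae_of_all _ fun u => ?_)
  beta_reduce
  by_cases h : z + b * u ∈ lifterSupport g
  · rw [Set.indicator_of_mem (show u ∈ {u : ℝ | z + b * u ∈ lifterSupport g} from h),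
      show suppInd g (z + b * u) = 1 by simp [suppInd, h], one_mul]
  · rw [Set.indicator_of_notMem (show u ∉ {u : ℝ | z + b * u ∈ lifterSupport g} from h),
      show suppInd g (z + b * u) = 0 by simp [suppInd, h], zero_mul]

theorem F_one_nonneg (hk : IsSmoother k) (z : ℝ) : 0 ≤ F k g b 1 z := by
  rw [F_eq]
  exact integral_nonneg fun u => mul_nonneg (suppInd_nonneg _) (pow_nonneg (hk.nonneg _) _)

theorem F_one_le (hk : IsSmoother k) (z : ℝ) : F k g b 1 z ≤ 1 := by
  rw [F_eq, ← hk.integral_eq]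
  simp only [pow_one]
  exact integral_mono_of_nonneg
    (ae_of_all _ fun u => mul_nonneg (suppInd_nonneg _) (hk.nonneg _)) hk.integrable
    (ae_of_all _ fun u => mul_le_of_le_one_left (hk.nonneg u) (suppInd_le_one _))

theorem A₁_nonneg (hk : IsSmoother k) : 0 ≤ A₁ k g b :=
  integral_nonneg fun z => mul_nonneg (F_one_nonneg hk z) (sq_nonneg _)

theorem A₁_le (hk : IsSmoother k) (hg : IsDensity g) : A₁ k g b ≤ ∫ z, g z ^ 2 :=
  integral_mono_of_nonneg (ae_of_all _ fun z => mul_nonneg (F_one_nonneg hk z) (sq_nonneg _))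
    hg.integrable_sq (ae_of_all _ fun z => mul_le_of_le_one_left (sq_nonneg _) (F_one_le hk z))

theorem A₂_nonneg (hg : IsDensity g) : 0 ≤ A₂ k g b :=
  integral_nonneg fun z => mul_nonneg (sq_nonneg _) (pow_nonneg (hg.nonneg z) 3)

theorem A₂_le (hk : IsSmoother k) (hg : IsDensity g) : A₂ k g b ≤ ∫ z, g z ^ 3 :=
  integral_mono_of_nonneg
    (ae_of_all _ fun z => mul_nonneg (sq_nonneg _) (pow_nonneg (hg.nonneg z) 3))
    hg.integrable_pow_three
    (ae_of_all _ fun z => mul_le_of_le_one_left (pow_nonneg (hg.nonneg z) 3)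
      (pow_le_one₀ (F_one_nonneg hk z) (F_one_le hk z)))

/-- The mean of `g` over the points of the support that a shift keeps in the support. -/
def suppCorr (g : ℝ → ℝ) (h : ℝ) : ℝ := ∫ z, suppInd g (z + h) * g z ^ 2

theorem IsDensity.integrable_suppInd_mul (hg : IsDensity g) (h : ℝ) :
    Integrable fun z => suppInd g (z + h) * g z ^ 2 := by
  have hi : Measurable (suppInd g) := measurable_suppInd
  refine hg.integrable_sq.bdd_mul (c := 1) (by fun_prop : Measurable _).aestronglyMeasurable
    (ae_of_all _ fun z => ?_)
  rw [Real.norm_eq_abs, abs_of_nonneg (suppInd_nonneg _)]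
  exact suppInd_le_one _

theorem integrable_suppInd_prod (hk : IsSmoother k) (hg : IsDensity g) :
    Integrable (fun p : ℝ × ℝ => suppInd g (p.1 + b * p.2) * k p.2 ^ 2 * g p.1 ^ 2)
      (volume.prod volume) := by
  have hi : Measurable (suppInd g) := measurable_suppInd
  refine ((hg.integrable_sq.mul_prod hk.integrable_sq).bdd_mul (c := 1)
    (f := fun p : ℝ × ℝ => suppInd g (p.1 + b * p.2)) (by fun_prop : Measurable _).aestronglyMeasurable
      (ae_of_all _ fun z => ?_)).congr
    (ae_of_all _ fun p => ?_)
  · rw [Real.norm_eq_abs, abs_of_nonneg (suppInd_nonneg _)]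
    exact suppInd_le_one _
  · simp only; ring

theorem integrable_mul_suppCorr (hk : IsSmoother k) (hg : IsDensity g) :
    Integrable (fun u => k u ^ 2 * suppCorr g (b * u)) := by
  refine (integrable_suppInd_prod (b := b) hk hg).integral_prod_right.congr
    (ae_of_all _ fun u => ?_)
  simp only [suppCorr]
  rw [← integral_const_mul]
  exact integral_congr_ae (ae_of_all _ fun z => by ring)

/-- Fubini's theorem gives `A₃` the shape of `E κ_b² / b`, with `suppCorr` in place of `corr`, so
that comparing the two reduces to comparing these functions of the shift. -/
theorem A₃_eq (hk : IsSmoother k) (hg : IsDensity g) :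
    A₃ k g b = ∫ u, k u ^ 2 * suppCorr g (b * u) := by
  have h1 : A₃ k g b = ∫ z, ∫ u, suppInd g (z + b * u) * k u ^ 2 * g z ^ 2 := by
    rw [A₃]
    refine integral_congr_ae (ae_of_all _ fun z => ?_)
    simp only [F_eq, integral_mul_const]
  rw [h1, integral_integral_swap (integrable_suppInd_prod hk hg)]
  refine integral_congr_ae (ae_of_all _ fun u => ?_)
  simp only [suppCorr]
  rw [← integral_const_mul]
  exact integral_congr_ae (ae_of_all _ fun z => by ring)

theorem suppCorr_le (hg : IsDensity g) (h : ℝ) : suppCorr g h ≤ ∫ z, g z ^ 2 :=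
  integral_mono (hg.integrable_suppInd_mul h) hg.integrable_sq fun _ =>
    mul_le_of_le_one_left (sq_nonneg _) (suppInd_le_one _)

theorem A₃_le (hk : IsSmoother k) (hg : IsDensity g) :
    A₃ k g b ≤ (∫ u, k u ^ 2) * ∫ z, g z ^ 2 := by
  rw [A₃_eq hk hg, ← integral_mul_const]
  exact integral_mono (integrable_mul_suppCorr hk hg) (hk.integrable_sq.mul_const _) fun u =>
    mul_le_mul_of_nonneg_left (suppCorr_le hg _) (sq_nonneg _)

theorem IsDensity.ae_shift (hg : IsDensity g) (h : ℝ) :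
    ∀ᵐ z, z + h ∈ lifterSupport g ∨ g (z + h) = 0 :=
  (measurePreserving_add_right volume h).quasiMeasurePreserving.ae hg.ae_mem_or_eq_zero

/-- If `z` and `z + h` lie in the support, the integrands `g(z) g(z + h)` and `g(z)²` differ by at
most `L |h| g(z)`, which integrates to `L |h|`. If `z + h` is outside, both vanish almost
everywhere: one by the indicator, the other because `g` is almost everywhere zero off its support.
-/
theorem abs_corr_sub_suppCorr_le (hg : IsDensity g) {L : NNReal}
    (hL : LipschitzOnWith L g (lifterSupport g)) (h : ℝ) :
    |corr g h - suppCorr g h| ≤ L * |h| := by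
  have h1 : L * |h| = ∫ z, L * |h| * g z := by rw [integral_const_mul, hg.integral_eq, mul_one]
  rw [corr, suppCorr, ← integral_sub (hg.integrable_mul_shift h) (hg.integrable_suppInd_mul h), h1]
  refine (abs_integral_le_integral_abs).trans (integral_mono_ae
    ((hg.integrable_mul_shift h).sub (hg.integrable_suppInd_mul h)).abs
    (hg.integrable.const_mul _) ?_)
  filter_upwards [hg.ae_mem_or_eq_zero, hg.ae_shift h] with z hz hzh
  rcases hz with hz | hz
  · by_cases hD : z + h ∈ lifterSupport g
    · have e1 : suppInd g (z + h) = 1 := by simp [suppInd, hD]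
      have e2 := hL.dist_le_mul _ hD _ hz
      rw [Real.dist_eq, Real.dist_eq, add_sub_cancel_left] at e2
      rw [e1, one_mul, sq, ← mul_sub, abs_mul, abs_of_nonneg (hg.nonneg z), mul_comm]
      exact mul_le_mul_of_nonneg_right e2 (hg.nonneg z)
    · have e1 : suppInd g (z + h) = 0 := by simp [suppInd, hD]
      have e2 : g (z + h) = 0 := hzh.resolve_left hD
      rw [e1, e2]
      simp only [mul_zero, zero_mul, sub_zero, abs_zero]
      have := hg.nonneg z
      positivity
  · simp [hz]

theorem abs_meanSq_kappa_sub_le (hk : IsSmoother k) (hg : IsDensity g) {L : NNReal}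
    (hL : LipschitzOnWith L g (lifterSupport g)) (hku : Integrable fun u => |u| * k u ^ 2)
    (hb : 0 < b) :
    |meanSq (kappa k b) (lifterLaw g) - b * A₃ k g b| ≤ L * (∫ u, |u| * k u ^ 2) * b ^ 2 := by
  rw [meanSq_kappa hk hg hb, A₃_eq hk hg, ← mul_sub, abs_mul, abs_of_pos hb,
    ← integral_sub (integrable_mul_corr hg hk.integrable_sq b) (integrable_mul_suppCorr hk hg)]
  have h1 : |∫ u, (k u ^ 2 * corr g (b * u) - k u ^ 2 * suppCorr g (b * u))|
      ≤ ∫ u, (L * b) * (|u| * k u ^ 2) := by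
    refine (abs_integral_le_integral_abs).trans (integral_mono
      ((integrable_mul_corr hg hk.integrable_sq b).sub (integrable_mul_suppCorr hk hg)).abs
      (hku.const_mul _) fun u => ?_)
    simp only
    rw [← mul_sub, abs_mul, abs_of_nonneg (sq_nonneg _)]
    have := abs_corr_sub_suppCorr_le hg hL (b * u)
    rw [abs_mul, abs_of_pos hb] at this
    calc _ ≤ k u ^ 2 * (L * (b * |u|)) := mul_le_mul_of_nonneg_left this (sq_nonneg _)
      _ = _ := by ring
  rw [integral_const_mul] at h1
  calc _ ≤ b * (L * b * ∫ u, |u| * k u ^ 2) := mul_le_mul_of_nonneg_left h1 hb.le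
    _ = _ := by ring

/-- The inequality `2xy ≤ x² + y²`, where almost everywhere the left side vanishes unless both
points lie in the support. Translating the second square by `h` turns it into `suppCorr` at `-h`. -/
theorem corr_le_suppCorr (hg : IsDensity g) (h : ℝ) :
    corr g h ≤ (suppCorr g h + suppCorr g (-h)) / 2 := by
  have h1 : suppCorr g (-h) = ∫ z, suppInd g z * g (z + h) ^ 2 := by
    rw [suppCorr, ← integral_add_right_eq_self _ h]
    simp
  have hi : Integrable fun z => suppInd g z * g (z + h) ^ 2 := by
    refine (hg.memLp_shift h).integrable_sq.bdd_mul (c := 1)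
      measurable_suppInd.aestronglyMeasurable (ae_of_all _ fun z => ?_)
    rw [Real.norm_eq_abs, abs_of_nonneg (suppInd_nonneg _)]
    exact suppInd_le_one _
  rw [h1, suppCorr, ← integral_add (hg.integrable_suppInd_mul h) hi, ← integral_div, corr]
  refine integral_mono_ae (hg.integrable_mul_shift h)
    (((hg.integrable_suppInd_mul h).add hi).div_const 2) ?_
  filter_upwards [hg.ae_mem_or_eq_zero, hg.ae_shift h] with z hz hzh
  have n1 : 0 ≤ suppInd g (z + h) * g z ^ 2 := mul_nonneg (suppInd_nonneg _) (sq_nonneg _)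
  have n2 : 0 ≤ suppInd g z * g (z + h) ^ 2 := mul_nonneg (suppInd_nonneg _) (sq_nonneg _)
  rcases hz with hz | hz
  · rcases hzh with hzh | hzh
    · simp only [suppInd, Set.indicator_of_mem hz, Set.indicator_of_mem hzh, Pi.one_apply]
      nlinarith [sq_nonneg (g z - g (z + h))]
    · rw [hzh, mul_zero] at *; linarith
  · rw [hz, zero_mul] at *; linarith

/-- Evenness of `k` identifies the contributions of the shifts `bu` and `-bu`. This is the lower
half of the squeeze for the limit of `A₃`, free of any Lipschitz condition. -/
theorem integral_mul_corr_le_A₃ (hk : IsSmoother k) (hg : IsDensity g) :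
    ∫ u, k u ^ 2 * corr g (b * u) ≤ A₃ k g b := by
  have i1 := integrable_mul_suppCorr (b := b) hk hg
  have e1 : ∫ u, k u ^ 2 * suppCorr g (-(b * u)) = ∫ u, k u ^ 2 * suppCorr g (b * u) := by
    rw [← integral_neg_eq_self]
    refine integral_congr_ae (ae_of_all _ fun u => ?_)
    simp [hk.even]
  have i2 : Integrable fun u => k u ^ 2 * suppCorr g (-(b * u)) := by
    refine i1.comp_neg.congr (ae_of_all _ fun u => ?_)
    simp [hk.even]
  have e2 : A₃ k g b = ∫ u, (k u ^ 2 * suppCorr g (b * u) + k u ^ 2 * suppCorr g (-(b * u))) / 2 := by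
    rw [integral_div, integral_add i1 i2, e1, A₃_eq hk hg]; ring
  rw [e2]
  refine integral_mono (integrable_mul_corr hg hk.integrable_sq b) ((i1.add i2).div_const 2)
    fun u => ?_
  simp only
  have := mul_le_mul_of_nonneg_left (corr_le_suppCorr hg (b * u)) (sq_nonneg (k u))
  linarith

theorem tendsto_A₃ (hk : IsSmoother k) (hg : IsDensity g) {b : ℕ → ℝ}
    (hb : Tendsto b atTop (𝓝 0)) :
    Tendsto (fun n => A₃ k g (b n)) atTop (𝓝 ((∫ u, k u ^ 2) * ∫ z, g z ^ 2)) :=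
  tendsto_of_tendsto_of_tendsto_of_le_of_le
    (tendsto_integral_mul_corr hg hk.integrable_sq hb) tendsto_const_nhds
    (fun _ => integral_mul_corr_le_A₃ hk hg) (fun _ => A₃_le hk hg)

/-! ### The variance expansion and the order of its leading term. -/

section

variable {𝒳 𝒴 : Type*} [MeasurableSpace 𝒳] [MeasurableSpace 𝒴] {μ : Measure 𝒳} {ν : Measure 𝒴}
  [IsProbabilityMeasure μ] [IsProbabilityMeasure ν] {ζ : 𝒳 → 𝒳 → ℝ} {η : 𝒴 → 𝒴 → ℝ}
  {k g : ℝ → ℝ} {b : ℝ}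

/-- The factor in braces of the leading expression of the variance. -/
def braces (η : 𝒴 → 𝒴 → ℝ) (k g : ℝ → ℝ) (ν : Measure 𝒴) (b : ℝ) : ℝ :=
  A₃ k g b * meanSq η ν - 2 * A₂ k g b * b * meanCross η ν + A₁ k g b ^ 2 * b * mean η ν ^ 2

theorem mainVar_eq {n : ℕ} (hn : 4 ≤ n) :
    mainVar ζ η k g μ ν n b = 2 * b * ((n - 4) * (n - 5)) / (n * (n - 1) * (n - 2) * (n - 3))
      * centredSq ζ μ * braces η k g ν b := by
  rw [mainVar, cast_descFactorial_four hn, Nat.cast_descFactorial_two, Nat.cast_sub hn, braces]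
  push_cast
  ring

theorem meanSq_lifted_le (hη : IsL2Kernel η ν) (hk : IsSmoother k) (hg : IsDensity g)
    (hb : 0 < b) : meanSq (lifted η k b) (ν.prod (lifterLaw g))
      ≤ (meanSq η ν * ((∫ u, k u ^ 2) * ∫ z, g z ^ 2)) * b := by
  have := hg.isProbabilityMeasure
  rw [meanSq_lifted hη (isL2Kernel_kappa hk hg hb)]
  have h0 : 0 ≤ meanSq η ν := integral_nonneg fun _ => sq_nonneg _
  calc _ ≤ meanSq η ν * (b * ((∫ u, k u ^ 2) * ∫ z, g z ^ 2)) :=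
        mul_le_mul_of_nonneg_left (meanSq_kappa_le hk hg hb) h0
    _ = _ := by ring

theorem meanCross_lifted_le (hη : IsL2Kernel η ν) (hk : IsSmoother k) (hg : IsDensity g)
    (hb : 0 < b) : meanCross (lifted η k b) (ν.prod (lifterLaw g))
      ≤ (3 * meanCross η ν * ∫ z, g z ^ 3) * b ^ 2 := by
  have := hg.isProbabilityMeasure
  rw [meanCross_lifted hη (isL2Kernel_kappa hk hg hb)]
  calc _ ≤ meanCross η ν * (3 * (b ^ 2 * ∫ z, g z ^ 3)) :=
        mul_le_mul_of_nonneg_left (meanCross_kappa_le hk hg hb) hη.meanCross_nonneg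
    _ = _ := by ring

/-- Only `E κ_b²` is of order `b` and needs comparison with its approximation. The other two moments
of `κ_b` and their approximations are each `O(b²)`, so their differences are bounded by sums of
sizes. -/
theorem abs_centredSq_sub_braces_le (hη : IsL2Kernel η ν) (hk : IsSmoother k) (hg : IsDensity g)
    {L : NNReal} (hL : LipschitzOnWith L g (lifterSupport g))
    (hku : Integrable fun u => |u| * k u ^ 2) :
    ∃ K, ∀ b, 0 < b →
      |centredSq (lifted η k b) (ν.prod (lifterLaw g)) - b * braces η k g ν b| ≤ K * b ^ 2 := by
  have := hg.isProbabilityMeasure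
  set G2 := ∫ z, g z ^ 2
  set G3 := ∫ z, g z ^ 3
  -- The cross moment and the squared mean of `κ_b` are at most `3 G3 b²`, while `A₂ ≤ G3` and `A₁²
  -- ≤ G2²`; `4 G3` and `3 G3 + G2²` are cruder sums of these bounds.
  refine ⟨meanSq η ν * (L * ∫ u, |u| * k u ^ 2) + 2 * meanCross η ν * (4 * G3)
    + mean η ν ^ 2 * (3 * G3 + G2 ^ 2), fun b hb => ?_⟩
  have hκ := isL2Kernel_kappa hk hg hb
  have h1 := abs_meanSq_kappa_sub_le hk hg hL hku hb
  have h2 := meanCross_kappa_le hk hg hb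
  have h2' := hκ.meanCross_nonneg
  have h3 := hκ.mean_sq_le
  have a1 := A₁_le (b := b) hk hg
  have a1' := A₁_nonneg (g := g) (b := b) hk
  have a2 := A₂_le (b := b) hk hg
  have a2' := A₂_nonneg (k := k) (b := b) hg
  have m1 : 0 ≤ meanSq η ν := integral_nonneg fun _ => sq_nonneg _
  have m2 := hη.meanCross_nonneg
  have a1s : A₁ k g b ^ 2 ≤ G2 ^ 2 := pow_le_pow_left₀ a1' a1 2
  rw [centredSq, meanSq_lifted hη hκ, meanCross_lifted hη hκ, mean_lifted hη hκ, braces]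
  set M := meanSq (kappa k b) (lifterLaw g)
  set Cκ := meanCross (kappa k b) (lifterLaw g)
  set e := mean (kappa k b) (lifterLaw g)
  have t1 : |meanSq η ν * (M - b * A₃ k g b)| ≤ meanSq η ν * (L * (∫ u, |u| * k u ^ 2) * b ^ 2) := by
    rw [abs_mul, abs_of_nonneg m1]; exact mul_le_mul_of_nonneg_left h1 m1
  have t2 : |2 * meanCross η ν * (Cκ - A₂ k g b * b ^ 2)| ≤ 2 * meanCross η ν * (4 * G3 * b ^ 2) := by
    rw [abs_mul, abs_of_nonneg (by positivity)]
    refine mul_le_mul_of_nonneg_left ?_ (by positivity)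
    have := mul_le_mul_of_nonneg_right a2 (sq_nonneg b)
    have := mul_nonneg a2' (sq_nonneg b)
    rw [abs_le]; constructor <;> nlinarith
  have t3 : |mean η ν ^ 2 * (e ^ 2 - A₁ k g b ^ 2 * b ^ 2)|
      ≤ mean η ν ^ 2 * ((3 * G3 + G2 ^ 2) * b ^ 2) := by
    rw [abs_mul, abs_of_nonneg (sq_nonneg _)]
    refine mul_le_mul_of_nonneg_left ?_ (sq_nonneg _)
    have := mul_le_mul_of_nonneg_right a1s (sq_nonneg b)
    have := mul_nonneg (sq_nonneg (A₁ k g b)) (sq_nonneg b)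
    have := sq_nonneg e
    rw [abs_le]; constructor <;> nlinarith
  calc _ = |meanSq η ν * (M - b * A₃ k g b) - 2 * meanCross η ν * (Cκ - A₂ k g b * b ^ 2)
          + mean η ν ^ 2 * (e ^ 2 - A₁ k g b ^ 2 * b ^ 2)| := by congr 1; ring
    _ ≤ _ := (abs_add_le _ _).trans (add_le_add ((abs_sub _ _).trans (add_le_add t1 t2)) t3)
    _ = _ := by ring

theorem variance_expansion (hζ : IsL2Kernel ζ μ) (hη : IsL2Kernel η ν) (hk : IsSmoother k)
    (hg : IsDensity g) {L : NNReal} (hL : LipschitzOnWith L g (lifterSupport g))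
    (hku : Integrable fun u => |u| * k u ^ 2) {c : ℝ} (hc : 0 < c) :
    ∃ C : ℝ, ∀ n : ℕ, 4 ≤ n → ∀ b : ℝ, 0 < b → c ≤ n * b →
      |2 * centredSq ζ μ * centredSq (lifted η k b) (ν.prod (lifterLaw g)) / (n * (n - 3))
        - mainVar ζ η k g μ ν n b| ≤ C * (b ^ 2 / (n : ℝ) ^ 2) := by
  have := hg.isProbabilityMeasure
  obtain ⟨K, hK⟩ := abs_centredSq_sub_braces_le hη hk hg hL hku
  set K₂ := meanSq η ν * ((∫ u, k u ^ 2) * ∫ z, g z ^ 2) with hK₂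
  refine ⟨2 * centredSq ζ μ * (4 * K + 16 * K₂ / c), fun n hn b hb hcb => ?_⟩
  have hκ := isL2Kernel_kappa hk hg hb
  have hl := isL2Kernel_lifted hη hκ
  have hn' : (4 : ℝ) ≤ n := by exact_mod_cast hn
  have hV := hζ.centredSq_nonneg
  have hW0 := hl.centredSq_nonneg
  have hW := hl.centredSq_le.trans (meanSq_lifted_le hη hk hg hb)
  rw [mainVar_eq hn]
  set V := centredSq ζ μ
  set W := centredSq (lifted η k b) (ν.prod (lifterLaw g))
  set B := braces η k g ν b
  set N : ℝ := (n : ℝ)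
  have hKb := hK b hb
  have hK0 : 0 ≤ K * b ^ 2 := (abs_nonneg _).trans hKb
  have n0 : 0 < N := by linarith
  have n1 : 0 < N - 1 := by linarith
  have n2 : 0 < N - 2 := by linarith
  have n3 : 0 < N - 3 := by linarith
  -- As a real polynomial this is negative between `4` and `5`; integrality of `n` is what gives the
  -- sign.
  have hq0 : 0 ≤ (N - 4) * (N - 5) := by
    rcases Nat.lt_or_ge n 5 with h | h
    · have : n = 4 := by omega
      simp [N, this]
    · have : (5 : ℝ) ≤ (n : ℝ) := by exact_mod_cast h
      exact mul_nonneg (by linarith) (by linarith)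
  have hr0 : 0 ≤ (N - 4) * (N - 5) / (N * (N - 1) * (N - 2) * (N - 3)) := by positivity
  have hr : (N - 4) * (N - 5) / (N * (N - 1) * (N - 2) * (N - 3)) ≤ 4 / N ^ 2 := by
    rw [div_le_div_iff₀ (by positivity) (by positivity)]
    have h1 : (N - 4) * (N - 5) ≤ (N - 1) * (N - 2) := by nlinarith
    have h2 : N ^ 2 ≤ 4 * (N * (N - 3)) := by nlinarith
    calc _ ≤ ((N - 1) * (N - 2)) * (4 * (N * (N - 3))) :=
          mul_le_mul h1 h2 (by positivity) (by positivity)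
      _ = _ := by ring
  have hs : 6 / (N * (N - 1) * (N - 2)) ≤ 16 / N ^ 3 := by
    rw [div_le_div_iff₀ (by positivity) (by positivity)]
    have h1 : 3 * N ^ 2 ≤ 8 * ((N - 1) * (N - 2)) := by nlinarith
    nlinarith [mul_le_mul_of_nonneg_left h1 n0.le]
  -- The lower bound on `nb` converts the error `b / n³` of the combinatorial factor into the target
  -- order `b² / n²`.
  have hbn : b / N ^ 3 ≤ b ^ 2 / N ^ 2 / c := by
    rw [div_div, div_le_div_iff₀ (by positivity) (by positivity)]
    have : b * N ^ 2 * c ≤ b * N ^ 2 * (N * b) := by gcongr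
    nlinarith
  -- Since `(n-1)(n-2) - (n-4)(n-5) = 6(n-3)`, the two combinatorial factors differ by `6 /
  -- (n(n-1)(n-2))`.
  have e : 2 * V * W / (N * (N - 3)) - 2 * b * ((N - 4) * (N - 5)) /
        (N * (N - 1) * (N - 2) * (N - 3)) * V * B
      = 2 * V * ((W - b * B) * ((N - 4) * (N - 5) / (N * (N - 1) * (N - 2) * (N - 3)))
        + W * (6 / (N * (N - 1) * (N - 2)))) := by
    field_simp
    ring
  rw [e, abs_mul, abs_of_nonneg (by positivity : 0 ≤ 2 * V)]
  have t1 : |(W - b * B) * ((N - 4) * (N - 5) / (N * (N - 1) * (N - 2) * (N - 3)))|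
      ≤ (K * b ^ 2) * (4 / N ^ 2) := by
    rw [abs_mul, abs_of_nonneg hr0]
    exact mul_le_mul hKb hr hr0 hK0
  have t2 : |W * (6 / (N * (N - 1) * (N - 2)))| ≤ 16 * K₂ / c * (b ^ 2 / N ^ 2) := by
    rw [abs_of_nonneg (by positivity)]
    have hK20 : 0 ≤ K₂ := by
      have := hW0.trans hW
      exact nonneg_of_mul_nonneg_left this hb
    calc W * (6 / (N * (N - 1) * (N - 2))) ≤ (K₂ * b) * (16 / N ^ 3) :=
          mul_le_mul hW hs (by positivity) (by positivity)
      _ = 16 * K₂ * (b / N ^ 3) := by ring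
      _ ≤ 16 * K₂ * (b ^ 2 / N ^ 2 / c) := by gcongr
      _ = _ := by ring
  calc _ ≤ 2 * V * ((K * b ^ 2) * (4 / N ^ 2) + 16 * K₂ / c * (b ^ 2 / N ^ 2)) :=
        mul_le_mul_of_nonneg_left ((abs_add_le _ _).trans (add_le_add t1 t2)) (by positivity)
    _ = _ := by ring

theorem tendsto_one_sub_div (a : ℝ) : Tendsto (fun n : ℕ => 1 - a / (n : ℝ)) atTop (𝓝 1) := by
  simpa using tendsto_const_nhds.sub (tendsto_const_div_atTop_nhds_zero_nat a)

theorem tendsto_braces (hk : IsSmoother k) (hg : IsDensity g) {b : ℕ → ℝ}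
    (hb : ∀ n, 0 < b n) (hb0 : Tendsto b atTop (𝓝 0)) :
    Tendsto (fun n => braces η k g ν (b n)) atTop
      (𝓝 (((∫ u, k u ^ 2) * ∫ z, g z ^ 2) * meanSq η ν)) := by
  have h2 : Tendsto (fun n => A₂ k g (b n) * b n) atTop (𝓝 0) := by
    refine squeeze_zero (fun n => mul_nonneg (A₂_nonneg hg) (hb n).le)
      (fun n => mul_le_mul_of_nonneg_right (A₂_le hk hg) (hb n).le) ?_
    simpa using hb0.const_mul (∫ z, g z ^ 3)
  have h1 : Tendsto (fun n => A₁ k g (b n) ^ 2 * b n) atTop (𝓝 0) := by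
    refine squeeze_zero (fun n => mul_nonneg (sq_nonneg _) (hb n).le)
      (fun n => mul_le_mul_of_nonneg_right (pow_le_pow_left₀ (A₁_nonneg hk) (A₁_le hk hg) 2)
        (hb n).le) ?_
    simpa using hb0.const_mul ((∫ z, g z ^ 2) ^ 2)
  have h := (((tendsto_A₃ hk hg hb0).mul_const (meanSq η ν)).sub
    (h2.const_mul (2 * meanCross η ν))).add (h1.mul_const (mean η ν ^ 2))
  rw [mul_zero, zero_mul, sub_zero, add_zero] at h
  refine h.congr fun n => ?_
  rw [braces]; ring

theorem tendsto_mainVar_div (hk : IsSmoother k) (hg : IsDensity g) {b : ℕ → ℝ}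
    (hb : ∀ n, 0 < b n) (hb0 : Tendsto b atTop (𝓝 0)) :
    Tendsto (fun n : ℕ => mainVar ζ η k g μ ν n (b n) / (b n / (n : ℝ) ^ 2)) atTop
      (𝓝 (2 * centredSq ζ μ * (((∫ u, k u ^ 2) * ∫ z, g z ^ 2) * meanSq η ν))) := by
  have hr : Tendsto (fun n : ℕ => (1 - 4 / (n : ℝ)) * (1 - 5 / (n : ℝ)) /
      ((1 - 1 / (n : ℝ)) * (1 - 2 / (n : ℝ)) * (1 - 3 / (n : ℝ)))) atTop (𝓝 1) := by
    have := ((tendsto_one_sub_div 4).mul (tendsto_one_sub_div 5)).div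
      (((tendsto_one_sub_div 1).mul (tendsto_one_sub_div 2)).mul (tendsto_one_sub_div 3))
      (by norm_num)
    simpa only [mul_one, div_one, Pi.div_def] using this
  have h := (hr.const_mul (2 * centredSq ζ μ)).mul (tendsto_braces (η := η) (ν := ν) hk hg hb hb0)
  rw [mul_one] at h
  refine h.congr' ?_
  filter_upwards [eventually_ge_atTop 4] with n hn
  have hn' : (4 : ℝ) ≤ n := by exact_mod_cast hn
  have n0 : (n : ℝ) ≠ 0 := by linarith
  have n1 : (n : ℝ) - 1 ≠ 0 := by linarith
  have n2 : (n : ℝ) - 2 ≠ 0 := by linarith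
  have n3 : (n : ℝ) - 3 ≠ 0 := by linarith
  have hbn := (hb n).ne'
  rw [mainVar_eq hn]
  field_simp

theorem isTheta_mainVar (hk : IsSmoother k) (hg : IsDensity g) (hζ : centredSq ζ μ ≠ 0)
    (hη : meanSq η ν ≠ 0) {b : ℕ → ℝ} (hb : ∀ n, 0 < b n) (hb0 : Tendsto b atTop (𝓝 0)) :
    (fun n : ℕ => mainVar ζ η k g μ ν n (b n)) =Θ[atTop] (fun n : ℕ => b n / (n : ℝ) ^ 2) := by
  have hkg := mul_pos hk.integral_sq_pos hg.integral_sq_pos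
  exact Asymptotics.isTheta_of_div_tendsto_nhds_ne_zero
    (tendsto_mainVar_div hk hg hb hb0)
    (mul_ne_zero (mul_ne_zero two_ne_zero hζ) (mul_ne_zero hkg.ne' hη)) |>.symm

end

/-! ### Double centring by sample means. -/

section DoubleCentring

variable {ι : Type*} [Fintype ι] [DecidableEq ι]

/-- The doubly centred matrix. -/
def doubleCentring (A : ι → ι → ℝ) (i j : ι) : ℝ :=
  A i j - (∑ k, A k j) / Fintype.card ι - (∑ k, A i k) / Fintype.card ι
    + (∑ k, ∑ l, A k l) / (Fintype.card ι : ℝ) ^ 2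

theorem centring_mul_mul_centring (n : ℕ) (A : Matrix (Fin n) (Fin n) ℝ) (i j : Fin n) :
    (centring n * A * centring n) i j = doubleCentring A i j := by
  have e : centring n * A * centring n = A - (Matrix.of fun _ _ => 1 / (n : ℝ)) * A
      - A * (Matrix.of fun _ _ => 1 / (n : ℝ))
      + (Matrix.of fun _ _ => 1 / (n : ℝ)) * A * (Matrix.of fun _ _ => 1 / (n : ℝ)) := by
    rw [centring]; noncomm_ring
  rw [e]
  simp only [Matrix.add_apply, Matrix.sub_apply, Matrix.mul_apply, Matrix.of_apply, doubleCentring,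
    Fintype.card_fin]
  have h1 : ∑ x, (∑ y, 1 / (n : ℝ) * A y x) * (1 / (n : ℝ)) = (∑ k, ∑ l, A k l) / (n : ℝ) ^ 2 := by
    simp_rw [Finset.sum_mul]
    rw [Finset.sum_comm, Finset.sum_div]
    refine Finset.sum_congr rfl fun x _ => ?_
    rw [Finset.sum_div]
    exact Finset.sum_congr rfl fun y _ => by ring
  rw [h1, ← Finset.mul_sum, ← Finset.sum_mul]
  ring

theorem doubleCentring_add [Nonempty ι] (A : ι → ι → ℝ) (f : ι → ℝ) (c : ℝ) (i j : ι) :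
    doubleCentring (fun i j => A i j + (f i + f j + c)) i j = doubleCentring A i j := by
  have hN : (Fintype.card ι : ℝ) ≠ 0 := by exact_mod_cast Fintype.card_ne_zero
  simp only [doubleCentring, Finset.sum_add_distrib, Finset.sum_const, Finset.card_univ,
    nsmul_eq_mul, ← Finset.mul_sum]
  field_simp
  ring

/-- The matrix of a kernel along a sample, with a prescribed diagonal. -/
def withDiag {S : Type*} (φ : S → S → ℝ) (s : S → ℝ) (x : ι → S) (i j : ι) : ℝ :=
  if i = j then s (x i) else φ (x i) (x j)

end DoubleCentring

/-! ### Mean square distance between empirical and theoretical centring. -/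

section Moments

variable {S : Type*} [MeasurableSpace S] {m : Measure S} [IsProbabilityMeasure m]
  {φ : S → S → ℝ} {ι : Type*} [Fintype ι] [DecidableEq ι]

/-- Double centring ignores matrices `f i + f j + c`, so the kernel may be centred at no cost. The
perturbation also reaches the diagonal, which explains the new diagonal function. -/
theorem doubleCentring_withDiag [Nonempty ι] (φ : S → S → ℝ) (m : Measure S) (s : S → ℝ)
    (x : ι → S) (i j : ι) :
    doubleCentring (withDiag φ s x) i j =
      doubleCentring (withDiag (centred φ m) (fun y => s y - 2 * proj φ m y + mean φ m) x) i j := by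
  rw [← doubleCentring_add (withDiag φ s x) (fun i => -proj φ m (x i)) (mean φ m)]
  congr 1
  funext i j
  simp only [withDiag, centred]
  split_ifs with h
  · rw [h]; ring
  · ring

/-- The diagonal is separated from the off-diagonal sums because the two are controlled differently:
the former through second moments only, the latter through orthogonality. -/
theorem doubleCentring_withDiag_sub (φ : S → S → ℝ) (t : S → ℝ) (x : ι → S) {i j : ι}
    (hij : i ≠ j) :
    doubleCentring (withDiag φ t x) i j - φ (x i) (x j)
      = -(t (x j) + t (x i)) / Fintype.card ι
        - (∑ k, hollow φ x k j + ∑ k, hollow φ x i k) / Fintype.card ι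
        + (∑ k, t (x k)) / (Fintype.card ι : ℝ) ^ 2
        + (∑ k, ∑ l, hollow φ x k l) / (Fintype.card ι : ℝ) ^ 2 := by
  have e : ∀ k l, withDiag φ t x k l = (if k = l then t (x k) else 0) + hollow φ x k l := by
    intro k l; simp only [withDiag, hollow]; split_ifs <;> simp
  have e1 : ∑ k, withDiag φ t x k j = t (x j) + ∑ k, hollow φ x k j := by
    simp [e, Finset.sum_add_distrib]
  have e2 : ∀ i, ∑ k, withDiag φ t x i k = t (x i) + ∑ k, hollow φ x i k := by
    intro i; simp [e, Finset.sum_add_distrib]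
  rw [doubleCentring, e1, e2]
  simp_rw [e2, Finset.sum_add_distrib]
  rw [withDiag, if_neg hij]
  ring

theorem integral_coord {f : S → ℝ} (i : ι) (hf : AEStronglyMeasurable f m) :
    ∫ x, f (x i) ∂(Measure.pi fun _ : ι => m) = ∫ s, f s ∂m := by
  have h := measurePreserving_eval (fun _ : ι => m) i
  conv_rhs => rw [← h.map_eq]
  rw [integral_map h.measurable.aemeasurable (by rwa [h.map_eq])]

/-- Centring by sample means instead of by expectations costs `O(1 / n)` in mean square. -/
theorem IsDegenerate.integral_doubleCentring_sub_sq_le (h : IsDegenerate φ m) {t : S → ℝ}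
    (ht : MemLp t 2 m) [Nonempty ι] {i j : ι} (hij : i ≠ j) :
    MemLp (fun x : ι → S => doubleCentring (withDiag φ t x) i j - φ (x i) (x j)) 2
      (Measure.pi fun _ => m) ∧
    ∫ x, (doubleCentring (withDiag φ t x) i j - φ (x i) (x j)) ^ 2 ∂(Measure.pi fun _ : ι => m)
      ≤ 18 * (∫ s, t s ^ 2 ∂m) / (Fintype.card ι : ℝ) ^ 2
        + 24 * meanSq φ m / Fintype.card ι := by
  set N : ℝ := (Fintype.card ι : ℝ) with hN
  have hN1 : 1 ≤ N := by rw [hN]; exact_mod_cast Fintype.card_pos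
  have hN0 : 0 < N := by linarith
  set P := (Measure.pi fun _ : ι => m)
  have ht' : ∀ i : ι, MemLp (fun x : ι → S => t (x i)) 2 P := fun i =>
    ht.comp_measurePreserving (measurePreserving_eval (fun _ : ι => m) i)
  have hT : ∀ i : ι, HasMean (fun x : ι → S => t (x i) ^ 2) P (∫ s, t s ^ 2 ∂m) := fun i =>
    ⟨(ht' i).integrable_sq, integral_coord (f := fun s => t s ^ 2) i (ht.1.pow 2)⟩
  have hh := h.memLp_hollow (ι := ι)
  have l1 : MemLp (fun x : ι → S => -(t (x j) + t (x i)) / N) 2 P := by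
    simp only [div_eq_mul_inv]; exact ((ht' j).add (ht' i)).neg.mul_const _
  have l2 : MemLp (fun x : ι → S => (∑ k, hollow φ x k j + ∑ k, hollow φ x i k) / N) 2 P := by
    simp only [div_eq_mul_inv]
    exact ((memLp_finsetSum _ fun k _ => hh k j).add
      (memLp_finsetSum _ fun k _ => hh i k)).mul_const _
  have l3 : MemLp (fun x : ι → S => (∑ k, t (x k)) / N ^ 2) 2 P := by
    simp only [div_eq_mul_inv]; exact (memLp_finsetSum _ fun k _ => ht' k).mul_const _
  have l4 : MemLp (fun x : ι → S => (∑ k, ∑ l, hollow φ x k l) / N ^ 2) 2 P := by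
    simp only [div_eq_mul_inv]
    exact (memLp_finsetSum _ fun k _ => memLp_finsetSum _ fun l _ => hh k l).mul_const _
  have hmem : MemLp (fun x : ι → S => doubleCentring (withDiag φ t x) i j - φ (x i) (x j)) 2 P := by
    simp only [doubleCentring_withDiag_sub φ t _ hij]
    exact ((l1.sub l2).add l3).add l4
  refine ⟨hmem, ?_⟩
  have hcol : ∀ x : ι → S, ∑ k, hollow φ x k j = ∑ k, hollow φ x j k := fun x =>
    Finset.sum_congr rfl fun k _ => hollow_symm h.symm x k j
  -- The error is a sum of six terms, whence the factor `6`. The diagonal contributes `6 + 6 + 6 =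
  -- 18` over `n²`; the row sums and the total contribute less than the stated `24 / n`.
  have hbound := ((((hT j).add (hT i)).const_mul (6 / N ^ 2)).add
    (((h.hasMean_row_sq j).add (h.hasMean_row_sq i)).const_mul (6 / N ^ 2))).add
    (((HasMean.sum Finset.univ fun k _ => hT k).const_mul (6 / N ^ 3)).add
      ((h.hasMean_total_sq (ι := ι)).const_mul (6 / N ^ 4)))
  refine (integral_mono hmem.integrable_sq hbound.integrable fun x => ?_).trans
    (hbound.integral_eq.trans_le ?_)
  · simp only [doubleCentring_withDiag_sub φ t x hij, hcol, ← hN]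
    set a := t (x j)
    set a' := t (x i)
    set r := ∑ k, hollow φ x j k
    set r' := ∑ k, hollow φ x i k
    set τ := ∑ k, t (x k) with hτ
    set w := ∑ k, ∑ l, hollow φ x k l
    have hs : τ ^ 2 ≤ N * ∑ k, t (x k) ^ 2 := by
      have := sq_sum_le_card_mul_sum_sq (s := Finset.univ) (f := fun k => t (x k))
      simpa [hN] using this
    have h3 : (τ / N ^ 2) ^ 2 ≤ (1 / N ^ 3) * ∑ k, t (x k) ^ 2 := by
      rw [div_pow, div_le_iff₀ (by positivity)]
      calc τ ^ 2 ≤ N * ∑ k, t (x k) ^ 2 := hs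
        _ = _ := by field_simp
    have h6 : ∀ p q r s u v : ℝ, (p + q + r + s + u + v) ^ 2
        ≤ 6 * (p ^ 2 + q ^ 2 + r ^ 2 + s ^ 2 + u ^ 2 + v ^ 2) := by
      intro p q r s u v
      have := sq_sum_le_card_mul_sum_sq (s := Finset.univ) (f := ![p, q, r, s, u, v])
      simp only [Fin.sum_univ_six, Finset.card_univ, Fintype.card_fin] at this
      simpa using this
    calc _ = (-a / N + -a' / N + -r / N + -r' / N + τ / N ^ 2 + w / N ^ 2) ^ 2 := by ring
      _ ≤ _ := h6 _ _ _ _ _ _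
      _ ≤ 6 * ((-a / N) ^ 2 + (-a' / N) ^ 2 + (-r / N) ^ 2 + (-r' / N) ^ 2
          + (1 / N ^ 3) * (∑ k, t (x k) ^ 2) + (w / N ^ 2) ^ 2) := by gcongr
      _ = _ := by ring
  · simp only [Finset.sum_const, Finset.card_univ, nsmul_eq_mul, ← hN]
    set T := ∫ s, t s ^ 2 ∂m
    set V := meanSq φ m
    have hV : 0 ≤ V := integral_nonneg fun _ => sq_nonneg _
    have e : 6 / N ^ 2 * (T + T) + 6 / N ^ 2 * (V * (N - 1) + V * (N - 1))
        + (6 / N ^ 3 * (N * T) + 6 / N ^ 4 * (V * (2 * N * (N - 1))))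
        = 18 * T / N ^ 2 + 24 * V / N - 12 * V / N - 12 * V / N ^ 3 := by
      field_simp
      ring
    have p1 : 0 ≤ 12 * V / N ^ 3 := by positivity
    have p2 : 0 ≤ 12 * V / N := by positivity
    linarith

/-- The analogue for a kernel that is not centred, and a square integrable diagonal. -/
theorem IsL2Kernel.integral_doubleCentring_sub_sq_le (h : IsL2Kernel φ m) {s : S → ℝ}
    (hs : MemLp s 2 m) [Nonempty ι] {i j : ι} (hij : i ≠ j) :
    MemLp (fun x : ι → S => doubleCentring (withDiag φ s x) i j - centred φ m (x i) (x j)) 2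
      (Measure.pi fun _ => m) ∧
    ∫ x, (doubleCentring (withDiag φ s x) i j - centred φ m (x i) (x j)) ^ 2
        ∂(Measure.pi fun _ : ι => m)
      ≤ 54 * (∫ y, s y ^ 2 ∂m + 5 * meanCross φ m) / (Fintype.card ι : ℝ) ^ 2
        + 24 * centredSq φ m / Fintype.card ι := by
  have hp := h.memLp_proj
  have hs2 : HasMean (fun y => s y ^ 2) m (∫ y, s y ^ 2 ∂m) := ⟨hs.integrable_sq, rfl⟩
  have hp2 : HasMean (fun y => proj φ m y ^ 2) m (meanCross φ m) :=
    ⟨hp.integrable_sq, h.integral_proj_sq⟩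
  have ht : MemLp (fun y => s y - 2 * proj φ m y + mean φ m) 2 m :=
    (hs.sub (hp.const_mul 2)).add (memLp_const _)
  have key := h.isDegenerate.integral_doubleCentring_sub_sq_le ht hij (ι := ι)
  simp only [doubleCentring_withDiag φ m s]
  refine ⟨key.1, key.2.trans ?_⟩
  rw [h.meanSq_centred]
  have hb := ((hs2.add (hp2.const_mul 4)).add (.const (mean φ m ^ 2))).const_mul 3
  -- Three summands cost a factor `3`, so `18` becomes `54`; the `5` is `4` from the doubled
  -- projection plus `1` from the mean, by `mean_sq_le`.
  have : ∫ y, (s y - 2 * proj φ m y + mean φ m) ^ 2 ∂m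
      ≤ 3 * (∫ y, s y ^ 2 ∂m + 5 * meanCross φ m) := by
    refine (integral_mono ht.integrable_sq hb.integrable fun y => ?_).trans
      (hb.integral_eq.trans_le ?_)
    · simp only
      nlinarith [sq_nonneg (s y + 2 * proj φ m y), sq_nonneg (s y - mean φ m),
        sq_nonneg (2 * proj φ m y + mean φ m)]
    · have := h.mean_sq_le; linarith
  have h18 : 18 * ∫ y, (s y - 2 * proj φ m y + mean φ m) ^ 2 ∂m
      ≤ 54 * (∫ y, s y ^ 2 ∂m + 5 * meanCross φ m) := by linarith
  gcongr

end Moments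

theorem HasMean.comp {α β : Type*} [MeasurableSpace α] [MeasurableSpace β] {μ : Measure α}
    {ν : Measure β} {f : β → ℝ} {v : ℝ} (h : HasMean f ν v) {e : α → β}
    (he : MeasurePreserving e μ ν) : HasMean (fun x => f (e x)) μ v := by
  refine ⟨he.integrable_comp_of_integrable h.1, ?_⟩
  rw [← h.2, ← he.map_eq, integral_map he.measurable.aemeasurable]
  rw [he.map_eq]; exact h.1.aestronglyMeasurable

theorem HasMean.mul_prod {α β : Type*} [MeasurableSpace α] [MeasurableSpace β] {μ : Measure α}
    {ν : Measure β} [SigmaFinite μ] [SigmaFinite ν] {f : α → ℝ} {g : β → ℝ} {u v : ℝ}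
    (hf : HasMean f μ u) (hg : HasMean g ν v) :
    HasMean (fun p : α × β => f p.1 * g p.2) (μ.prod ν) (u * v) :=
  ⟨hf.1.mul_prod hg.1, by rw [integral_prod_mul, hf.2, hg.2]⟩

theorem HasMean.mul_prodProd {α β : Type*} [MeasurableSpace α] [MeasurableSpace β] {μ : Measure α}
    {ν : Measure β} [IsProbabilityMeasure μ] [IsProbabilityMeasure ν] {f : α × α → ℝ}
    {g : β × β → ℝ} {u v : ℝ} (hf : HasMean f (μ.prod μ) u) (hg : HasMean g (ν.prod ν) v) :
    HasMean (fun p : (α × β) × (α × β) => f (p.1.1, p.2.1) * g (p.1.2, p.2.2))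
      ((μ.prod ν).prod (μ.prod ν)) (u * v) :=
  (hf.mul_prod hg).comp (measurePreserving_prodProdComm μ ν)

theorem HasMean.mono {α : Type*} [MeasurableSpace α] {μ : Measure α} {f g : α → ℝ} {u v : ℝ}
    (hf : HasMean f μ u) (hg : HasMean g μ v) (h : ∀ x, f x ≤ g x) : u ≤ v := by
  rw [← hf.2, ← hg.2]; exact integral_mono hf.1 hg.1 h

/-! ### A weak law of large numbers for sums of a nonnegative kernel. -/

section Chebyshev

variable {S : Type*} [MeasurableSpace S] {m : Measure S} [IsProbabilityMeasure m]
  {ι : Type*} [Fintype ι] [DecidableEq ι]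

theorem indepFun_pair {i j k l : ι} (hik : i ≠ k) (hil : i ≠ l) (hjk : j ≠ k) (hjl : j ≠ l) :
    IndepFun (fun x : ι → S => (x i, x j)) (fun x => (x k, x l)) (Measure.pi fun _ => m) := by
  have h := (iIndepFun_pi (μ := fun _ : ι => m) (X := fun _ => (id : S → S))
    (fun _ => aemeasurable_id))
  exact h.indepFun_prodMk_prodMk (fun i => measurable_pi_apply i) i j k l hik hil hjk hjl

/-- The variance is at most `E H² ≤ M E H`. Linearity in the mean matters: for the squared kernels
the mean is of order `b`, and a bound by `M²` would lose that factor. -/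
theorem hasMean_sub_sq_le {α : Type*} [MeasurableSpace α] {μ : Measure α} [IsProbabilityMeasure μ]
    {H : α → ℝ} {h M : ℝ} (hH : HasMean H μ h) (h0 : ∀ p, 0 ≤ H p) (hM : ∀ p, H p ≤ M) :
    ∃ v ≤ M * h, HasMean (fun p => (H p - h) ^ 2) μ v := by
  have hb : MemLp H 2 μ := MemLp.of_bound hH.1.aestronglyMeasurable M
    (ae_of_all _ fun p => by rw [Real.norm_eq_abs, abs_of_nonneg (h0 p)]; exact hM p)
  have h2 : HasMean (fun p => H p ^ 2) μ (∫ p, H p ^ 2 ∂μ) := ⟨hb.integrable_sq, rfl⟩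
  refine ⟨∫ p, H p ^ 2 ∂μ - 2 * h * h + h ^ 2, ?_, ?_⟩
  · have := h2.mono (hH.const_mul M) fun p => by
      rw [sq]; exact mul_le_mul_of_nonneg_right (hM p) (h0 p)
    nlinarith [sq_nonneg h]
  · exact ((h2.sub (hH.const_mul (2 * h))).add (.const (h ^ 2))).congr (fun p => by ring) rfl

/-- A Chebyshev bound for the U-statistic of a bounded nonnegative kernel. -/
theorem integral_sum_sub_sq_le {H : S × S → ℝ} {h M : ℝ} (hHm : Measurable H)
    (hH : HasMean H (m.prod m) h) (h0 : ∀ p, 0 ≤ H p) (hM : ∀ p, H p ≤ M) :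
    MemLp (fun x : ι → S => ∑ i, ∑ j, hollow (fun a b => H (a, b) - h) x i j) 2
      (Measure.pi fun _ => m) ∧
    ∫ x, (∑ i, ∑ j, hollow (fun a b => H (a, b) - h) x i j) ^ 2 ∂(Measure.pi fun _ : ι => m)
      ≤ 4 * (Fintype.card ι : ℝ) ^ 3 * (M * h) := by
  set P := Measure.pi fun _ : ι => m
  set c : S → S → ℝ := fun a b => H (a, b) - h with hc
  have hpair : ∀ i j : ι, i ≠ j → HasMean (fun x : ι → S => H (x i, x j)) P h := fun i j hij =>
    hH.comp (measurePreserving_pair hij)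
  have hh0 : 0 ≤ h := by rw [← hH.2]; exact integral_nonneg h0
  have hM0 : 0 ≤ M * h := by
    obtain ⟨v, hv, hv'⟩ := hasMean_sub_sq_le hH h0 hM
    rw [← hv'.2] at hv
    exact (integral_nonneg fun _ => sq_nonneg _).trans hv
  have hcl : ∀ i j : ι, MemLp (fun x : ι → S => hollow c x i j) 2 P := by
    intro i j
    unfold hollow
    split_ifs with hij
    · exact MemLp.zero
    · refine MemLp.of_bound ((hpair i j hij).1.aestronglyMeasurable.sub
        aestronglyMeasurable_const) (M + h) (ae_of_all _ fun x => ?_)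
      rw [Real.norm_eq_abs, abs_le]
      have h1 := h0 (x i, x j)
      have h2 := hM (x i, x j)
      constructor <;> simp only [hc] <;> linarith
  have hsq : ∀ i j : ι, ∫ x, hollow c x i j ^ 2 ∂P ≤ M * h := by
    intro i j
    unfold hollow
    split_ifs with hij
    · simpa using hM0
    · obtain ⟨v, hv, hv'⟩ := hasMean_sub_sq_le (hpair i j hij) (fun _ => h0 _) (fun _ => hM _)
      exact hv'.2.trans_le hv
  have hprod : ∀ i j k l : ι, ∫ x, hollow c x i j * hollow c x k l ∂P ≤ M * h := by
    intro i j k l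
    have := integral_mono ((hcl i j).integrable_mul (hcl k l))
      (((hcl i j).integrable_sq.add (hcl k l).integrable_sq).div_const 2) fun x => by
        simp only [Pi.mul_apply, Pi.add_apply]
        nlinarith [sq_nonneg (hollow c x i j - hollow c x k l)]
    rw [integral_div] at this
    simp only [Pi.add_apply, Pi.mul_apply] at this
    rw [integral_add (hcl i j).integrable_sq (hcl k l).integrable_sq] at this
    linarith [hsq i j, hsq k l]
  -- Disjoint pairs are independent, so the covariance vanishes unless an index is shared. Each of
  -- the four possible coincidences leaves `n³` choices, hence the constant `4`.
  have hcov : ∀ i j k l : ι, ∫ x, hollow c x i j * hollow c x k l ∂P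
      ≤ (M * h) * ((if k = i then 1 else 0) + (if k = j then 1 else 0) + (if l = i then 1 else 0)
        + if l = j then 1 else 0) := by
    intro i j k l
    by_cases hd : k = i ∨ k = j ∨ l = i ∨ l = j
    · refine (hprod i j k l).trans (le_mul_of_one_le_right hM0 ?_)
      rcases hd with hd | hd | hd | hd <;> simp only [hd, if_true] <;> split_ifs <;> norm_num
    · push Not at hd
      simp only [hd.1, hd.2.1, hd.2.2.1, hd.2.2.2, if_false, add_zero, mul_zero]
      refine le_of_eq ?_
      by_cases hij : i = j
      · simp [hollow, hij]
      by_cases hkl : k = l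
      · simp [hollow, hkl]
      simp only [hollow, hij, hkl, if_false, hc]
      have hi := (indepFun_pair (m := m) (Ne.symm hd.1) (Ne.symm hd.2.2.1) (Ne.symm hd.2.1)
        (Ne.symm hd.2.2.2)).comp (φ := fun p : S × S => H p - h) (ψ := fun p : S × S => H p - h)
        (hHm.sub_const h) (hHm.sub_const h)
      have e := hi.integral_fun_mul_eq_mul_integral
        ((hpair i j hij).1.aestronglyMeasurable.sub aestronglyMeasurable_const)
        ((hpair k l hkl).1.aestronglyMeasurable.sub aestronglyMeasurable_const)
      refine e.trans ?_
      have z : ∫ x, H (x i, x j) - h ∂P = 0 := by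
        rw [((hpair i j hij).sub (.const h)).2, sub_self]
      simp only [Function.comp_def]
      rw [z, zero_mul]
  refine ⟨memLp_finsetSum _ fun i _ => memLp_finsetSum _ fun j _ => hcl i j, ?_⟩
  have key : HasMean (fun x : ι → S => ∑ i, ∑ j, ∑ k, ∑ l, hollow c x i j * hollow c x k l) P
      (∑ i, ∑ j, ∑ k, ∑ l, ∫ x, hollow c x i j * hollow c x k l ∂P) :=
    .sum _ fun i _ => .sum _ fun j _ => .sum _ fun k _ => .sum _ fun l _ =>
      ⟨(hcl i j).integrable_mul (hcl k l), rfl⟩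
  have e : ∀ x : ι → S, (∑ i, ∑ j, hollow c x i j) ^ 2
      = ∑ i, ∑ j, ∑ k, ∑ l, hollow c x i j * hollow c x k l := by
    intro x
    simp only [sq, Finset.sum_mul, Finset.mul_sum]
    exact Finset.sum_congr rfl fun i _ => Finset.sum_congr rfl fun j _ =>
      Finset.sum_congr rfl fun k _ => Finset.sum_congr rfl fun l _ => mul_comm _ _
  simp_rw [e]
  rw [key.2]
  calc _ ≤ ∑ i : ι, ∑ j : ι, ∑ k : ι, ∑ l : ι, (M * h) * ((if k = i then 1 else 0)
        + (if k = j then 1 else 0) + (if l = i then 1 else 0) + if l = j then 1 else 0) :=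
        Finset.sum_le_sum fun i _ => Finset.sum_le_sum fun j _ => Finset.sum_le_sum fun k _ =>
          Finset.sum_le_sum fun l _ => hcov i j k l
    _ = _ := by
        simp only [← Finset.mul_sum, Finset.sum_add_distrib, Finset.sum_const, Finset.card_univ,
          nsmul_eq_mul, Finset.sum_ite_eq', Finset.mem_univ, if_true, mul_one]
        ring

/-- A weak law of large numbers by truncation: `H'` is a bounded minorant of the kernel `H`. -/
theorem integral_abs_sum_sub_le {H H' : S × S → ℝ} {h h' M : ℝ} (hHm : Measurable H')
    (hH : HasMean H (m.prod m) h) (hH' : HasMean H' (m.prod m) h') (h0 : ∀ p, 0 ≤ H' p)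
    (hM : ∀ p, H' p ≤ M) (hle : ∀ p, H' p ≤ H p) :
    Integrable (fun x : ι → S => ∑ i, ∑ j, hollow (fun a b => H (a, b) - h) x i j)
      (Measure.pi fun _ => m) ∧
    ∫ x, |∑ i, ∑ j, hollow (fun a b => H (a, b) - h) x i j| ∂(Measure.pi fun _ : ι => m)
      ≤ 2 * (Fintype.card ι : ℝ) ^ 2 * (h - h')
        + √(4 * (Fintype.card ι : ℝ) ^ 3 * (M * h')) := by
  set P := Measure.pi fun _ : ι => m
  set N : ℝ := (Fintype.card ι : ℝ) with hN
  have hd : 0 ≤ h - h' := by have := hH'.mono hH hle; linarith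
  obtain ⟨hm2, hcheb⟩ := integral_sum_sub_sq_le (ι := ι) hHm hH' h0 hM
  have habs : ∫ x, |∑ i, ∑ j, hollow (fun a b => H' (a, b) - h') x i j| ∂P
      ≤ √(4 * N ^ 3 * (M * h')) := by
    have hsq := sq_integral_le hm2.abs
    simp only [Pi.abs_apply, sq_abs] at hsq
    exact Real.le_sqrt_of_sq_le (hsq.trans hcheb)
  have hdiff : ∀ i j : ι, HasMean (fun x : ι → S => hollow (fun a b => H (a, b) - H' (a, b)) x i j)
      P (if i = j then 0 else h - h') := by
    intro i j
    unfold hollow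
    split_ifs with hij
    · exact .const 0
    · exact (hH.sub hH').comp (measurePreserving_pair hij)
  have hD := HasMean.sum Finset.univ fun i _ => HasMean.sum Finset.univ fun j _ => hdiff i j
  have hcst : HasMean (fun _ : ι → S => ∑ i : ι, ∑ j : ι, if i = j then 0 else h - h') P
      (∑ i : ι, ∑ j : ι, if i = j then 0 else h - h') := .const _
  have hval : (∑ i : ι, ∑ j : ι, if i = j then 0 else h - h') ≤ N ^ 2 * (h - h') := by
    simp_rw [sum_ne_const]
    simp only [Finset.sum_const, Finset.card_univ, nsmul_eq_mul, ← hN]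
    have : 0 ≤ N := Nat.cast_nonneg _
    nlinarith [mul_nonneg this hd]
  -- The discarded mass `h - h'` counts twice: as the mean of the nonnegative part `H - H'`, and as
  -- the shift between the two centring constants.
  have e : ∀ x : ι → S, ∑ i, ∑ j, hollow (fun a b => H (a, b) - h) x i j
      = (∑ i, ∑ j, hollow (fun a b => H (a, b) - H' (a, b)) x i j)
        + (∑ i, ∑ j, hollow (fun a b => H' (a, b) - h') x i j)
        - ∑ i : ι, ∑ j : ι, if i = j then 0 else h - h' := by
    intro x
    simp only [← Finset.sum_add_distrib, ← Finset.sum_sub_distrib]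
    refine Finset.sum_congr rfl fun i _ => Finset.sum_congr rfl fun j _ => ?_
    simp only [hollow]
    split_ifs <;> ring
  have hint : Integrable (fun x : ι → S => ∑ i, ∑ j, hollow (fun a b => H (a, b) - h) x i j) P := by
    simp_rw [e]
    exact (hD.1.add (hm2.integrable one_le_two)).sub (integrable_const _)
  refine ⟨hint, ?_⟩
  have hA : HasMean (fun x : ι → S => |∑ i, ∑ j, hollow (fun a b => H' (a, b) - h') x i j|) P
      (∫ x, |∑ i, ∑ j, hollow (fun a b => H' (a, b) - h') x i j| ∂P) :=
    ⟨(hm2.integrable one_le_two).abs, rfl⟩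
  have hbd := (hD.add hA).add hcst
  refine (integral_mono hint.abs hbd.1 fun x => ?_).trans (hbd.2.trans_le ?_)
  · simp only [e]
    have n1 : 0 ≤ ∑ i, ∑ j, hollow (fun a b => H (a, b) - H' (a, b)) x i j :=
      Finset.sum_nonneg fun i _ => Finset.sum_nonneg fun j _ => by
        unfold hollow; split_ifs
        · exact le_rfl
        · exact sub_nonneg.2 (hle _)
    have n2 : 0 ≤ ∑ i : ι, ∑ j : ι, if i = j then 0 else h - h' :=
      Finset.sum_nonneg fun i _ => Finset.sum_nonneg fun j _ => by
        split_ifs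
        · exact le_rfl
        · exact hd
    refine (abs_sub _ _).trans ?_
    rw [abs_of_nonneg n2]
    gcongr
    refine (abs_add_le _ _).trans ?_
    rw [abs_of_nonneg n1]
  · linarith

end Chebyshev

theorem tendsto_integral_sub_min {α : Type*} [MeasurableSpace α] {μ : Measure α} {f : α → ℝ}
    (hf : Integrable f μ) (h0 : ∀ x, 0 ≤ f x) :
    Tendsto (fun M : ℕ => ∫ x, (f x - min (f x) M) ∂μ) atTop (𝓝 0) := by
  rw [← integral_zero α ℝ (μ := μ)]
  refine tendsto_integral_of_dominated_convergence f (fun M => ?_) hf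
    (fun M => ae_of_all _ fun x => ?_) (ae_of_all _ fun x => ?_)
  · exact hf.aestronglyMeasurable.sub (hf.aestronglyMeasurable.inf aestronglyMeasurable_const)
  · rw [Real.norm_eq_abs, abs_of_nonneg (sub_nonneg.2 (min_le_left _ _))]
    have : 0 ≤ min (f x) M := le_min (h0 x) (Nat.cast_nonneg M)
    linarith
  · refine tendsto_const_nhds.congr' ?_
    filter_upwards [eventually_ge_atTop ⌈f x⌉₊] with M hM
    rw [min_eq_left ((Nat.le_ceil _).trans (by exact_mod_cast hM)), sub_self]

/-- The truncation level `M` is fixed before `n` grows, so the convergence of `s M` need not be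
uniform in `M`. -/
theorem tendsto_zero_of_forall_le {E : ℕ → ℝ} {s : ℕ → ℕ → ℝ} {e : ℕ → ℝ}
    (hE : ∀ᶠ n in atTop, 0 ≤ E n)
    (hle : ∀ M, ∀ᶠ n in atTop, E n ≤ e M + s M n) (he : Tendsto e atTop (𝓝 0))
    (hs : ∀ M, Tendsto (s M) atTop (𝓝 0)) : Tendsto E atTop (𝓝 0) := by
  rw [Metric.tendsto_atTop']
  intro ε hε
  obtain ⟨M, hM⟩ := (he.eventually (gt_mem_nhds (half_pos hε))).exists
  obtain ⟨n₀, hn₀⟩ := eventually_atTop.1 ((hE.and (hle M)).and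
    ((hs M).eventually (gt_mem_nhds (half_pos hε))))
  refine ⟨n₀, fun n hn => ?_⟩
  obtain ⟨⟨h1, h2⟩, h3⟩ := hn₀ n hn.le
  rw [Real.dist_eq, sub_zero, abs_of_nonneg h1]
  linarith

/-! ### Law of large numbers for the squared kernels at scale `n² b`. -/

section

variable {𝒳 𝒴 : Type*} [MeasurableSpace 𝒳] [MeasurableSpace 𝒴] {μ : Measure 𝒳} {ν : Measure 𝒴}
  [IsProbabilityMeasure μ] [IsProbabilityMeasure ν] {φ : 𝒳 → 𝒳 → ℝ} {η : 𝒴 → 𝒴 → ℝ}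
  {k g : ℝ → ℝ}

/-- The mean excess of a nonnegative function over a level. -/
def excess {α : Type*} [MeasurableSpace α] (f : α → ℝ) (m : Measure α) (M : ℝ) : ℝ :=
  ∫ x, (f x - min (f x) M) ∂m

theorem hasMean_min {α : Type*} [MeasurableSpace α] {f : α → ℝ} {m : Measure α}
    [IsProbabilityMeasure m] {v : ℝ} (hf : HasMean f m v) (M : ℝ) :
    HasMean (fun x => min (f x) M) m (v - excess f m M) := by
  have hi : Integrable (fun x => min (f x) M) m := hf.1.inf (integrable_const M)
  refine ⟨hi, ?_⟩
  rw [excess, integral_sub hf.1 hi, hf.2]; ring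

theorem excess_nonneg {α : Type*} [MeasurableSpace α] (f : α → ℝ) (m : Measure α) (M : ℝ) :
    0 ≤ excess f m M := integral_nonneg fun _ => sub_nonneg.2 (min_le_left _ _)

/-- The excess of `κ_b²` over `M` is again an even function of `(z - w) / b`, so it is of order `b`
with a constant that vanishes as `M` grows, uniformly in `b`. -/
theorem excess_kappa_sq_le (hk : IsSmoother k) (hg : IsDensity g) {b : ℝ} (hb : 0 < b) {M : ℝ}
    (hM : 0 ≤ M) :
    excess (fun p : ℝ × ℝ => kappa k b p.1 p.2 ^ 2) ((lifterLaw g).prod (lifterLaw g)) M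
      ≤ b * (excess (fun u => k u ^ 2) volume M * ∫ z, g z ^ 2) := by
  have hkm := hk.meas
  have h0 : ∀ u, 0 ≤ k u ^ 2 - min (k u ^ 2) M := fun u => sub_nonneg.2 (min_le_left _ _)
  have hi : Integrable fun u => k u ^ 2 - min (k u ^ 2) M := by
    refine hk.integrable_sq.mono' (by fun_prop : Measurable _).aestronglyMeasurable
      (ae_of_all _ fun u => ?_)
    rw [Real.norm_eq_abs, abs_of_nonneg (h0 u)]
    have : 0 ≤ min (k u ^ 2) M := le_min (sq_nonneg _) hM
    linarith
  have h := hasMean_lifterLaw_prod (q := fun u => k u ^ 2 - min (k u ^ 2) M) hg (by fun_prop) h0 hi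
    (fun u => by simp only [hk.even]) hb
  exact h.2.trans_le (mul_le_mul_of_nonneg_left (integral_mul_corr_le hg h0 hi b) hb.le)

theorem hasMean_kernel_prod {l : Measure ℝ} [IsProbabilityMeasure l] {f₁ : 𝒳 × 𝒳 → ℝ}
    {f₂ : 𝒴 × 𝒴 → ℝ} {f₃ : ℝ × ℝ → ℝ} {v₁ v₂ v₃ : ℝ} (h₁ : HasMean f₁ (μ.prod μ) v₁)
    (h₂ : HasMean f₂ (ν.prod ν) v₂) (h₃ : HasMean f₃ (l.prod l) v₃) :
    HasMean (fun p : (𝒳 × 𝒴 × ℝ) × (𝒳 × 𝒴 × ℝ) => f₁ (p.1.1, p.2.1) *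
        (f₂ (p.1.2.1, p.2.2.1) * f₃ (p.1.2.2, p.2.2.2)))
      ((μ.prod (ν.prod l)).prod (μ.prod (ν.prod l))) (v₁ * (v₂ * v₃)) :=
  h₁.mul_prodProd (g := fun q : (𝒴 × ℝ) × (𝒴 × ℝ) => f₂ (q.1.1, q.2.1) * f₃ (q.1.2, q.2.2))
    (h₂.mul_prodProd h₃)

/-- The centred sum of the squares of the products of the two kernels along a sample. -/
def sqSum {ι : Type*} [Fintype ι] [DecidableEq ι] (φ : 𝒳 → 𝒳 → ℝ) (ψ : 𝒴 × ℝ → 𝒴 × ℝ → ℝ) (h : ℝ)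
    (p : (ι → 𝒳) × (ι → 𝒴 × ℝ)) : ℝ :=
  ∑ i, ∑ j, if i = j then 0 else (φ (p.1 i) (p.1 j) * ψ (p.2 i) (p.2 j)) ^ 2 - h

/-- Truncating each squared factor at `M` gives a minorant bounded by `M³`, and the means still
factor. All error terms retain the factor `b`, under the square root for the Chebyshev term. -/
theorem integral_abs_sqSum_le (hφ : IsL2Kernel φ μ) (hη : IsL2Kernel η ν) (hk : IsSmoother k)
    (hg : IsDensity g) {b : ℝ} (hb : 0 < b) {M : ℝ} (hM : 0 ≤ M) (n : ℕ) :
    let G := (∫ u, k u ^ 2) * ∫ z, g z ^ 2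
    let P := (Measure.pi fun _ : Fin n => μ).prod
      (Measure.pi fun _ : Fin n => ν.prod (lifterLaw g))
    let h := meanSq φ μ * meanSq (lifted η k b) (ν.prod (lifterLaw g))
    Integrable (sqSum φ (lifted η k b) h) P ∧
    ∫ p, |sqSum φ (lifted η k b) h p| ∂P
      ≤ 2 * (n : ℝ) ^ 2 * (b * (excess (fun p : 𝒳 × 𝒳 => φ p.1 p.2 ^ 2) (μ.prod μ) M
            * meanSq η ν * G
          + meanSq φ μ * excess (fun p : 𝒴 × 𝒴 => η p.1 p.2 ^ 2) (ν.prod ν) M * G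
          + meanSq φ μ * meanSq η ν * (excess (fun u => k u ^ 2) volume M * ∫ z, g z ^ 2)))
        + √(4 * (n : ℝ) ^ 3 * (M ^ 3 * (b * (meanSq φ μ * meanSq η ν * G)))) := by
  intro G P h
  have := hg.isProbabilityMeasure
  have hκ := isL2Kernel_kappa hk hg hb
  have m₁ : HasMean (fun p : 𝒳 × 𝒳 => φ p.1 p.2 ^ 2) (μ.prod μ) (meanSq φ μ) :=
    ⟨hφ.integrable_sq, rfl⟩
  have m₂ : HasMean (fun p : 𝒴 × 𝒴 => η p.1 p.2 ^ 2) (ν.prod ν) (meanSq η ν) :=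
    ⟨hη.integrable_sq, rfl⟩
  have m₃ : HasMean (fun p : ℝ × ℝ => kappa k b p.1 p.2 ^ 2)
      ((lifterLaw g).prod (lifterLaw g)) (meanSq (kappa k b) (lifterLaw g)) :=
    ⟨hκ.integrable_sq, rfl⟩
  have x₁ := excess_nonneg (fun p : 𝒳 × 𝒳 => φ p.1 p.2 ^ 2) (μ.prod μ) M
  have x₂ := excess_nonneg (fun p : 𝒴 × 𝒴 => η p.1 p.2 ^ 2) (ν.prod ν) M
  have x₃ := excess_nonneg (fun p : ℝ × ℝ => kappa k b p.1 p.2 ^ 2)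
    ((lifterLaw g).prod (lifterLaw g)) M
  have y₃ := excess_kappa_sq_le hk hg hb hM
  have n₁ := hasMean_min m₁ M
  have n₂ := hasMean_min m₂ M
  have n₃ := hasMean_min m₃ M
  have z₁ : 0 ≤ meanSq φ μ - excess (fun p : 𝒳 × 𝒳 => φ p.1 p.2 ^ 2) (μ.prod μ) M := by
    rw [← n₁.2]; exact integral_nonneg fun p => le_min (sq_nonneg _) hM
  have z₂ : 0 ≤ meanSq η ν - excess (fun p : 𝒴 × 𝒴 => η p.1 p.2 ^ 2) (ν.prod ν) M := by
    rw [← n₂.2]; exact integral_nonneg fun p => le_min (sq_nonneg _) hM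
  have z₃ : 0 ≤ meanSq (kappa k b) (lifterLaw g) - excess (fun p : ℝ × ℝ => kappa k b p.1 p.2 ^ 2)
      ((lifterLaw g).prod (lifterLaw g)) M := by
    rw [← n₃.2]; exact integral_nonneg fun p => le_min (sq_nonneg _) hM
  have q₁ : 0 ≤ meanSq φ μ := integral_nonneg fun _ => sq_nonneg _
  have q₂ : 0 ≤ meanSq η ν := integral_nonneg fun _ => sq_nonneg _
  have hR := meanSq_kappa_le hk hg hb
  have hH := hasMean_kernel_prod m₁ m₂ m₃
  have hH' := hasMean_kernel_prod n₁ n₂ n₃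
  have hm' : Measurable fun p : (𝒳 × 𝒴 × ℝ) × (𝒳 × 𝒴 × ℝ) => min (φ p.1.1 p.2.1 ^ 2) M *
      (min (η p.1.2.1 p.2.2.1 ^ 2) M * min (kappa k b p.1.2.2 p.2.2.2 ^ 2) M) := by
    have f₁ := hφ.meas.comp (f := fun p : (𝒳 × 𝒴 × ℝ) × (𝒳 × 𝒴 × ℝ) => (p.1.1, p.2.1)) (by fun_prop)
    have f₂ := hη.meas.comp (f := fun p : (𝒳 × 𝒴 × ℝ) × (𝒳 × 𝒴 × ℝ) => (p.1.2.1, p.2.2.1))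
      (by fun_prop)
    have f₃ := hκ.meas.comp (f := fun p : (𝒳 × 𝒴 × ℝ) × (𝒳 × 𝒴 × ℝ) => (p.1.2.2, p.2.2.2))
      (by fun_prop)
    exact ((f₁.pow_const 2).min measurable_const).mul
      (((f₂.pow_const 2).min measurable_const).mul ((f₃.pow_const 2).min measurable_const))
  have key := integral_abs_sum_sub_le (ι := Fin n) (M := M ^ 3) hm' hH hH'
    (fun p => mul_nonneg (le_min (sq_nonneg _) hM)
      (mul_nonneg (le_min (sq_nonneg _) hM) (le_min (sq_nonneg _) hM)))
    (fun p => by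
      rw [show M ^ 3 = M * (M * M) by ring]
      exact mul_le_mul (min_le_right _ _) (mul_le_mul (min_le_right _ _) (min_le_right _ _)
        (le_min (sq_nonneg _) hM) hM) (mul_nonneg (le_min (sq_nonneg _) hM)
          (le_min (sq_nonneg _) hM)) hM)
    (fun p => mul_le_mul (min_le_left _ _) (mul_le_mul (min_le_left _ _) (min_le_left _ _)
        (le_min (sq_nonneg _) hM) (sq_nonneg _)) (mul_nonneg (le_min (sq_nonneg _) hM)
          (le_min (sq_nonneg _) hM)) (sq_nonneg _))
  have hh : h = meanSq φ μ * (meanSq η ν * meanSq (kappa k b) (lifterLaw g)) := by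
    simp only [h]; rw [meanSq_lifted hη hκ]
  have he := measurePreserving_arrowProdEquivProdArrow 𝒳 (𝒴 × ℝ) (Fin n) (fun _ => μ)
    (fun _ => ν.prod (lifterLaw g))
  have e : ∀ w : Fin n → 𝒳 × 𝒴 × ℝ,
      sqSum φ (lifted η k b) h (MeasurableEquiv.arrowProdEquivProdArrow 𝒳 (𝒴 × ℝ) (Fin n) w)
      = ∑ i, ∑ j, hollow (fun a c : 𝒳 × 𝒴 × ℝ => φ a.1 c.1 ^ 2 * (η a.2.1 c.2.1 ^ 2 *
          kappa k b a.2.2 c.2.2 ^ 2) - meanSq φ μ * (meanSq η ν *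
            meanSq (kappa k b) (lifterLaw g))) w i j := by
    intro w
    refine Finset.sum_congr rfl fun i _ => Finset.sum_congr rfl fun j _ => ?_
    simp only [hollow, hh]
    refine ite_congr rfl (fun _ => rfl) fun _ => ?_
    simp only [lifted, mul_pow]
    rfl
  constructor
  · rw [← he.integrable_comp_emb (MeasurableEquiv.measurableEmbedding _)]
    refine key.1.congr (ae_of_all _ fun w => (e w).symm)
  · rw [← he.integral_comp (MeasurableEquiv.measurableEmbedding _)]
    simp only [e]
    refine key.2.trans ?_
    rw [Fintype.card_fin]
    set p := meanSq φ μ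
    set q := meanSq η ν
    set r := meanSq (kappa k b) (lifterLaw g)
    set δp := excess (fun p : 𝒳 × 𝒳 => φ p.1 p.2 ^ 2) (μ.prod μ) M
    set δq := excess (fun p : 𝒴 × 𝒴 => η p.1 p.2 ^ 2) (ν.prod ν) M
    set δr := excess (fun p : ℝ × ℝ => kappa k b p.1 p.2 ^ 2)
      ((lifterLaw g).prod (lifterLaw g)) M
    set δk := excess (fun u => k u ^ 2) volume M
    have r0 : 0 ≤ r := by linarith
    -- The loss from truncating a product is telescoped over its three factors.
    have t1 : p * (q * r) - (p - δp) * ((q - δq) * (r - δr))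
        ≤ b * (δp * q * G + p * δq * G + p * q * (δk * ∫ z, g z ^ 2)) := by
      have a1 : δp * q * r ≤ δp * q * (b * G) := by gcongr
      have a2 : (p - δp) * δq * r ≤ p * δq * (b * G) := by
        gcongr; linarith
      have a3 : (p - δp) * (q - δq) * δr ≤ p * q * (b * (δk * ∫ z, g z ^ 2)) := by
        gcongr <;> linarith
      calc _ = δp * q * r + (p - δp) * δq * r + (p - δp) * (q - δq) * δr := by ring
        _ ≤ _ := add_le_add (add_le_add a1 a2) a3
        _ = _ := by ring
    have t2 : (p - δp) * ((q - δq) * (r - δr)) ≤ b * (p * q * G) := by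
      have : (p - δp) * ((q - δq) * (r - δr)) ≤ p * (q * (b * G)) := by
        gcongr <;> linarith
      calc _ ≤ _ := this
        _ = _ := by ring
    gcongr

/-- At scale `n² b` the Chebyshev term is of order `(nb)^(-1/2)` for a fixed truncation level, and
the truncation error does not depend on `n`. -/
theorem tendsto_integral_abs_sqSum (hφ : IsL2Kernel φ μ) (hη : IsL2Kernel η ν) (hk : IsSmoother k)
    (hg : IsDensity g) {b : ℕ → ℝ} (hb : ∀ n, 0 < b n)
    (hnb : Tendsto (fun n : ℕ => n * b n) atTop atTop) :
    Tendsto (fun n : ℕ => (∫ p, |sqSum φ (lifted η k (b n))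
        (meanSq φ μ * meanSq (lifted η k (b n)) (ν.prod (lifterLaw g))) p|
        ∂((Measure.pi fun _ : Fin n => μ).prod
          (Measure.pi fun _ : Fin n => ν.prod (lifterLaw g)))) / ((n : ℝ) ^ 2 * b n))
      atTop (𝓝 0) := by
  set G := (∫ u, k u ^ 2) * ∫ z, g z ^ 2 with hG
  have hb' := fun n => (hb n).le
  have t1 := tendsto_integral_sub_min hφ.integrable_sq (fun _ => sq_nonneg _)
  have t2 := tendsto_integral_sub_min hη.integrable_sq (fun _ => sq_nonneg _)
  have t3 := tendsto_integral_sub_min hk.integrable_sq (fun _ => sq_nonneg _)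
  have he := ((((t1.mul_const (meanSq η ν)).mul_const G).add
    ((t2.const_mul (meanSq φ μ)).mul_const G)).add
    ((t3.mul_const (∫ z, g z ^ 2)).const_mul (meanSq φ μ * meanSq η ν))).const_mul 2
  simp only [zero_mul, mul_zero, add_zero] at he
  refine tendsto_zero_of_forall_le (s := fun M n =>
    √(4 * ((M : ℝ) ^ 3 * (meanSq φ μ * meanSq η ν * G)) / (n * b n)))
    (Eventually.of_forall fun n => by have := hb' n; positivity) (fun M => ?_) he (fun M => ?_)
  · filter_upwards [eventually_ge_atTop 1] with n hn
    have hn' : (0 : ℝ) < n := by exact_mod_cast hn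
    have hbn := hb n
    have key := (integral_abs_sqSum_le hφ hη hk hg hbn (Nat.cast_nonneg M) n).2
    have hpos : 0 < (n : ℝ) ^ 2 * b n := by positivity
    rw [div_le_iff₀ hpos, add_mul]
    refine key.trans (le_of_eq ?_)
    congr 1
    · simp only [excess]; ring
    · have : (n : ℝ) ^ 2 * b n = √(((n : ℝ) ^ 2 * b n) ^ 2) := (Real.sqrt_sq hpos.le).symm
      conv_rhs => rw [this]
      rw [← Real.sqrt_mul' _ (sq_nonneg _)]
      congr 1
      rw [hG]
      field_simp
  · have h := hnb.inv_tendsto_atTop.const_mul (4 * ((M : ℝ) ^ 3 * (meanSq φ μ * meanSq η ν * G)))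
    rw [mul_zero] at h
    have h2 := (Real.continuous_sqrt.tendsto 0).comp h
    rw [Real.sqrt_zero] at h2
    refine h2.congr fun n => ?_
    simp [div_eq_mul_inv]

end

/-- The difference of products is expanded in the two errors. Each resulting term is a function of
`x` times a function of `y`, so under the product measure its second moment factors. -/
theorem memLp_mul_sub_mul {α β : Type*} [MeasurableSpace α] [MeasurableSpace β] {P : Measure α}
    {Q : Measure β} [IsProbabilityMeasure P] [IsProbabilityMeasure Q] {φ A : α → ℝ} {ψ B : β → ℝ}
    (hφ : MemLp φ 2 P) (hA : MemLp (fun x => A x - φ x) 2 P) (hψ : MemLp ψ 2 Q)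
    (hB : MemLp (fun y => B y - ψ y) 2 Q) :
    MemLp (fun p : α × β => A p.1 * B p.2 - φ p.1 * ψ p.2) 2 (P.prod Q) ∧
    ∫ p, (A p.1 * B p.2 - φ p.1 * ψ p.2) ^ 2 ∂(P.prod Q)
      ≤ 3 * ((∫ x, φ x ^ 2 ∂P) * (∫ y, (B y - ψ y) ^ 2 ∂Q)
        + (∫ x, (A x - φ x) ^ 2 ∂P) * (∫ y, ψ y ^ 2 ∂Q)
        + (∫ x, (A x - φ x) ^ 2 ∂P) * (∫ y, (B y - ψ y) ^ 2 ∂Q)) := by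
  have e : ∀ p : α × β, A p.1 * B p.2 - φ p.1 * ψ p.2 = φ p.1 * (B p.2 - ψ p.2)
      + (A p.1 - φ p.1) * ψ p.2 + (A p.1 - φ p.1) * (B p.2 - ψ p.2) := fun p => by ring
  have hm : MemLp (fun p : α × β => A p.1 * B p.2 - φ p.1 * ψ p.2) 2 (P.prod Q) := by
    simp only [e]
    exact ((memLp_mul_prod hφ hB).add (memLp_mul_prod hA hψ)).add (memLp_mul_prod hA hB)
  refine ⟨hm, ?_⟩
  have q1 : HasMean (fun x => φ x ^ 2) P (∫ x, φ x ^ 2 ∂P) := ⟨hφ.integrable_sq, rfl⟩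
  have q2 : HasMean (fun x => (A x - φ x) ^ 2) P (∫ x, (A x - φ x) ^ 2 ∂P) :=
    ⟨hA.integrable_sq, rfl⟩
  have q3 : HasMean (fun x => ψ x ^ 2) Q (∫ x, ψ x ^ 2 ∂Q) := ⟨hψ.integrable_sq, rfl⟩
  have q4 : HasMean (fun x => (B x - ψ x) ^ 2) Q (∫ x, (B x - ψ x) ^ 2 ∂Q) :=
    ⟨hB.integrable_sq, rfl⟩
  have hb := (((q1.mul_prod q4).add (q2.mul_prod q3)).add (q2.mul_prod q4)).const_mul 3
  refine (integral_mono hm.integrable_sq hb.1 fun p => ?_).trans hb.2.le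
  simp only [e p]
  set u := φ p.1 * (B p.2 - ψ p.2) with hu
  set v := (A p.1 - φ p.1) * ψ p.2 with hv
  set w := (A p.1 - φ p.1) * (B p.2 - ψ p.2) with hw
  calc (u + v + w) ^ 2 ≤ 3 * (u ^ 2 + v ^ 2 + w ^ 2) := by
        nlinarith [sq_nonneg (u - v), sq_nonneg (v - w), sq_nonneg (u - w)]
    _ = _ := by rw [hu, hv, hw]; ring

/-- Young's inequality `2|dh| ≤ d²/t + t h²` with `d = f - h`. The parameter `t` is kept free, to be
sent to zero after `n` has gone to infinity. -/
theorem integral_abs_sq_sub_sq_le {α : Type*} [MeasurableSpace α] {P : Measure α} {f h : α → ℝ}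
    (hh : MemLp h 2 P) (hd : MemLp (fun x => f x - h x) 2 P) {t : ℝ} (ht : 0 < t) :
    Integrable (fun x => f x ^ 2 - h x ^ 2) P ∧
    ∫ x, |f x ^ 2 - h x ^ 2| ∂P
      ≤ (1 + 1 / t) * (∫ x, (f x - h x) ^ 2 ∂P) + t * ∫ x, h x ^ 2 ∂P := by
  have hf : MemLp f 2 P := (hd.add hh).ae_eq (ae_of_all _ fun x => by simp)
  have hi := hf.integrable_sq.sub hh.integrable_sq
  have q1 : HasMean (fun x => (f x - h x) ^ 2) P (∫ x, (f x - h x) ^ 2 ∂P) :=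
    ⟨hd.integrable_sq, rfl⟩
  have q2 : HasMean (fun x => h x ^ 2) P (∫ x, h x ^ 2 ∂P) := ⟨hh.integrable_sq, rfl⟩
  have hb := (q1.const_mul (1 + 1 / t)).add (q2.const_mul t)
  refine ⟨hi, (integral_mono hi.abs hb.1 fun x => ?_).trans hb.2.le⟩
  simp only [Pi.sub_apply]
  have e : f x ^ 2 - h x ^ 2 = (f x - h x) ^ 2 + 2 * (f x - h x) * h x := by ring
  set d := f x - h x
  have hp : 0 ≤ 1 / t := by positivity
  have h1 : (1 + 1 / t) * d ^ 2 + t * h x ^ 2 - (d ^ 2 + 2 * d * h x) = 1 / t * (d - t * h x) ^ 2 := by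
    field_simp; ring
  have h2 : (1 + 1 / t) * d ^ 2 + t * h x ^ 2 + (d ^ 2 + 2 * d * h x)
      = 2 * d ^ 2 + 1 / t * (d + t * h x) ^ 2 := by
    field_simp; ring
  rw [e, abs_le]
  constructor
  · have := mul_nonneg hp (sq_nonneg (d + t * h x)); nlinarith [sq_nonneg d]
  · have := mul_nonneg hp (sq_nonneg (d - t * h x)); linarith

/-! ### Replacing the doubly centred matrices by kernels. -/

section Estimator

variable {S V : Type*} [MeasurableSpace S] [MeasurableSpace V] {m : Measure S} {τ : Measure V}
  [IsProbabilityMeasure m] [IsProbabilityMeasure τ] {φ : S → S → ℝ} {ψ : V → V → ℝ}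
  {ι : Type*} [Fintype ι] [DecidableEq ι]

/-- The sum of the squared off-diagonal entries of the entrywise product of two doubly centred
matrices of kernels with prescribed diagonals. -/
def estSum (φ : S → S → ℝ) (ψ : V → V → ℝ) (s : S → ℝ) (t : V → ℝ) (p : (ι → S) × (ι → V)) : ℝ :=
  ∑ i, ∑ j, if i = j then 0 else
    (doubleCentring (withDiag φ s p.1) i j * doubleCentring (withDiag ψ t p.2) i j) ^ 2

/-- The target here is the kernel without centring. The extra cost is at most a multiple of
`meanCross`, which for `η κ_b` is `O(b²)` and negligible against its second moment of order `b`. -/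
theorem IsL2Kernel.integral_doubleCentring_sub_sq_le' (h : IsL2Kernel ψ τ) {s : V → ℝ}
    (hs : MemLp s 2 τ) [Nonempty ι] {i j : ι} (hij : i ≠ j) :
    MemLp (fun x : ι → V => doubleCentring (withDiag ψ s x) i j - ψ (x i) (x j)) 2
      (Measure.pi fun _ => τ) ∧
    ∫ x, (doubleCentring (withDiag ψ s x) i j - ψ (x i) (x j)) ^ 2 ∂(Measure.pi fun _ : ι => τ)
      ≤ 2 * (54 * (∫ y, s y ^ 2 ∂τ + 5 * meanCross ψ τ) / (Fintype.card ι : ℝ) ^ 2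
        + 24 * centredSq ψ τ / Fintype.card ι + 2 * meanCross ψ τ) := by
  obtain ⟨h1, h2⟩ := h.integral_doubleCentring_sub_sq_le hs hij
  have h3 : MemLp (fun p : V × V => centred ψ τ p.1 p.2 - ψ p.1 p.2) 2 (τ.prod τ) :=
    h.centred_kernel.memLp.sub h.memLp
  have h4 : HasMean (fun p : V × V => (centred ψ τ p.1 p.2 - ψ p.1 p.2) ^ 2) (τ.prod τ)
      (2 * meanCross ψ τ - mean ψ τ ^ 2) := ⟨h3.integrable_sq, h.integral_sub_centred_sq⟩
  have h5 : MemLp (fun x : ι → V => centred ψ τ (x i) (x j) - ψ (x i) (x j)) 2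
      (Measure.pi fun _ => τ) := h3.comp_measurePreserving (measurePreserving_pair hij)
  have e : ∀ x : ι → V, doubleCentring (withDiag ψ s x) i j - ψ (x i) (x j)
      = (doubleCentring (withDiag ψ s x) i j - centred ψ τ (x i) (x j))
        + (centred ψ τ (x i) (x j) - ψ (x i) (x j)) := fun x => by ring
  have hm : MemLp (fun x : ι → V => doubleCentring (withDiag ψ s x) i j - ψ (x i) (x j)) 2
      (Measure.pi fun _ => τ) := by simp only [e]; exact h1.add h5
  refine ⟨hm, ?_⟩
  have hb := (HasMean.add ⟨h1.integrable_sq, rfl⟩ (h4.comp (measurePreserving_pair hij))).const_mul 2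
  refine (integral_mono hm.integrable_sq hb.1 fun x => ?_).trans (hb.2.trans_le ?_)
  · simp only [e x]
    nlinarith [sq_nonneg ((doubleCentring (withDiag ψ s x) i j - centred ψ τ (x i) (x j))
      - (centred ψ τ (x i) (x j) - ψ (x i) (x j)))]
  · nlinarith [sq_nonneg (mean ψ τ)]

theorem integral_abs_estSum_sub_le (hφ : IsL2Kernel φ m) (hψ : IsL2Kernel ψ τ) {s : S → ℝ}
    {s' : V → ℝ} (hs : MemLp s 2 m) (hs' : MemLp s' 2 τ) [Nonempty ι] {D R t : ℝ} (ht : 0 < t)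
    (hD : 54 * (∫ y, s y ^ 2 ∂m + 5 * meanCross φ m) / (Fintype.card ι : ℝ) ^ 2
        + 24 * centredSq φ m / Fintype.card ι ≤ D)
    (hR : 2 * (54 * (∫ y, s' y ^ 2 ∂τ + 5 * meanCross ψ τ) / (Fintype.card ι : ℝ) ^ 2
        + 24 * centredSq ψ τ / Fintype.card ι + 2 * meanCross ψ τ) ≤ R) :
    Integrable (fun p : (ι → S) × (ι → V) => estSum φ ψ s s' p - ∑ i, ∑ j, if i = j then 0 else
      (centred φ m (p.1 i) (p.1 j) * ψ (p.2 i) (p.2 j)) ^ 2)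
      ((Measure.pi fun _ => m).prod (Measure.pi fun _ => τ)) ∧
    ∫ p, |estSum φ ψ s s' p - ∑ i, ∑ j, if i = j then 0 else
        (centred φ m (p.1 i) (p.1 j) * ψ (p.2 i) (p.2 j)) ^ 2|
        ∂((Measure.pi fun _ : ι => m).prod (Measure.pi fun _ : ι => τ))
      ≤ (Fintype.card ι : ℝ) ^ 2 * ((1 + 1 / t) * (3 * (centredSq φ m * R + D * meanSq ψ τ + D * R))
        + t * (centredSq φ m * meanSq ψ τ)) := by
  set P := (Measure.pi fun _ : ι => m).prod (Measure.pi fun _ : ι => τ)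
  set a : ι → ι → (ι → S) × (ι → V) → ℝ := fun i j p =>
    doubleCentring (withDiag φ s p.1) i j * doubleCentring (withDiag ψ s' p.2) i j
  set c : ι → ι → (ι → S) × (ι → V) → ℝ := fun i j p =>
    centred φ m (p.1 i) (p.1 j) * ψ (p.2 i) (p.2 j)
  set B := (1 + 1 / t) * (3 * (centredSq φ m * R + D * meanSq ψ τ + D * R))
        + t * (centredSq φ m * meanSq ψ τ)
  have hV := hφ.centredSq_nonneg
  have hW : 0 ≤ meanSq ψ τ := integral_nonneg fun _ => sq_nonneg _
  have hD0 : 0 ≤ D := by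
    refine le_trans ?_ hD
    have := hφ.meanCross_nonneg
    have : 0 ≤ ∫ y, s y ^ 2 ∂m := integral_nonneg fun _ => sq_nonneg _
    positivity
  have hR0 : 0 ≤ R := by
    refine le_trans ?_ hR
    have := hψ.meanCross_nonneg
    have := hψ.centredSq_nonneg
    have : 0 ≤ ∫ y, s' y ^ 2 ∂τ := integral_nonneg fun _ => sq_nonneg _
    positivity
  have hB0 : 0 ≤ B := by positivity
  have main : ∀ i j : ι, i ≠ j → Integrable (fun p => a i j p ^ 2 - c i j p ^ 2) P ∧
      ∫ p, |a i j p ^ 2 - c i j p ^ 2| ∂P ≤ B := by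
    intro i j hij
    obtain ⟨d1, d2⟩ := hφ.integral_doubleCentring_sub_sq_le hs hij (ι := ι)
    obtain ⟨r1, r2⟩ := hψ.integral_doubleCentring_sub_sq_le' hs' hij (ι := ι)
    have l1 := hφ.centred_kernel.memLp_pair (ι := ι) hij
    have l2 := hψ.memLp_pair (ι := ι) hij
    have i1 : ∫ x : ι → S, centred φ m (x i) (x j) ^ 2 ∂(Measure.pi fun _ => m) = centredSq φ m := by
      rw [← hφ.meanSq_centred]
      exact integral_pair (f := fun p => centred φ m p.1 p.2 ^ 2)
        (hφ.centred_kernel.meas.pow_const 2) hij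
    have i2 : ∫ x : ι → V, ψ (x i) (x j) ^ 2 ∂(Measure.pi fun _ => τ) = meanSq ψ τ :=
      integral_pair (f := fun p => ψ p.1 p.2 ^ 2) (hψ.meas.pow_const 2) hij
    obtain ⟨k1, k2⟩ := memLp_mul_sub_mul l1 d1 l2 r1
    rw [i1, i2] at k2
    have l3 : MemLp (c i j) 2 P := memLp_mul_prod l1 l2
    obtain ⟨n1, n2⟩ := integral_abs_sq_sub_sq_le l3 k1 ht
    refine ⟨n1, n2.trans ?_⟩
    have i3 : ∫ p, c i j p ^ 2 ∂P = centredSq φ m * meanSq ψ τ := by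
      rw [← i1, ← i2, ← integral_prod_mul]
      simp only [c, mul_pow]
      rfl
    rw [i3]
    have hD' := d2.trans hD
    have hR' := r2.trans hR
    have : 0 ≤ 1 / t := by positivity
    refine add_le_add_left (mul_le_mul_of_nonneg_left (k2.trans ?_) (by linarith)) _
    have x1 : 0 ≤ ∫ x : ι → V, (doubleCentring (withDiag ψ s' x) i j - ψ (x i) (x j)) ^ 2
      ∂(Measure.pi fun _ : ι => τ) := integral_nonneg fun _ => sq_nonneg _
    gcongr
  have e : ∀ p : (ι → S) × (ι → V), estSum φ ψ s s' p - (∑ i, ∑ j, if i = j then 0 else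
      (centred φ m (p.1 i) (p.1 j) * ψ (p.2 i) (p.2 j)) ^ 2)
      = ∑ i, ∑ j, if i = j then 0 else (a i j p ^ 2 - c i j p ^ 2) := by
    intro p
    simp only [estSum, ← Finset.sum_sub_distrib]
    refine Finset.sum_congr rfl fun i _ => Finset.sum_congr rfl fun j _ => ?_
    split_ifs
    · simp
    · rfl
  have hI : ∀ i j : ι, Integrable (fun p => if i = j then 0 else (a i j p ^ 2 - c i j p ^ 2)) P := by
    intro i j
    split_ifs with hij
    · exact integrable_zero _ _ _
    · exact (main i j hij).1
  have hI2 : ∀ i j : ι, ∫ p, |if i = j then 0 else (a i j p ^ 2 - c i j p ^ 2)| ∂P ≤ B := by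
    intro i j
    split_ifs with hij
    · simpa using hB0
    · exact (main i j hij).2
  have hint : Integrable (fun p => ∑ i, ∑ j, if i = j then 0 else (a i j p ^ 2 - c i j p ^ 2)) P :=
    integrable_finsetSum _ fun i _ => integrable_finsetSum _ fun j _ => hI i j
  simp only [e]
  refine ⟨hint, ?_⟩
  have hS := HasMean.sum Finset.univ fun i _ => HasMean.sum Finset.univ fun j _ =>
    (⟨(hI i j).abs, rfl⟩ : HasMean (fun p => |if i = j then 0 else (a i j p ^ 2 - c i j p ^ 2)|) P
      (∫ p, |if i = j then 0 else (a i j p ^ 2 - c i j p ^ 2)| ∂P))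
  refine (integral_mono hint.abs hS.1 fun p => ?_).trans (hS.2.trans_le ?_)
  · exact (Finset.abs_sum_le_sum_abs _ _).trans
      (Finset.sum_le_sum fun i _ => Finset.abs_sum_le_sum_abs _ _)
  · refine (Finset.sum_le_sum fun i _ => Finset.sum_le_sum fun j _ => hI2 i j).trans ?_
    simp only [Finset.sum_const, Finset.card_univ, nsmul_eq_mul]
    exact le_of_eq (by ring)

end Estimator

/-! ### Convergence in mean of the sum of squares. -/

section

variable {𝒳 𝒴 : Type*} [MeasurableSpace 𝒳] [MeasurableSpace 𝒴] {μ : Measure 𝒳} {ν : Measure 𝒴}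
  [IsProbabilityMeasure μ] [IsProbabilityMeasure ν] {ζ : 𝒳 → 𝒳 → ℝ} {η : 𝒴 → 𝒴 → ℝ}
  {k g : ℝ → ℝ}

/-- The second kernel has mean square and mean square error of the forms `G b` and `R b`, so `n² b`
divides out and leaves explicit `D` and `R`. Second moments of the diagonals up to `K n` are
affordable: they enter divided by `n²`, giving `K / n` in `D` and `K / (nb)` in `R`. -/
theorem abs_estSum_sub_bound (hζ : IsL2Kernel ζ μ) (hη : IsL2Kernel η ν) (hk : IsSmoother k)
    (hg : IsDensity g) {b : ℝ} (hb : 0 < b) {n : ℕ} (hn : 0 < n) {s : 𝒳 → ℝ} {s' : 𝒴 × ℝ → ℝ}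
    {K t : ℝ} (ht : 0 < t) (hs : MemLp s 2 μ) (hs' : MemLp s' 2 (ν.prod (lifterLaw g)))
    (hsK : ∫ x, s x ^ 2 ∂μ ≤ K * n) (hsK' : ∫ v, s' v ^ 2 ∂(ν.prod (lifterLaw g)) ≤ K * n) :
    let Q := (Measure.pi fun _ : Fin n => μ).prod
      (Measure.pi fun _ : Fin n => ν.prod (lifterLaw g))
    let h := centredSq ζ μ * meanSq (lifted η k b) (ν.prod (lifterLaw g))
    let G := meanSq η ν * ((∫ u, k u ^ 2) * ∫ z, g z ^ 2)
    let C := 3 * meanCross η ν * ∫ z, g z ^ 3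
    let D := 54 * (K / n + 5 * meanCross ζ μ * (1 / n) ^ 2) + 24 * centredSq ζ μ * (1 / n)
    let R := 2 * (54 * (K * (1 / (n * b)) + 5 * C * b * (1 / n) ^ 2) + 24 * G * (1 / n)
      + 2 * C * b)
    Integrable (fun p => estSum ζ (lifted η k b) s s' p - n * (n - 1) * h) Q ∧
    (∫ p, |estSum ζ (lifted η k b) s s' p - n * (n - 1) * h| ∂Q) / ((n : ℝ) ^ 2 * b)
      ≤ t * (centredSq ζ μ * G)
        + ((1 + 1 / t) * (3 * (centredSq ζ μ * R + D * G + D * R))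
          + (∫ p, |sqSum (centred ζ μ) (lifted η k b)
            (meanSq (centred ζ μ) μ * meanSq (lifted η k b) (ν.prod (lifterLaw g))) p| ∂Q)
              / ((n : ℝ) ^ 2 * b)) := by
  intro Q h G C D R
  have := hg.isProbabilityMeasure
  have : Nonempty (Fin n) := ⟨⟨0, hn⟩⟩
  have hn' : (0 : ℝ) < n := by exact_mod_cast hn
  have hψ := isL2Kernel_lifted hη (isL2Kernel_kappa hk hg hb)
  have m1 := meanSq_lifted_le hη hk hg hb
  have m2 := meanCross_lifted_le hη hk hg hb
  have m3 := hψ.centredSq_le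
  have v1 := hζ.centredSq_nonneg
  have hD : 54 * (∫ y, s y ^ 2 ∂μ + 5 * meanCross ζ μ) / (Fintype.card (Fin n) : ℝ) ^ 2
        + 24 * centredSq ζ μ / Fintype.card (Fin n) ≤ D := by
    rw [Fintype.card_fin]
    calc _ ≤ 54 * (K * n + 5 * meanCross ζ μ) / (n : ℝ) ^ 2 + 24 * centredSq ζ μ / n := by gcongr
      _ = D := by simp only [D]; field_simp
  have hR : 2 * (54 * (∫ y, s' y ^ 2 ∂(ν.prod (lifterLaw g))
        + 5 * meanCross (lifted η k b) (ν.prod (lifterLaw g))) / (Fintype.card (Fin n) : ℝ) ^ 2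
        + 24 * centredSq (lifted η k b) (ν.prod (lifterLaw g)) / Fintype.card (Fin n)
        + 2 * meanCross (lifted η k b) (ν.prod (lifterLaw g))) ≤ R * b := by
    rw [Fintype.card_fin]
    calc _ ≤ 2 * (54 * (K * n + 5 * (C * b ^ 2)) / (n : ℝ) ^ 2 + 24 * (G * b) / n
          + 2 * (C * b ^ 2)) := by gcongr; exact m3.trans m1
      _ = R * b := by simp only [R]; field_simp
  obtain ⟨i1, i2⟩ := integral_abs_estSum_sub_le hζ hψ hs hs' ht hD hR
  have i3 := (integral_abs_sqSum_le hζ.centred_kernel hη hk hg hb zero_le_one n).1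
  rw [hζ.meanSq_centred] at i3 ⊢
  have e : ∀ p : (Fin n → 𝒳) × (Fin n → 𝒴 × ℝ),
      estSum ζ (lifted η k b) s s' p - n * (n - 1) * h
      = (estSum ζ (lifted η k b) s s' p - ∑ i, ∑ j, if i = j then 0 else
          (centred ζ μ (p.1 i) (p.1 j) * lifted η k b (p.2 i) (p.2 j)) ^ 2)
        + sqSum (centred ζ μ) (lifted η k b) h p := by
    intro p
    have e1 : sqSum (centred ζ μ) (lifted η k b) h p = (∑ i, ∑ j, if i = j then 0 else
          (centred ζ μ (p.1 i) (p.1 j) * lifted η k b (p.2 i) (p.2 j)) ^ 2)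
        - ∑ i : Fin n, ∑ j : Fin n, if i = j then 0 else h := by
      simp only [sqSum, ← Finset.sum_sub_distrib]
      refine Finset.sum_congr rfl fun i _ => Finset.sum_congr rfl fun j _ => ?_
      split_ifs <;> simp
    rw [e1]
    simp_rw [sum_ne_const]
    simp only [Finset.sum_const, Finset.card_univ, nsmul_eq_mul, Fintype.card_fin]
    ring
  simp only [e]
  refine ⟨i1.add i3, ?_⟩
  have hpos : 0 < (n : ℝ) ^ 2 * b := by positivity
  have hD0 : 0 ≤ D := by
    refine le_trans ?_ hD
    have := hζ.meanCross_nonneg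
    have : 0 ≤ ∫ y, s y ^ 2 ∂μ := integral_nonneg fun _ => sq_nonneg _
    positivity
  have hb1 : ∫ p, |(estSum ζ (lifted η k b) s s' p - ∑ i, ∑ j, if i = j then 0 else
          (centred ζ μ (p.1 i) (p.1 j) * lifted η k b (p.2 i) (p.2 j)) ^ 2)
        + sqSum (centred ζ μ) (lifted η k b) h p| ∂Q
      ≤ (n : ℝ) ^ 2 * b * (t * (centredSq ζ μ * G)
          + (1 + 1 / t) * (3 * (centredSq ζ μ * R + D * G + D * R)))
        + ∫ p, |sqSum (centred ζ μ) (lifted η k b) h p| ∂Q := by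
    refine (integral_mono (i1.add i3).abs (i1.abs.add i3.abs) fun p => abs_add_le _ _).trans ?_
    rw [integral_add' i1.abs i3.abs]
    refine add_le_add_left (i2.trans ?_) _
    rw [Fintype.card_fin]
    have hp : 0 ≤ 1 / t := by positivity
    calc _ ≤ (n : ℝ) ^ 2 * ((1 + 1 / t) * (3 * (centredSq ζ μ * (R * b) + D * (G * b)
          + D * (R * b))) + t * (centredSq ζ μ * (G * b))) := by gcongr
      _ = _ := by ring
  rw [div_le_iff₀ hpos, add_mul, add_mul, div_mul_cancel₀ _ hpos.ne']
  linarith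

theorem tendsto_integral_abs_estSum_sub (hζ : IsL2Kernel ζ μ) (hη : IsL2Kernel η ν)
    (hk : IsSmoother k) (hg : IsDensity g) {b : ℕ → ℝ} (hb : ∀ n, 0 < b n)
    (hb0 : Tendsto b atTop (𝓝 0)) (hnb : Tendsto (fun n : ℕ => n * b n) atTop atTop)
    {s : ℕ → 𝒳 → ℝ} {s' : ℕ → 𝒴 × ℝ → ℝ} {K : ℝ} (hs : ∀ n, MemLp (s n) 2 μ)
    (hs' : ∀ n, MemLp (s' n) 2 (ν.prod (lifterLaw g))) (hsK : ∀ n, ∫ x, s n x ^ 2 ∂μ ≤ K * n)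
    (hsK' : ∀ n, ∫ v, s' n v ^ 2 ∂(ν.prod (lifterLaw g)) ≤ K * n) :
    Tendsto (fun n : ℕ => (∫ p, |estSum ζ (lifted η k (b n)) (s n) (s' n) p
        - n * (n - 1) * (centredSq ζ μ * meanSq (lifted η k (b n)) (ν.prod (lifterLaw g)))|
      ∂((Measure.pi fun _ : Fin n => μ).prod
        (Measure.pi fun _ : Fin n => ν.prod (lifterLaw g)))) / ((n : ℝ) ^ 2 * b n))
      atTop (𝓝 0) := by
  have t1 : Tendsto (fun n : ℕ => 1 / (n : ℝ)) atTop (𝓝 0) := tendsto_one_div_atTop_nhds_zero_nat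
  have t2 : Tendsto (fun n : ℕ => 1 / (n * b n)) atTop (𝓝 0) := by
    simp only [one_div]; exact hnb.inv_tendsto_atTop
  have t0 : Tendsto (fun n : ℕ => K / (n : ℝ)) atTop (𝓝 0) := tendsto_const_div_atTop_nhds_zero_nat K
  set G := meanSq η ν * ((∫ u, k u ^ 2) * ∫ z, g z ^ 2)
  set C := 3 * meanCross η ν * ∫ z, g z ^ 3
  have tD := ((t0.add ((t1.pow 2).const_mul (5 * meanCross ζ μ))).const_mul 54).add
    (t1.const_mul (24 * centredSq ζ μ))
  have tR := (((((t2.const_mul K).add ((hb0.const_mul (5 * C)).mul (t1.pow 2))).const_mul 54).add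
    (t1.const_mul (24 * G))).add (hb0.const_mul (2 * C))).const_mul 2
  -- Young's parameter is `t = 1 / (M + 1)`: the term proportional to `t` vanishes with `M`, and for
  -- fixed `M` all other terms vanish with `n`.
  have tM : Tendsto (fun M : ℕ => 1 / ((M : ℝ) + 1) * (centredSq ζ μ * G)) atTop (𝓝 0) := by
    simpa using tendsto_one_div_add_atTop_nhds_zero_nat.mul_const (centredSq ζ μ * G)
  have tU := tendsto_integral_abs_sqSum hζ.centred_kernel hη hk hg hb hnb
  have hS := fun M : ℕ => ((((tR.const_mul (centredSq ζ μ)).add (tD.mul_const G)).add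
    (tD.mul tR)).const_mul 3 |>.const_mul (1 + 1 / (1 / ((M : ℝ) + 1)))).add tU
  simp only [ne_eq, OfNat.ofNat_ne_zero, not_false_eq_true, zero_pow, mul_zero, add_zero,
    zero_mul] at hS
  refine tendsto_zero_of_forall_le (Eventually.of_forall fun n => ?_) (fun M => ?_) tM hS
  · have := (hb n).le
    positivity
  · filter_upwards [eventually_gt_atTop 0] with n hn
    exact (abs_estSum_sub_bound hζ hη hk hg (hb n) hn (by positivity) (hs n) (hs' n) (hsK n)
      (hsK' n)).2

end

/-- Markov's inequality for `f'`, plus the probability of the exceptional set. The set allows `f` to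
be non-integrable, as happens when its diagonal terms are not truncated. -/
theorem tendstoInMeasure_const_of_integral {Ω : Type*} [MeasurableSpace Ω] {P : Measure Ω}
    {f f' : ℕ → Ω → ℝ} {c : ℝ} {B : ℕ → Set Ω} (hi : ∀ᶠ n in atTop, Integrable (f' n) P)
    (hf' : Tendsto (fun n => ∫ s, |f' n s| ∂P) atTop (𝓝 0))
    (hB : Tendsto (fun n => P (B n)) atTop (𝓝 0))
    (h : ∀ᶠ n in atTop, ∀ s, s ∉ B n → f n s - c = f' n s) :
    TendstoInMeasure P f atTop (fun _ => c) := by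
  rw [tendstoInMeasure_iff_norm]
  intro ε hε
  have hr : Tendsto (fun n => P (B n) + ENNReal.ofReal ((∫ s, |f' n s| ∂P) / ε)) atTop (𝓝 0) := by
    have := hB.add (ENNReal.tendsto_ofReal (hf'.div_const ε))
    simpa using this
  refine tendsto_of_tendsto_of_tendsto_of_le_of_le' tendsto_const_nhds hr
    (Eventually.of_forall fun _ => zero_le) ?_
  filter_upwards [hi, h] with n hin hn
  have hsub : {x | ε ≤ ‖f n x - c‖} ⊆ B n ∪ {x | ε ≤ |f' n x|} := by
    intro x hx
    by_cases hxB : x ∈ B n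
    · exact Or.inl hxB
    · right
      rw [Set.mem_ofPred_eq, ← hn x hxB]
      exact hx
  refine (measure_mono hsub).trans ((measure_union_le _ _).trans (add_le_add_right ?_ _))
  have := meas_ge_le_lintegral_div (μ := P) (f := fun x => ENNReal.ofReal |f' n x|)
    hin.abs.aestronglyMeasurable.aemeasurable.ennreal_ofReal (ε := ENNReal.ofReal ε)
    (by simpa using hε) ENNReal.ofReal_ne_top
  rw [ENNReal.ofReal_div_of_pos hε, ofReal_integral_eq_lintegral_ofReal hin.abs
    (ae_of_all _ fun _ => abs_nonneg _)]
  refine le_trans (measure_mono fun x hx => ?_) this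
  exact ENNReal.ofReal_le_ofReal hx

/-- By Markov on the tail, the left side is at most `E |f| 1{n < |f|}`, which tends to zero by
dominated convergence. A union bound over `n` observations therefore costs nothing in the limit. -/
theorem tendsto_mul_measureReal_lt {α : Type*} [MeasurableSpace α] {m : Measure α} {f : α → ℝ}
    [IsProbabilityMeasure m] (hfm : Measurable f) (hf : Integrable f m) :
    Tendsto (fun n : ℕ => n * m.real {x | (n : ℝ) < |f x|}) atTop (𝓝 0) := by
  have hA : ∀ n : ℕ, MeasurableSet {x | (n : ℝ) < |f x|} := fun n =>
    measurableSet_lt measurable_const hfm.abs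
  have key : Tendsto (fun n : ℕ => ∫ x, {x | (n : ℝ) < |f x|}.indicator (fun x => |f x|) x ∂m) atTop
      (𝓝 0) := by
    rw [← integral_zero α ℝ (μ := m)]
    refine tendsto_integral_of_dominated_convergence (fun x => |f x|)
      (fun n => (hf.abs.indicator (hA n)).aestronglyMeasurable) hf.abs
      (fun n => ae_of_all _ fun x => ?_) (ae_of_all _ fun x => ?_)
    · exact (norm_indicator_le_norm_self _ _).trans_eq (by simp)
    · refine tendsto_const_nhds.congr' ?_
      filter_upwards [eventually_ge_atTop ⌈|f x|⌉₊] with n hn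
      rw [Set.indicator_of_notMem]
      simp only [Set.mem_ofPred_eq, not_lt]
      exact (Nat.le_ceil _).trans (by exact_mod_cast hn)
  refine squeeze_zero (fun n => by positivity) (fun n => ?_) key
  have e : n * m.real {x | (n : ℝ) < |f x|}
      = ∫ x, {x | (n : ℝ) < |f x|}.indicator (fun _ => (n : ℝ)) x ∂m := by
    rw [integral_indicator_const _ (hA n), smul_eq_mul, mul_comm]
  rw [e]
  refine integral_mono ((integrable_const _).indicator (hA n)) (hf.abs.indicator (hA n)) fun x => ?_
  refine Set.indicator_le_indicator' fun hx => ?_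
  exact le_of_lt hx

/-- Truncation to zero of the values above a level. -/
def trunc {α : Type*} (f : α → ℝ) (N : ℝ) (x : α) : ℝ := if |f x| ≤ N then f x else 0

theorem memLp_trunc {α : Type*} [MeasurableSpace α] {m : Measure α} {f : α → ℝ}
    [IsProbabilityMeasure m] (hfm : Measurable f) (hf : Integrable f m) {N : ℝ} (hN : 0 ≤ N) :
    MemLp (trunc f N) 2 m ∧ ∫ x, trunc f N x ^ 2 ∂m ≤ N * ∫ x, |f x| ∂m := by
  have hm : Measurable (trunc f N) :=
    Measurable.ite (measurableSet_le hfm.abs measurable_const) hfm measurable_const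
  have h : MemLp (trunc f N) 2 m := MemLp.of_bound hm.aestronglyMeasurable N
    (ae_of_all _ fun x => by
      unfold trunc; split_ifs with hx
      · exact hx
      · simpa using hN)
  refine ⟨h, ?_⟩
  rw [← integral_const_mul]
  refine integral_mono h.integrable_sq (hf.abs.const_mul N) fun x => ?_
  simp only [trunc]
  split_ifs with hx
  · rw [← sq_abs, sq]; exact mul_le_mul_of_nonneg_right hx (abs_nonneg _)
  · have := abs_nonneg (f x); simpa using mul_nonneg hN this

/-! ### Consistency of the variance estimator. -/

section

variable {𝒳 𝒴 : Type*} [MeasurableSpace 𝒳] [MeasurableSpace 𝒴] {μ : Measure 𝒳} {ν : Measure 𝒴}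
  [IsProbabilityMeasure μ] [IsProbabilityMeasure ν] {ζ : 𝒳 → 𝒳 → ℝ} {η : 𝒴 → 𝒴 → ℝ}
  {k g : ℝ → ℝ}

theorem tendsto_meanSq_lifted_div (hη : IsL2Kernel η ν) (hk : IsSmoother k) (hg : IsDensity g)
    {b : ℕ → ℝ} (hb : ∀ n, 0 < b n) (hb0 : Tendsto b atTop (𝓝 0)) :
    Tendsto (fun n => meanSq (lifted η k (b n)) (ν.prod (lifterLaw g)) / b n) atTop
      (𝓝 (meanSq η ν * ((∫ u, k u ^ 2) * ∫ z, g z ^ 2))) := by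
  have := hg.isProbabilityMeasure
  refine ((tendsto_integral_mul_corr hg hk.integrable_sq hb0).const_mul (meanSq η ν)).congr
    fun n => ?_
  have := (hb n).ne'
  rw [meanSq_lifted hη (isL2Kernel_kappa hk hg (hb n)), meanSq_kappa hk hg (hb n)]
  field_simp

/-- The second moment and its centred version differ by `2 meanCross - mean²`, which lies between
`0` and `O(b²)`; at scale `b` they have the same limit. -/
theorem tendsto_centredSq_lifted_div (hη : IsL2Kernel η ν) (hk : IsSmoother k) (hg : IsDensity g)
    {b : ℕ → ℝ} (hb : ∀ n, 0 < b n) (hb0 : Tendsto b atTop (𝓝 0)) :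
    Tendsto (fun n => centredSq (lifted η k (b n)) (ν.prod (lifterLaw g)) / b n) atTop
      (𝓝 (meanSq η ν * ((∫ u, k u ^ 2) * ∫ z, g z ^ 2))) := by
  have := hg.isProbabilityMeasure
  have h0 : Tendsto (fun n => (2 * meanCross (lifted η k (b n)) (ν.prod (lifterLaw g))
      - mean (lifted η k (b n)) (ν.prod (lifterLaw g)) ^ 2) / b n) atTop (𝓝 0) := by
    have hr := hb0.const_mul (2 * (3 * meanCross η ν * ∫ z, g z ^ 3))
    rw [mul_zero] at hr
    refine squeeze_zero (fun n => ?_) (fun n => ?_) hr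
    · have hψ := isL2Kernel_lifted hη (isL2Kernel_kappa hk hg (hb n))
      have h1 := hψ.mean_sq_le
      have h2 := hψ.meanCross_nonneg
      exact div_nonneg (by linarith) (hb n).le
    · rw [div_le_iff₀ (hb n)]
      have h1 := meanCross_lifted_le hη hk hg (hb n)
      nlinarith [sq_nonneg (mean (lifted η k (b n)) (ν.prod (lifterLaw g)))]
  have h := (tendsto_meanSq_lifted_div hη hk hg hb hb0).sub h0
  rw [sub_zero] at h
  refine h.congr fun n => ?_
  rw [centredSq]; ring

variable {Ω : Type*} [MeasurableSpace Ω] {P : Measure Ω} [IsProbabilityMeasure P]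
  {X : ℕ → Ω → 𝒳} {Y : ℕ → Ω → 𝒴} {Z : ℕ → Ω → ℝ}

theorem tendsto_measure_exists_lt {S : Type*} [MeasurableSpace S] {m : Measure S}
    [IsProbabilityMeasure m] {U : ℕ → Ω → S} (hU : ∀ i, MeasurePreserving (U i) P m) {f : S → ℝ}
    (hfm : Measurable f) (hf : Integrable f m) :
    Tendsto (fun n : ℕ => P {s | ∃ i : Fin n, (n : ℝ) < |f (U i s)|}) atTop (𝓝 0) := by
  have h := ENNReal.tendsto_ofReal (tendsto_mul_measureReal_lt hfm hf)
  rw [ENNReal.ofReal_zero] at h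
  refine tendsto_of_tendsto_of_tendsto_of_le_of_le tendsto_const_nhds h (fun _ => zero_le)
    fun n => ?_
  have hA : MeasurableSet {x | (n : ℝ) < |f x|} := measurableSet_lt measurable_const hfm.abs
  have e : {s | ∃ i : Fin n, (n : ℝ) < |f (U i s)|} = ⋃ i : Fin n, U i ⁻¹' {x | (n : ℝ) < |f x|} := by
    ext s; simp
  rw [e]
  refine (measure_iUnion_fintype_le P _).trans ?_
  simp only [(hU _).measure_preimage hA.nullMeasurableSet, Finset.sum_const, Finset.card_univ,
    Fintype.card_fin, nsmul_eq_mul]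
  rw [ENNReal.ofReal_mul (Nat.cast_nonneg _), ENNReal.ofReal_natCast, ofReal_measureReal]

/-- The diagonal of the kernel `η κ_b`, truncated. -/
def liftedDiag (η : 𝒴 → 𝒴 → ℝ) (k : ℝ → ℝ) (N : ℝ) (v : 𝒴 × ℝ) : ℝ :=
  trunc (fun y => η y y) N v.1 * k 0

theorem memLp_liftedDiag {l : Measure ℝ} [IsProbabilityMeasure l]
    (hηm : Measurable fun y => η y y) (hηi : Integrable (fun y => η y y) ν) {N : ℝ} (hN : 0 ≤ N) :
    MemLp (liftedDiag η k N) 2 (ν.prod l) ∧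
    ∫ v, liftedDiag η k N v ^ 2 ∂(ν.prod l) ≤ k 0 ^ 2 * (∫ y, |η y y| ∂ν) * N := by
  obtain ⟨h1, h2⟩ := memLp_trunc hηm hηi hN
  have h3 : MemLp (fun v : 𝒴 × ℝ => trunc (fun y => η y y) N v.1) 2 (ν.prod l) :=
    h1.comp_measurePreserving measurePreserving_fst
  have h4 : HasMean (fun y => trunc (fun y => η y y) N y ^ 2) ν _ := ⟨h1.integrable_sq, rfl⟩
  have h5 := ((h4.comp (measurePreserving_fst (μ := ν) (ν := l))).const_mul (k 0 ^ 2)).2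
  refine ⟨h3.mul_const (k 0), ?_⟩
  simp only [liftedDiag, mul_pow]
  simp only [mul_comm _ (k 0 ^ 2)]
  rw [h5, mul_assoc]
  refine mul_le_mul_of_nonneg_left ?_ (sq_nonneg _)
  rw [mul_comm]; exact h2

/-- When no diagonal value exceeds `n`, truncation at `n` is invisible. The diagonal of `η κ_b` is
`η y y * k 0`, so only the factor from `η` has to be truncated. -/
theorem Ssq_eq {n : ℕ} {b : ℝ} {x : ℕ → 𝒳} {y : ℕ → 𝒴} {z : ℕ → ℝ}
    (hx : ∀ i : Fin n, |ζ (x i) (x i)| ≤ n) (hy : ∀ i : Fin n, |η (y i) (y i)| ≤ n) :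
    Ssq ζ η k n b x y z = 2 * ((n : ℝ) - 4) * ((n : ℝ) - 5) /
      ((n : ℝ) ^ 2 * ((n : ℝ) - 1) ^ 2 * ((n : ℝ) - 2) * ((n : ℝ) - 3)) *
      estSum ζ (lifted η k b) (trunc (fun x => ζ x x) n) (liftedDiag η k n)
        ((fun i : Fin n => x i), fun i : Fin n => (y i, z i)) := by
  have e1 : (gramX ζ n x : Fin n → Fin n → ℝ)
      = withDiag ζ (trunc (fun x => ζ x x) n) (fun i : Fin n => x i) := by
    funext i j
    simp only [gramX, withDiag, trunc, Matrix.of_apply]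
    split_ifs with h h'
    · rw [h]
    · exact absurd (hx i) h'
    · rfl
  have e2 : (gramYZ η k n b y z : Fin n → Fin n → ℝ)
      = withDiag (lifted η k b) (liftedDiag η k n) (fun i : Fin n => (y i, z i)) := by
    funext i j
    simp only [gramYZ, withDiag, liftedDiag, trunc, Matrix.of_apply, lifted]
    split_ifs with h h'
    · rw [h, kappa, sub_self, zero_div]
    · exact absurd (hy i) h'
    · rfl
  rw [Ssq, estSum]
  congr 1
  refine Finset.sum_congr rfl fun i _ => Finset.sum_congr rfl fun j _ => ?_
  simp only [ne_eq, ite_not]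
  refine ite_congr rfl (fun _ => rfl) fun _ => ?_
  simp only [matM, Matrix.map_apply, Matrix.hadamard_apply]
  rw [centring_mul_mul_centring, centring_mul_mul_centring, e1, e2]

theorem tendstoInMeasure_Ssq (hX : ∀ i, Measurable (X i)) (hY : ∀ i, Measurable (Y i))
    (hZ : ∀ i, Measurable (Z i)) (hg : IsDensity g)
    (hlaw : ∀ i, P.map (fun s => ((X i s, Y i s), Z i s)) = (μ.prod ν).prod (lifterLaw g))
    (hind : iIndepFun (fun i s => ((X i s, Y i s), Z i s)) P)
    (hζ : IsL2Kernel ζ μ) (hη : IsL2Kernel η ν) (hk : IsSmoother k)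
    (hζi : Integrable (fun x => ζ x x) μ) (hηi : Integrable (fun y => η y y) ν)
    {b : ℕ → ℝ} (hb : ∀ n, 0 < b n) (hb0 : Tendsto b atTop (𝓝 0))
    (hnb : Tendsto (fun n : ℕ => n * b n) atTop atTop) :
    TendstoInMeasure P
      (fun (n : ℕ) s => (n : ℝ) ^ 2 / b n * (Ssq ζ η k n (b n) (X · s) (Y · s) (Z · s)
        - variance (fun s' => T ζ η k n (b n) (X · s') (Y · s') (Z · s')) P))
      atTop (fun _ => 0) ∧
    (centredSq ζ μ ≠ 0 → meanSq η ν ≠ 0 →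
      TendstoInMeasure P
        (fun (n : ℕ) s => Ssq ζ η k n (b n) (X · s) (Y · s) (Z · s)
          / variance (fun s' => T ζ η k n (b n) (X · s') (Y · s') (Z · s')) P)
        atTop (fun _ => 1)) := by
  have := hg.isProbabilityMeasure
  set l := lifterLaw g
  have hζm : Measurable fun x => ζ x x := hζ.meas.comp (measurable_id.prodMk measurable_id)
  have hηm : Measurable fun y => η y y := hη.meas.comp (measurable_id.prodMk measurable_id)
  have hXl : ∀ i, MeasurePreserving (X i) P μ := fun i =>
    (measurePreserving_fst.comp measurePreserving_fst).comp
      (⟨((hX i).prodMk (hY i)).prodMk (hZ i), hlaw i⟩ :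
        MeasurePreserving (fun s => ((X i s, Y i s), Z i s)) P ((μ.prod ν).prod l))
  have hYl : ∀ i, MeasurePreserving (Y i) P ν := fun i =>
    (measurePreserving_snd.comp measurePreserving_fst).comp
      (⟨((hX i).prodMk (hY i)).prodMk (hZ i), hlaw i⟩ :
        MeasurePreserving (fun s => ((X i s, Y i s), Z i s)) P ((μ.prod ν).prod l))
  set B : ℕ → Set Ω := fun n => {s | ∃ i : Fin n, (n : ℝ) < |ζ (X i s) (X i s)|} ∪
    {s | ∃ i : Fin n, (n : ℝ) < |η (Y i s) (Y i s)|}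
  have hB : Tendsto (fun n => P (B n)) atTop (𝓝 0) := by
    have h := (tendsto_measure_exists_lt hXl hζm hζi).add (tendsto_measure_exists_lt hYl hηm hηi)
    rw [add_zero] at h
    exact tendsto_of_tendsto_of_tendsto_of_le_of_le tendsto_const_nhds h (fun _ => zero_le)
      fun n => measure_union_le _ _
  set W := centredSq ζ μ
  set V : ℕ → ℝ := fun n => centredSq (lifted η k (b n)) (ν.prod l)
  set h : ℕ → ℝ := fun n => W * meanSq (lifted η k (b n)) (ν.prod l)
  set L := W * (meanSq η ν * ((∫ u, k u ^ 2) * ∫ z, g z ^ 2)) with hL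
  have hvar : ∀ n : ℕ, 4 ≤ n → variance (fun s => T ζ η k n (b n) (X · s) (Y · s) (Z · s)) P
      = 2 * W * V n / (n * (n - 3)) := fun n hn =>
    (memLp_and_variance_T hX hY hZ hlaw hind hζ hη (isL2Kernel_kappa hk hg (hb n)) hk.even hn).2
  set Φ : (n : ℕ) → Ω → (Fin n → 𝒳) × (Fin n → 𝒴 × ℝ) := fun n s =>
    ((fun i : Fin n => X i s), fun i : Fin n => (Y i s, Z i s))
  have hΦ := fun n => measurePreserving_sample hX hY hZ hlaw hind n
  set E : (n : ℕ) → (Fin n → 𝒳) × (Fin n → 𝒴 × ℝ) → ℝ := fun n p =>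
    estSum ζ (lifted η k (b n)) (trunc (fun x => ζ x x) n) (liftedDiag η k n) p
      - n * (n - 1) * h n
  set K := max (∫ x, |ζ x x| ∂μ) (k 0 ^ 2 * ∫ y, |η y y| ∂ν)
  have d1 : ∀ n : ℕ, MemLp (trunc (fun x => ζ x x) n) 2 μ := fun n =>
    (memLp_trunc hζm hζi (Nat.cast_nonneg n)).1
  have d2 : ∀ n : ℕ, ∫ x, trunc (fun x => ζ x x) n x ^ 2 ∂μ ≤ K * n := fun n => by
    refine (memLp_trunc hζm hζi (Nat.cast_nonneg n)).2.trans ?_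
    rw [mul_comm]
    exact mul_le_mul_of_nonneg_right (le_max_left _ _) (Nat.cast_nonneg n)
  have d3 : ∀ n : ℕ, MemLp (liftedDiag η k n) 2 (ν.prod l) := fun n =>
    (memLp_liftedDiag hηm hηi (Nat.cast_nonneg n)).1
  have d4 : ∀ n : ℕ, ∫ v, liftedDiag η k n v ^ 2 ∂(ν.prod l) ≤ K * n := fun n =>
    (memLp_liftedDiag hηm hηi (Nat.cast_nonneg n)).2.trans
      (mul_le_mul_of_nonneg_right (le_max_right _ _) (Nat.cast_nonneg n))
  have hE := tendsto_integral_abs_estSum_sub hζ hη hk hg hb hb0 hnb d1 d3 d2 d4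
  have hEi : ∀ n : ℕ, 0 < n → Integrable (fun s => E n (Φ n s)) P := fun n hn =>
    (hΦ n).integrable_comp_of_integrable
      (abs_estSum_sub_bound hζ hη hk hg (hb n) hn one_pos (d1 n) (d3 n) (d2 n) (d4 n)).1
  have hEP : ∀ n : ℕ, 0 < n → ∫ s, |E n (Φ n s)| ∂P = ∫ p, |E n p|
      ∂((Measure.pi fun _ : Fin n => μ).prod (Measure.pi fun _ : Fin n => ν.prod l)) := fun n hn =>
    (HasMean.comp ⟨(abs_estSum_sub_bound hζ hη hk hg (hb n) hn one_pos (d1 n) (d3 n) (d2 n)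
      (d4 n)).1.abs, rfl⟩ (hΦ n)).2
  -- The normalisation of the estimator multiplied by `n⁴ / 2`.
  set θ : ℕ → ℝ := fun n => (1 - 4 / (n : ℝ)) * (1 - 5 / (n : ℝ)) /
    ((1 - 1 / (n : ℝ)) ^ 2 * (1 - 2 / (n : ℝ)) * (1 - 3 / (n : ℝ)))
  have hθ : Tendsto θ atTop (𝓝 1) := by
    have := ((tendsto_one_sub_div 4).mul (tendsto_one_sub_div 5)).div
      ((((tendsto_one_sub_div 1).pow 2).mul (tendsto_one_sub_div 2)).mul (tendsto_one_sub_div 3))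
      (by norm_num)
    simp only [one_pow, mul_one, div_one] at this
    exact this
  set r : ℕ → ℝ := fun n => 2 * (W * (V n / b n)) / (1 - 3 / (n : ℝ))
  have hr : Tendsto r atTop (𝓝 (2 * L)) := by
    have := (((tendsto_centredSq_lifted_div hη hk hg hb hb0).const_mul W).const_mul 2).div
      (tendsto_one_sub_div 3) one_ne_zero
    rw [div_one] at this
    exact this
  -- The deterministic bias: the rescaled centring constant of the sum of squares minus the rescaled
  -- variance. Both tend to `2 * L`.
  set d : ℕ → ℝ := fun n => 2 * (θ n * (1 - 1 / (n : ℝ)) *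
    (W * (meanSq (lifted η k (b n)) (ν.prod l) / b n))) - r n
  have hd : Tendsto d atTop (𝓝 0) := by
    have := (((hθ.mul (tendsto_one_sub_div 1)).mul
      ((tendsto_meanSq_lifted_div hη hk hg hb hb0).const_mul W)).const_mul 2).sub hr
    simp only [mul_one, one_mul] at this
    rw [← hL, sub_self] at this
    exact this
  set f' : ℕ → Ω → ℝ := fun n s => 2 * θ n * (E n (Φ n s) / ((n : ℝ) ^ 2 * b n)) + d n
  have hf'i : ∀ n : ℕ, 0 < n → Integrable (f' n) P := fun n hn =>
    (((hEi n hn).div_const _).const_mul _).add (integrable_const _)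
  have hf' : Tendsto (fun n => ∫ s, |f' n s| ∂P) atTop (𝓝 0) := by
    have hu := ((hθ.abs.const_mul 2).mul hE).add hd.abs
    simp only [abs_one, mul_one, mul_zero, abs_zero, add_zero] at hu
    refine tendsto_of_tendsto_of_tendsto_of_le_of_le' tendsto_const_nhds hu
      (Eventually.of_forall fun n => integral_nonneg fun _ => abs_nonneg _) ?_
    filter_upwards [eventually_gt_atTop 0] with n hn
    have hbn := hb n
    have hm : HasMean (fun s => |E n (Φ n s)|) P _ := ⟨(hEi n hn).abs, rfl⟩
    have hc := (hm.const_mul (2 * |θ n| / ((n : ℝ) ^ 2 * b n))).add (.const |d n|)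
    refine (integral_mono (hf'i n hn).abs hc.1 fun s => ?_).trans (hc.2.trans_le ?_)
    · refine (abs_add_le _ _).trans (le_of_eq ?_)
      rw [abs_mul, abs_mul, abs_div (E n _), abs_two, abs_of_pos (show 0 < (n : ℝ) ^ 2 * b n by
        have : (0 : ℝ) < n := by exact_mod_cast hn
        positivity)]
      ring
    · rw [hEP n hn]
      exact le_of_eq (by ring)
  have hpos : ∀ n : ℕ, 6 ≤ n → (n : ℝ) ≠ 0 ∧ (n : ℝ) - 1 ≠ 0 ∧ (n : ℝ) - 2 ≠ 0 ∧ (n : ℝ) - 3 ≠ 0 := by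
    intro n hn
    have : (6 : ℝ) ≤ n := by exact_mod_cast hn
    refine ⟨?_, ?_, ?_, ?_⟩ <;> exact ne_of_gt (by linarith)
  have hrv : ∀ n : ℕ, 6 ≤ n → (n : ℝ) ^ 2 / b n *
      variance (fun s => T ζ η k n (b n) (X · s) (Y · s) (Z · s)) P = r n := by
    intro n hn
    obtain ⟨h0, -, -, h3⟩ := hpos n hn
    have := (hb n).ne'
    rw [hvar n (by omega)]
    simp only [r]
    field_simp
  have key : ∀ n : ℕ, 6 ≤ n → ∀ s, s ∉ B n → (n : ℝ) ^ 2 / b n *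
      (Ssq ζ η k n (b n) (X · s) (Y · s) (Z · s)
        - variance (fun s' => T ζ η k n (b n) (X · s') (Y · s') (Z · s')) P) = f' n s := by
    intro n hn s hs
    obtain ⟨h0, h1, h2, h3⟩ := hpos n hn
    have hbn := (hb n).ne'
    simp only [B, Set.mem_union, Set.mem_ofPred_eq, not_or, not_exists, not_lt] at hs
    rw [mul_sub, hrv n hn, Ssq_eq hs.1 hs.2]
    simp only [f', d, E, θ, h, Φ]
    field_simp
    ring
  refine ⟨tendstoInMeasure_const_of_integral
    (eventually_atTop.2 ⟨1, fun n hn => hf'i n hn⟩) hf' hB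
    (eventually_atTop.2 ⟨6, fun n hn s hs => by rw [sub_zero]; exact key n hn s hs⟩), ?_⟩
  intro hW hη0
  have hL0 : 2 * L ≠ 0 :=
    mul_ne_zero two_ne_zero (mul_ne_zero hW (mul_ne_zero hη0
      (mul_ne_zero hk.integral_sq_pos.ne' hg.integral_sq_pos.ne')))
  -- The ratio minus one is the rescaled difference divided by the rescaled variance `r n`, whose
  -- limit `2 * L` is nonzero.
  have hq : Tendsto (fun n => ∫ s, |(r n)⁻¹ * f' n s| ∂P) atTop (𝓝 0) := by
    have := (hr.inv₀ hL0).abs.mul hf'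
    rw [mul_zero] at this
    refine this.congr fun n => ?_
    rw [← integral_const_mul]
    simp only [abs_mul]
  refine tendstoInMeasure_const_of_integral
    (eventually_atTop.2 ⟨1, fun n hn => (hf'i n hn).const_mul (r n)⁻¹⟩) hq hB ?_
  filter_upwards [eventually_ge_atTop 6, hr.eventually_ne hL0] with n hn hrn s hs
  rw [← key n hn s hs, ← hrv n hn]
  rw [← hrv n hn] at hrn
  have hv := right_ne_zero_of_mul hrn
  have hn0 := left_ne_zero_of_mul hrn
  have h0 := (hpos n hn).1
  have hbn := (hb n).ne'
  field_simp

end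

end RandomLifter

end

/-! ### The proposition. -/

theorem mainTheorem2 {𝒳 𝒴 Ω : Type*} [MeasurableSpace 𝒳] [MeasurableSpace 𝒴] [MeasurableSpace Ω]
    -- the kernels on the two spaces
    (ζ : 𝒳 → 𝒳 → ℝ) (η : 𝒴 → 𝒴 → ℝ)
    (hζm : Measurable (Function.uncurry ζ)) (hηm : Measurable (Function.uncurry η))
    (hζs : ∀ x x', ζ x x' = ζ x' x) (hηs : ∀ y y', η y y' = η y' y)
    -- the kernel of the random lifter
    (k : ℝ → ℝ) (δ : ℝ) (hδ : 0 < δ) (hkm : Measurable k) (hk0 : ∀ u, 0 ≤ k u)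
    (hk1 : ∫ u, k u = 1) (hkδ : Integrable (fun u => k u ^ (2 + δ)))
    (hks : ∀ u, k (-u) = k u)
    -- the density of the random lifter
    (g : ℝ → ℝ) (hgm : Measurable g) (hg0 : ∀ z, 0 ≤ g z) (hg1 : ∫ z, g z = 1)
    (hg4 : Integrable (fun z => g z ^ 3) (RandomLifter.lifterLaw g))
    -- the laws; the null hypothesis
    (μ : Measure 𝒳) (ν : Measure 𝒴) (ω : Measure (𝒳 × 𝒴))
    [IsProbabilityMeasure μ] [IsProbabilityMeasure ν]
    (hH₀ : ω = μ.prod ν)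
    (hζ2 : Integrable (fun p : 𝒳 × 𝒳 => ζ p.1 p.2 ^ 2) (μ.prod μ))
    (hη2 : Integrable (fun p : 𝒴 × 𝒴 => η p.1 p.2 ^ 2) (ν.prod ν))
    -- an i.i.d. sample of (X, Y) with law ω, lifted by an independent Z with density g
    (P : Measure Ω) [IsProbabilityMeasure P]
    (X : ℕ → Ω → 𝒳) (Y : ℕ → Ω → 𝒴) (Z : ℕ → Ω → ℝ)
    (hX : ∀ i, Measurable (X i)) (hY : ∀ i, Measurable (Y i)) (hZ : ∀ i, Measurable (Z i))
    (hlaw : ∀ i, P.map (fun s => ((X i s, Y i s), Z i s)) = ω.prod (RandomLifter.lifterLaw g))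
    (hind : iIndepFun (fun i s => ((X i s, Y i s), Z i s)) P) :
    -- the variance expansion
    ((∃ L, LipschitzOnWith L g (RandomLifter.lifterSupport g)) →
      Integrable (fun u => |u| * k u ^ 2) →
      ∀ c : ℝ, 0 < c → ∃ C : ℝ, ∀ n : ℕ, 4 ≤ n → ∀ b : ℝ, 0 < b → c ≤ n * b →
        MemLp (fun s => RandomLifter.T ζ η k n b (X · s) (Y · s) (Z · s)) 2 P ∧
        |variance (fun s => RandomLifter.T ζ η k n b (X · s) (Y · s) (Z · s)) P
            - RandomLifter.mainVar ζ η k g μ ν n b| ≤ C * (b ^ 2 / (n : ℝ) ^ 2)) ∧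
    -- the order of the leading expression
    (RandomLifter.centredSq ζ μ ≠ 0 → RandomLifter.meanSq η ν ≠ 0 →
      ∀ b : ℕ → ℝ, (∀ n, 0 < b n) → Tendsto b atTop (𝓝 0) →
        Tendsto (fun n : ℕ => n * b n) atTop atTop →
        (fun n : ℕ => RandomLifter.mainVar ζ η k g μ ν n (b n))
          =Θ[atTop] (fun n : ℕ => b n / (n : ℝ) ^ 2)) ∧
    -- consistency of the variance estimator
    (Integrable (fun p : 𝒳 × 𝒳 => |ζ p.1 p.2| ^ (2 + δ)) (μ.prod μ) →
      Integrable (fun p : 𝒴 × 𝒴 => |η p.1 p.2| ^ (2 + δ)) (ν.prod ν) →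
      Integrable (fun x => ζ x x) μ → Integrable (fun y => η y y) ν →
      ∀ b : ℕ → ℝ, (∀ n, 0 < b n) → Tendsto b atTop (𝓝 0) →
        Tendsto (fun n : ℕ => n * b n) atTop atTop →
        TendstoInMeasure P
          (fun (n : ℕ) s => (n : ℝ) ^ 2 / b n *
            (RandomLifter.Ssq ζ η k n (b n) (X · s) (Y · s) (Z · s)
              - variance (fun s' => RandomLifter.T ζ η k n (b n) (X · s') (Y · s') (Z · s')) P))
          atTop (fun _ => 0) ∧
        (RandomLifter.centredSq ζ μ ≠ 0 → RandomLifter.meanSq η ν ≠ 0 →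
          TendstoInMeasure P
            (fun (n : ℕ) s => RandomLifter.Ssq ζ η k n (b n) (X · s) (Y · s) (Z · s)
              / variance (fun s' => RandomLifter.T ζ η k n (b n) (X · s') (Y · s') (Z · s')) P)
            atTop (fun _ => 1))) := by
  subst hH₀
  have hζ : RandomLifter.IsL2Kernel ζ μ :=
    ⟨hζm, hζs, (memLp_two_iff_integrable_sq hζm.aestronglyMeasurable).2 hζ2⟩
  have hη : RandomLifter.IsL2Kernel η ν :=
    ⟨hηm, hηs, (memLp_two_iff_integrable_sq hηm.aestronglyMeasurable).2 hη2⟩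
  have hk := RandomLifter.isSmoother_of_rpow hδ hkm hk0 hk1 hkδ hks
  have hg : RandomLifter.IsDensity g := ⟨hgm, hg0, hg1, hg4⟩
  have := hg.isProbabilityMeasure
  refine ⟨?_, fun hW hV b hb hb0 _ => RandomLifter.isTheta_mainVar hk hg hW hV hb hb0,
    fun _ _ hζi hηi b hb hb0 hnb =>
      RandomLifter.tendstoInMeasure_Ssq hX hY hZ hg hlaw hind hζ hη hk hζi hηi hb hb0 hnb⟩
  rintro ⟨L, hL⟩ hku c hc
  obtain ⟨C, hC⟩ := RandomLifter.variance_expansion hζ hη hk hg hL hku hc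
  refine ⟨C, fun n hn b hb hcb => ?_⟩
  obtain ⟨h1, h2⟩ := RandomLifter.memLp_and_variance_T (n := n) hX hY hZ hlaw hind hζ hη
    (RandomLifter.isL2Kernel_kappa hk hg hb) hks hn
  exact ⟨h1, h2 ▸ hC n hn b hb hcb⟩
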